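/- Let $d_1,d_2>0$, let $\Omega=\mathbb R\times(-d_2,d_1)$, and let $m$ be the measure $dx\otimes\delta(y)$ on $\Omega$, carried by the line $y=0$, so that $L^2(m)\cong L^2(\mathbb R,dx)$. Let $I_m:H^1_0(\Omega)\to L^2(m)$ be the trace operator, the continuous extension of $\varphi\mapsto\varphi(\cdot,0)$, $\varphi\in C_c^\infty(\Omega)$. For a Borel function $\alpha:\mathbb R\to\mathbb R$ let $H_\alpha$ (formally $-\Delta_D^\Omega+\alpha(x)\delta(y)$) be the self-adjoint operator in $L^2(\Omega)$ associated with the form $$\mathcal E_\alpha(\varphi,\psi)=\int_\Omega\overline{\nabla\varphi}\cdot\nabla\psi\,dx\,dy+\int_{\mathbb R}\alpha\,\overline{I_m\varphi}\,I_m\psi\,dx,\qquad D(\mathcal E_\alpha)=H^1_0(\Omega).$$ Let $\alpha_0\in\mathbb R$ be a constant and suppose that $\alpha-\alpha_0\in L^{1+\varepsilon}(\mathbb R,dx)$ for some $\varepsilon>0$ and $\alpha-\alpha_0\in L^1(\mathbb R,|x|\,dx)$. Let $$\mathbb C^+=\{k\in\mathbb C:\ (\operatorname{Im}k>0\ \text{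 or }\ k^2\in[0,\inf\sigma(H_{\alpha_0})))\ \text{ and }\ k^2\in\rho(H_{\alpha_0})\}.$$ For $k\in\mathbb C^+$ put $R^k_{dx,m}(\alpha_0)=I_m(H_{\alpha_0}-k^2)^{-1}$, $R^k_{m,dx}(\alpha_0)=\big(I_m(H_{\alpha_0}-\overline{k}^{\,2})^{-1}\big)^*$ and $R^k_{m,m}(\alpha_0)=I_mR^k_{m,dx}(\alpha_0)$, the two-sided trace of the resolvent on $L^2(m)$, and $$K_\alpha^k=|\alpha-\alpha_0|^{1/2}\,R^k_{m,m}(\alpha_0)\,(\alpha-\alpha_0)^{1/2},\qquad (\alpha-\alpha_0)^{1/2}:=|\alpha-\alpha_0|^{1/2}\operatorname{sgn}(\alpha-\alpha_0),$$ understood as the closure in $L^2(m)$ of the product of these operators on its natural domain. Then: (i) for every $k\in\mathbb C^+$, $K_\alpha^k$ is (well defined, everywhere defined on $L^2(m)$ and) a Hilbert–Schmidt operator; (ii) there is $\kappa_0>0$ such that for every $\kappa\ge\kappa_0$ one has $i\kappa\in\mathbb C^+$ and $I+K_\alpha^{i\kappa}$ has a bounded inverse on $L^2(m)$; (iii) for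 every $k\in\mathbb C^+$, $\dim\operatorname{Ker}(H_\alpha-k^2)=\dim\operatorname{Ker}(I+K_\alpha^k)$; (iv) (Birman–Schwinger principle) for every $k\in\mathbb C^+$, $k^2\in\sigma_{\mathrm{disc}}(H_\alpha)$ if and only if $-1\in\sigma_{\mathrm{disc}}(K_\alpha^k)$. Here $\sigma_{\mathrm{disc}}$ of the self-adjoint operator $H_\alpha$ is the set of isolated points of the spectrum that are eigenvalues of finite multiplicity, and $\sigma_{\mathrm{disc}}$ of the bounded operator $K_\alpha^k$ is the set of isolated points of its spectrum whose Riesz projection has finite rank. -/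

import Mathlib

open MeasureTheory Topology Filter Set
open scoped ContDiff ComplexConjugate

noncomputable section

namespace DoubleGuide

/-! ### Unbounded operators, spectra -/

section Spectral

variable {H : Type} [NormedAddCommGroup H] [InnerProductSpace ℂ H]

/-- `Ker (A - z)` for an unbounded operator `A`. -/
def kerSub (A : H →ₗ.[ℂ] H) (z : ℂ) : Submodule ℂ H :=
  A.graph.comap (LinearMap.id.prod (z • LinearMap.id))

/-- The resolvent set `ρ(A)`: those `z` for which `A - z` is a bijection of the domain of `A` onto
the whole space with a bounded inverse `R`, that is, `(A - z) x = y` if and only if `x = R y`. -/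
def resSet (A : H →ₗ.[ℂ] H) : Set ℂ :=
  {z | ∃ R : H →L[ℂ] H, ∀ x y : H, (x, y + z • x) ∈ A.graph ↔ x = R y}

/-- The spectrum `σ(A)`. -/
def spec (A : H →ₗ.[ℂ] H) : Set ℂ := (resSet A)ᶜ

/-- The discrete spectrum of a self-adjoint operator: the isolated points of the spectrum that are
eigenvalues of finite multiplicity. -/
def discSpec (A : H →ₗ.[ℂ] H) : Set ℂ :=
  {z | (∃ r > 0, Metric.ball z r ∩ spec A = {z}) ∧
    kerSub A z ≠ ⊥ ∧ FiniteDimensional ℂ (kerSub A z)}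

/-- The discrete spectrum of a bounded, not necessarily self-adjoint, operator: the isolated points
of the spectrum for which the Riesz projection `(2πi)⁻¹ ∮ (ζ - T)⁻¹ dζ` has finite rank. -/
def discSpecBdd [CompleteSpace H] (T : H →L[ℂ] H) : Set ℂ :=
  {z | ∃ r > 0, Metric.closedBall z r ∩ spectrum ℂ T = {z} ∧
    FiniteDimensional ℂ
      (LinearMap.range
        (((2 * Real.pi * Complex.I : ℂ)⁻¹ • ∮ ζ in C(z, r), resolvent T ζ : H →L[ℂ] H) :
          H →ₗ[ℂ] H))}

/-- Hilbert-Schmidt operators: `∑ ‖T eᵢ‖² < ∞` for an orthonormal basis (the value of the sum does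
not depend on the basis). -/
def IsHilbertSchmidt (T : H →L[ℂ] H) : Prop :=
  ∃ (ι : Type) (b : HilbertBasis ι ℂ H), Summable fun i => ‖T (b i)‖ ^ 2

end Spectral

/-! ### The strip, the Sobolev space and the trace on the barrier -/

/-- The double strip `Ω = ℝ × (-d₂, d₁)`. -/
def strip (d₁ d₂ : ℝ) : Set (ℝ × ℝ) := univ ×ˢ Ioo (-d₂) d₁

/-- `L²(Ω)`, complex valued. -/
abbrev L2Strip (d₁ d₂ : ℝ) : Type := Lp ℂ 2 ((volume : Measure (ℝ × ℝ)).restrict (strip d₁ d₂))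

/-- `L²(m)` for the measure `m = dx ⊗ δ(y)` on the barrier `y = 0`, identified with `L²(ℝ, dx)`. -/
abbrev L2Line : Type := Lp ℂ 2 (volume : Measure ℝ)

/-- The subspace of all `(ψ, ∂ψ/∂x, ∂ψ/∂y, I_m ψ)` with `ψ ∈ H¹₀(Ω)`: the closure, in
`L²(Ω) × L²(Ω) × L²(Ω) × L²(m)`, of the quadruples `(φ, ∂φ/∂x, ∂φ/∂y, φ(·, 0))` with
`φ ∈ C_c^∞(Ω)` (these already form a linear subspace). Since `‖φ(·, 0)‖` is bounded by the
`H¹`-norm of `φ`, the last entry is the continuous extension `I_m` of the restriction map. -/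
def sobolevTrace (d₁ d₂ : ℝ) :
    Submodule ℂ (L2Strip d₁ d₂ × L2Strip d₁ d₂ × L2Strip d₁ d₂ × L2Line) :=
  (Submodule.span ℂ
    {p | ∃ φ : ℝ × ℝ → ℂ, ContDiff ℝ ∞ φ ∧ HasCompactSupport φ ∧ tsupport φ ⊆ strip d₁ d₂ ∧
      p.1 =ᵐ[volume.restrict (strip d₁ d₂)] φ ∧
      p.2.1 =ᵐ[volume.restrict (strip d₁ d₂)] (fun q => fderiv ℝ φ q (1, 0)) ∧
      p.2.2.1 =ᵐ[volume.restrict (strip d₁ d₂)] (fun q => fderiv ℝ φ q (0, 1)) ∧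
      p.2.2.2 =ᵐ[volume] (fun x => φ (x, 0))}).topologicalClosure

/-- `ψ ∈ H¹₀(Ω)` and `I_m ψ = t`. -/
def HasTrace (d₁ d₂ : ℝ) (ψ : L2Strip d₁ d₂) (t : L2Line) : Prop :=
  ∃ ψx ψy, (ψ, ψx, ψy, t) ∈ sobolevTrace d₁ d₂

/-! ### The Hamiltonian -/

/-- The graph of the operator associated with the form
`E_α(φ, ψ) = ∫ conj(∇φ) · ∇ψ + ∫ α conj(I_m φ) (I_m ψ) dm` with form domain `H¹₀(Ω)`:
`H_α ψ = f` means `ψ ∈ H¹₀(Ω)` and `E_α(φ, ψ) = (φ, f)` for all `φ ∈ H¹₀(Ω)`. -/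
def hamGraph (d₁ d₂ : ℝ) (α : ℝ → ℝ) : Submodule ℂ (L2Strip d₁ d₂ × L2Strip d₁ d₂) where
  carrier := {p | ∃ ψx ψy t, (p.1, ψx, ψy, t) ∈ sobolevTrace d₁ d₂ ∧
    ∀ φ φx φy s, (φ, φx, φy, s) ∈ sobolevTrace d₁ d₂ →
      Integrable (fun x => (α x : ℂ) * conj (s x) * t x) ∧
      inner ℂ φx ψx + inner ℂ φy ψy + ∫ x, (α x : ℂ) * conj (s x) * t x = inner ℂ φ p.2}
  zero_mem' := by
    refine ⟨0, 0, 0, (sobolevTrace d₁ d₂).zero_mem, fun φ φx φy s _ => ?_⟩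
    have h : (fun x => (α x : ℂ) * conj (s x) * (0 : L2Line) x) =ᵐ[volume] fun _ => 0 := by
      filter_upwards [Lp.coeFn_zero ℂ 2 (volume : Measure ℝ)] with x hx
      rw [hx]; simp
    refine ⟨(integrable_congr h).2 (integrable_zero _ _ _), ?_⟩
    rw [integral_congr_ae h]
    simp
  add_mem' := by
    rintro ⟨a, f⟩ ⟨b, g⟩ ⟨ax, ay, t, ht, hE⟩ ⟨bx, bby, u, hu, hF⟩
    refine ⟨ax + bx, ay + bby, t + u, (sobolevTrace d₁ d₂).add_mem ht hu,
      fun φ φx φy s hs => ?_⟩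
    obtain ⟨i1, e1⟩ := hE φ φx φy s hs
    obtain ⟨i2, e2⟩ := hF φ φx φy s hs
    have h : (fun x => (α x : ℂ) * conj (s x) * (t + u : L2Line) x) =ᵐ[volume]
        fun x => (α x : ℂ) * conj (s x) * t x + (α x : ℂ) * conj (s x) * u x := by
      filter_upwards [Lp.coeFn_add t u] with x hx
      rw [hx, Pi.add_apply, mul_add]
    refine ⟨(integrable_congr h).2 (i1.add i2), ?_⟩
    rw [integral_congr_ae h, integral_add i1 i2]
    simp only [Prod.snd_add, inner_add_right]
    rw [← e1, ← e2]
    ring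
  smul_mem' := by
    rintro c ⟨a, f⟩ ⟨ax, ay, t, ht, hE⟩
    refine ⟨c • ax, c • ay, c • t, (sobolevTrace d₁ d₂).smul_mem c ht, fun φ φx φy s hs => ?_⟩
    obtain ⟨i1, e1⟩ := hE φ φx φy s hs
    have h : (fun x => (α x : ℂ) * conj (s x) * (c • t : L2Line) x) =ᵐ[volume]
        fun x => c * ((α x : ℂ) * conj (s x) * t x) := by
      filter_upwards [Lp.coeFn_smul c t] with x hx
      rw [hx, Pi.smul_apply, smul_eq_mul]
      ring
    refine ⟨(integrable_congr h).2 (i1.const_mul c), ?_⟩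
    rw [integral_congr_ae h, integral_const_mul]
    simp only [Prod.smul_snd, inner_smul_right]
    rw [← e1]
    ring

/-- The Hamiltonian `H_α = -Δ_D + α(x) δ(y)` on `L²(Ω)`. -/
def ham (d₁ d₂ : ℝ) (α : ℝ → ℝ) : L2Strip d₁ d₂ →ₗ.[ℂ] L2Strip d₁ d₂ :=
  (hamGraph d₁ d₂ α).toLinearPMap

/-- The reference Hamiltonian `H_{α₀}` with a constant coupling `α₀`. -/
def hamConst (d₁ d₂ a : ℝ) : L2Strip d₁ d₂ →ₗ.[ℂ] L2Strip d₁ d₂ := ham d₁ d₂ fun _ => a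

/-- The admissible spectral parameters: `Im k > 0` or `k² ∈ [0, inf σ(H_{α₀}))`, and in either case
`k² ∈ ρ(H_{α₀})`. -/
def admissible (d₁ d₂ a : ℝ) : Set ℂ :=
  {k | (0 < k.im ∨
      ∃ s : ℝ, k ^ 2 = (s : ℂ) ∧ 0 ≤ s ∧ s < sInf (Complex.re '' spec (hamConst d₁ d₂ a))) ∧
    k ^ 2 ∈ resSet (hamConst d₁ d₂ a)}

/-! ### Traces of the resolvent and the Birman-Schwinger operator -/

/-- `S = R^k_{dx,m}(α₀) = I_m (H_{α₀} - k²)⁻¹ : L²(Ω) → L²(m)`. -/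
def IsResolventTrace (d₁ d₂ a : ℝ) (k : ℂ) (S : L2Strip d₁ d₂ →L[ℂ] L2Line) : Prop :=
  ∀ h, ∃ ψ, (ψ, h + k ^ 2 • ψ) ∈ (hamConst d₁ d₂ a).graph ∧ HasTrace d₁ d₂ ψ (S h)

/-- `T = R^k_{m,m}(α₀) = I_m R^k_{m,dx}(α₀) : L²(m) → L²(m)`, where
`R^k_{m,dx}(α₀) = (R^{conj k}_{dx,m}(α₀))^* : L²(m) → L²(Ω)` has range in `H¹₀(Ω)`. -/
def IsResolventTraceTrace (d₁ d₂ a : ℝ) (k : ℂ) (T : L2Line →L[ℂ] L2Line) : Prop :=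
  ∃ S, IsResolventTrace d₁ d₂ a (conj k) S ∧
    ∀ f, HasTrace d₁ d₂ (ContinuousLinearMap.adjoint S f) (T f)

/-- The signed square root `v^{1/2} = |v|^{1/2} sgn v`. -/
def signedSqrt (v : ℝ) : ℝ := Real.sign v * √|v|

/-- The graph of the product `|α - α₀|^{1/2} T (α - α₀)^{1/2}` on its natural domain in `L²(m)`: the
`f` for which `w = (α - α₀)^{1/2} f` and `g = |α - α₀|^{1/2} T w` are in `L²(m)`. -/
def sandwichGraph (α : ℝ → ℝ) (a : ℝ) (T : L2Line →L[ℂ] L2Line) : Set (L2Line × L2Line) :=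
  {p | ∃ w : L2Line,
    w =ᵐ[volume] (fun x => (signedSqrt (α x - a) : ℂ) * p.1 x) ∧
    p.2 =ᵐ[volume] (fun x => ((√|α x - a| : ℝ) : ℂ) * T w x)}

/-- `K = K_α^k = |α - α₀|^{1/2} R^k_{m,m}(α₀) (α - α₀)^{1/2}` as a bounded operator on `L²(m)`: the
closure of the product, whose factors are multiplications by possibly unbounded functions, is
everywhere defined and equal to `K`. -/
def IsBirmanSchwinger (d₁ d₂ : ℝ) (α : ℝ → ℝ) (a : ℝ) (k : ℂ) (K : L2Line →L[ℂ] L2Line) : Prop :=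
  ∃ T, IsResolventTraceTrace d₁ d₂ a k T ∧ closure (sandwichGraph α a T) = {p | p.2 = K p.1}

end DoubleGuide

end

/-! The form domain H¹₀(Ω) becomes a Hilbert space `FormSpace` on which the embedding j into L²(Ω),
the two partial derivatives and the trace I_m are all bounded. A form operator is then encoded by a
bounded operator A, and spectral questions at z become questions about the bounded operator A - z
j*j (`IsFormOperator.mem_resSet_iff`, `IsFormOperator.mem_kerSub`). Write V = α - α₀, M = |V|^{1/2}
I_m and σ = sgn V. The Hamiltonian with constant coupling has an operator A₀, the perturbed one has
A = A₀ + M*σM, and the Birman-Schwinger operator is K = M (A₀ - k² j*j)⁻¹ M*σ. The map u ↦ M u is a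
bijection from Ker(A - k² j*j) onto Ker(1 + K), which gives the equality of dimensions
(`IsFormOperator.rank_kerSub`).

The analytic core is that M is compact and K is Hilbert-Schmidt. Point evaluation is unbounded on H¹
in two dimensions, so M is not estimated directly in Hilbert-Schmidt norm. Instead φ(x, 0) is
telescoped over averages of φ at the dyadic heights d₁/2ʲ in a sector above x, and each difference
is an integral of ∇φ against a kernel of size 1/a on a box of side a = d₁/2ʲ. This writes M as a sum
of operators Nⱼ whose Hilbert-Schmidt norms are bounded uniformly by the L¹ norm of V, and whose
operator norms decay geometrically because Hölder's inequality bounds ∫|V| over an interval of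
length a by a positive power of a (`exists_mul_trace`). Hence M and M* are norm limits of
Hilbert-Schmidt operators. In M X M* one factor of each telescoped term contributes the decay and
the other a linearly growing Hilbert-Schmidt bound, so the sum converges in Hilbert-Schmidt norm
(`exists_hsBound_conj`).

Compactness does the rest. Ehrling's inequality makes M a small perturbation, so both shifted forms
are coercive at z = -κ² for large κ (`exists_isUnit_shiftOp`), and 1 + K is invertible there by the
Fredholm alternative. For the discrete spectra, a nonzero spectral point of a compact operator
always has a finite-rank Riesz projection (`IsCompactOperator.mem_discSpecBdd_iff`), and an
eigenvalue of H_α in ρ(H_{α₀}) is automatically isolated and of finite multiplicity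
(`exists_isUnit_punctured`). Both sides of the principle thus reduce to the existence of an
eigenvector. -/

noncomputable section

namespace DoubleGuide

/-! ### Hilbert-Schmidt bounds tested on finite orthonormal families -/

section HilbertSchmidt

variable {E F G : Type} [NormedAddCommGroup E] [InnerProductSpace ℂ E] [NormedAddCommGroup F]
  [InnerProductSpace ℂ F] [NormedAddCommGroup G] [InnerProductSpace ℂ G]

/-- The Hilbert-Schmidt norm of `T` is at most `C`. -/
def HSBound (T : E →L[ℂ] F) (C : ℝ) : Prop :=
  ∀ (ι : Type) [Fintype ι] (e : ι → E), Orthonormal ℂ e →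
    ‖(WithLp.toLp 2 fun i => T (e i) : PiLp 2 fun _ : ι => F)‖ ≤ C

theorem hsBound_iff {T : E →L[ℂ] F} {C : ℝ} (hC : 0 ≤ C) :
    HSBound T C ↔ ∀ (ι : Type) [Fintype ι] (e : ι → E), Orthonormal ℂ e →
      ∑ i, ‖T (e i)‖ ^ 2 ≤ C ^ 2 := by
  refine forall_congr' fun ι => forall_congr' fun _ => forall_congr' fun e =>
    forall_congr' fun _ => ?_
  rw [PiLp.norm_eq_of_L2, Real.sqrt_le_left hC]

theorem HSBound.nonneg {T : E →L[ℂ] F} {C : ℝ} (h : HSBound T C) : 0 ≤ C :=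
  (norm_nonneg _).trans (h (Fin 0) Fin.elim0 ⟨fun i => i.elim0, fun i => i.elim0⟩)

theorem HSBound.mono {T : E →L[ℂ] F} {C D : ℝ} (h : HSBound T C) (hCD : C ≤ D) : HSBound T D :=
  fun ι _ e he => (h ι e he).trans hCD

theorem HSBound.zero : HSBound (0 : E →L[ℂ] F) 0 := by
  rw [hsBound_iff le_rfl]
  intro ι _ e he
  simp

/-- Stating the bound through the norm of `PiLp 2` reduces this to the triangle inequality. -/
theorem HSBound.add {S T : E →L[ℂ] F} {C D : ℝ} (hS : HSBound S C) (hT : HSBound T D) :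
    HSBound (S + T) (C + D) := fun ι _ e he =>
  (norm_add_le (WithLp.toLp 2 fun i => S (e i) : PiLp 2 fun _ : ι => F)
    (WithLp.toLp 2 fun i => T (e i))).trans (add_le_add (hS ι e he) (hT ι e he))

theorem HSBound.sum {T : ℕ → E →L[ℂ] F} {C : ℕ → ℝ} (h : ∀ n, HSBound (T n) (C n)) (n : ℕ) :
    HSBound (∑ j ∈ Finset.range n, T j) (∑ j ∈ Finset.range n, C j) := by
  induction n with
  | zero => simpa using HSBound.zero
  | succ n ih =>
    rw [Finset.sum_range_succ, Finset.sum_range_succ]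
    exact ih.add (h n)

theorem HSBound.comp_left {T : E →L[ℂ] F} {C : ℝ} (h : HSBound T C) (B : F →L[ℂ] G) :
    HSBound (B ∘L T) (‖B‖ * C) := by
  rw [hsBound_iff (mul_nonneg (norm_nonneg _) h.nonneg)]
  intro ι _ e he
  have := (hsBound_iff h.nonneg).1 h ι e he
  calc ∑ i, ‖(B ∘L T) (e i)‖ ^ 2 ≤ ∑ i, ‖B‖ ^ 2 * ‖T (e i)‖ ^ 2 := by
        refine Finset.sum_le_sum fun i _ => ?_
        rw [← mul_pow]
        exact pow_le_pow_left₀ (norm_nonneg _) (B.le_opNorm _) 2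
    _ ≤ (‖B‖ * C) ^ 2 := by
        rw [← Finset.mul_sum, mul_pow]
        gcongr

theorem HSBound.of_tendsto {T : ℕ → E →L[ℂ] F} {S : E →L[ℂ] F} {C : ℝ}
    (hT : Tendsto T atTop (𝓝 S)) (h : ∀ n, HSBound (T n) C) : HSBound S C := by
  rw [hsBound_iff (h 0).nonneg]
  intro ι _ e he
  refine le_of_tendsto (f := fun n => ∑ i, ‖T n (e i)‖ ^ 2) (x := atTop) ?_
    (Eventually.of_forall fun n => (hsBound_iff (h 0).nonneg).1 (h n) ι e he)
  refine tendsto_finsetSum _ fun i _ => (Tendsto.norm ?_).pow 2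
  exact ((ContinuousLinearMap.apply ℂ F (e i)).continuous.tendsto S).comp hT

/-- Choose a finite orthonormal family that nearly attains the supremum of the sums of squares. A
further unit vector orthogonal to it can contribute at most δ², so T is small on the orthogonal
complement. -/
theorem HSBound.exists_finiteDimensional {T : E →L[ℂ] F} {C : ℝ} (h : HSBound T C) {δ : ℝ}
    (hδ : 0 < δ) : ∃ U : Submodule ℂ E, FiniteDimensional ℂ U ∧ ∀ x ∈ Uᗮ, ‖T x‖ ≤ δ * ‖x‖ := by
  let S : Set ℝ := {t | ∃ (n : ℕ) (e : Fin n → E), Orthonormal ℂ e ∧ ∑ i, ‖T (e i)‖ ^ 2 = t}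
  have hS : BddAbove S := by
    refine ⟨C ^ 2, ?_⟩
    rintro t ⟨n, e, he, rfl⟩
    exact (hsBound_iff h.nonneg).1 h _ e he
  have hS0 : S.Nonempty := ⟨0, 0, Fin.elim0, ⟨fun i => i.elim0, fun i => i.elim0⟩, by simp⟩
  obtain ⟨t, ⟨n, e, he, rfl⟩, ht⟩ := exists_lt_of_lt_csSup hS0
    (sub_lt_self (sSup S) (by positivity : 0 < δ ^ 2))
  refine ⟨Submodule.span ℂ (range e), FiniteDimensional.span_of_finite ℂ (finite_range e), ?_⟩
  intro x hx
  rcases eq_or_ne x 0 with rfl | hx0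
  · simp
  have hn : 0 < ‖x‖ := norm_pos_iff.2 hx0
  have horth : ∀ i, inner ℂ (e i) x = 0 := fun i =>
    hx (e i) (Submodule.subset_span (mem_range_self i))
  let y : E := ((‖x‖ : ℂ)⁻¹) • x
  have hy : ‖y‖ = 1 := by simp [y, norm_smul, hn.ne']
  have hey : Orthonormal ℂ (Fin.cons y e : Fin (n + 1) → E) := by
    constructor
    · intro i
      refine Fin.cases ?_ (fun i => ?_) i
      · simpa using hy
      · simpa using he.1 i
    · intro i j hij
      induction i using Fin.cases with
      | zero =>
        induction j using Fin.cases with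
        | zero => exact absurd rfl hij
        | succ j =>
          have := horth j
          rw [← inner_conj_symm] at this
          simp only [Fin.cons_zero, Fin.cons_succ, y, inner_smul_left]
          rw [(map_eq_zero _).1 this, mul_zero]
      | succ i =>
        induction j using Fin.cases with
        | zero => simp only [Fin.cons_zero, Fin.cons_succ, y, inner_smul_right, horth, mul_zero]
        | succ j =>
          simp only [Fin.cons_succ]
          exact he.2 fun h => hij (congrArg Fin.succ h)
  have hle : ∑ i, ‖T ((Fin.cons y e : Fin (n + 1) → E) i)‖ ^ 2 ≤ sSup S :=
    le_csSup hS ⟨n + 1, _, hey, rfl⟩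
  rw [Fin.sum_univ_succ] at hle
  simp only [Fin.cons_zero, Fin.cons_succ] at hle
  have h1 : ‖T y‖ ^ 2 ≤ δ ^ 2 := by linarith
  have h2 : ‖T y‖ ≤ δ := (pow_le_pow_iff_left₀ (norm_nonneg _) hδ.le two_ne_zero).1 h1
  have h3 : ‖T y‖ = ‖x‖⁻¹ * ‖T x‖ := by simp [y, norm_smul]
  rw [h3, inv_mul_le_iff₀ hn] at h2
  linarith

/-- T is the norm limit of its compositions with projections onto the finite-dimensional spaces of
`HSBound.exists_finiteDimensional`. -/
theorem HSBound.isCompactOperator [CompleteSpace F] {T : E →L[ℂ] F} {C : ℝ} (h : HSBound T C) :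
    IsCompactOperator T := by
  choose U hU hUT using fun n : ℕ =>
    h.exists_finiteDimensional (Nat.one_div_pos_of_nat (α := ℝ) (n := n))
  refine isCompactOperator_of_tendsto (l := atTop)
    (F := fun n => T ∘L (U n).starProjection) ?_ (Eventually.of_forall fun n => ?_)
  · rw [tendsto_iff_norm_sub_tendsto_zero]
    refine squeeze_zero (fun _ => norm_nonneg _) (fun n => ?_)
      (tendsto_one_div_add_atTop_nhds_zero_nat (𝕜 := ℝ))
    refine ContinuousLinearMap.opNorm_le_bound _ (by positivity) fun x => ?_
    have h1 : x - (U n).starProjection x ∈ (U n)ᗮ := (U n).sub_starProjection_mem_orthogonal x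
    have h2 : ‖x - (U n).starProjection x‖ ≤ ‖x‖ := by
      have := (U n)ᗮ.norm_starProjection_apply_le x
      rwa [Submodule.starProjection_orthogonal_val] at this
    have h3 := hUT n _ h1
    rw [map_sub, norm_sub_rev] at h3
    refine le_trans ?_ (h3.trans (mul_le_mul_of_nonneg_left h2 (by positivity)))
    simp
  · have h1 : IsCompactOperator ((U n).subtypeL ∘L (U n).orthogonalProjectionOnto) := by
      have : IsCompactOperator (U n).orthogonalProjectionOnto :=
        haveI := FiniteDimensional.proper ℂ (U n)
        isCompactOperator_of_locallyCompactSpace_dom (U n).orthogonalProjectionOnto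
      exact this.clm_comp (U n).subtypeL
    exact h1.clm_comp T

theorem HSBound.isCompactOperator_of_hasSum [CompleteSpace F] {N : ℕ → E →L[ℂ] F}
    {M : E →L[ℂ] F} {c : ℝ}
    (hN : ∀ j, HSBound (N j) c) (hM : HasSum N M) : IsCompactOperator M :=
  isCompactOperator_of_tendsto hM.tendsto_sum_nat
    (Eventually.of_forall fun n => (HSBound.sum hN n).isCompactOperator)

variable [CompleteSpace E] [CompleteSpace F]

/-- Expand ‖T* gⱼ‖² by Parseval in a Hilbert basis b, exchange the sums, and apply Bessel to each T
bᵢ along the family g. -/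
theorem HSBound.adjoint {T : E →L[ℂ] F} {C : ℝ} (h : HSBound T C) :
    HSBound (ContinuousLinearMap.adjoint T) C := by
  rw [hsBound_iff h.nonneg]
  intro ι _ g hg
  obtain ⟨w, b, -⟩ := exists_hilbertBasis ℂ E
  have hs : ∀ j, HasSum (fun i => ‖inner ℂ (b i) (ContinuousLinearMap.adjoint T (g j))‖ ^ 2)
      (‖ContinuousLinearMap.adjoint T (g j)‖ ^ 2) := fun j => by
    have h1 := b.hasSum_inner_mul_inner (ContinuousLinearMap.adjoint T (g j))
      (ContinuousLinearMap.adjoint T (g j))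
    have h2 := Complex.reCLM.hasSum h1
    have h3 : ∀ x y : E, (inner ℂ x y * inner ℂ y x : ℂ) = ((‖inner ℂ y x‖ ^ 2 : ℝ) : ℂ) := by
      intro x y
      rw [← inner_conj_symm x y, Complex.conj_mul']
      push_cast
      rfl
    simpa only [Function.comp_def, h3, Complex.reCLM_apply, Complex.ofReal_re, 
      inner_self_eq_norm_sq_to_K, ← Complex.ofReal_pow, Complex.coe_algebraMap] using h2
  have hs' := hasSum_sum (s := Finset.univ) fun j _ => hs j
  refine hasSum_le_of_sum_le hs' fun s => ?_
  calc ∑ i ∈ s, ∑ j, ‖inner ℂ (b i) (ContinuousLinearMap.adjoint T (g j))‖ ^ 2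
      ≤ ∑ i ∈ s, ‖T (b i)‖ ^ 2 := by
        refine Finset.sum_le_sum fun i _ => ?_
        refine le_trans (le_of_eq ?_) (hg.sum_inner_products_le (T (b i)) (s := Finset.univ))
        refine Finset.sum_congr rfl fun j _ => ?_
        rw [ContinuousLinearMap.adjoint_inner_right, norm_inner_symm]
    _ = ∑ i : s, ‖T (b i)‖ ^ 2 := (Finset.sum_coe_sort s fun i => ‖T (b i)‖ ^ 2).symm
    _ ≤ C ^ 2 := (hsBound_iff h.nonneg).1 h s _
        (b.orthonormal.comp (fun i : s => (i : w)) Subtype.val_injective)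

theorem HSBound.comp_right [CompleteSpace G] {T : E →L[ℂ] F} {C : ℝ} (h : HSBound T C)
    (B : G →L[ℂ] E) : HSBound (T ∘L B) (‖B‖ * C) := by
  have := (h.adjoint.comp_left (ContinuousLinearMap.adjoint B)).adjoint
  rwa [LinearIsometryEquiv.norm_map, ContinuousLinearMap.adjoint_comp,
    ContinuousLinearMap.adjoint_adjoint, ContinuousLinearMap.adjoint_adjoint] at this

theorem HSBound.isHilbertSchmidt {T : E →L[ℂ] E} {C : ℝ} (h : HSBound T C) :
    IsHilbertSchmidt T := by
  obtain ⟨w, b, -⟩ := exists_hilbertBasis ℂ E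
  refine ⟨w, b, summable_of_sum_le (c := C ^ 2) (fun i => by positivity) fun s => ?_⟩
  rw [← Finset.sum_coe_sort s fun i => ‖T (b i)‖ ^ 2]
  exact (hsBound_iff h.nonneg).1 h s _
    (b.orthonormal.comp (fun i : s => (i : w)) Subtype.val_injective)

/-- If `M = ∑ Nⱼ`, where the Hilbert-Schmidt norms of the `Nⱼ` are bounded and their operator norms
decay geometrically, then `M X M*` is Hilbert-Schmidt for all bounded `X`. -/
theorem exists_hsBound_conj {N : ℕ → E →L[ℂ] F} {M : E →L[ℂ] F} {c C r : ℝ} (hr0 : 0 ≤ r)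
    (hr : r < 1) (hN : ∀ j, HSBound (N j) c) (hN' : ∀ j, ‖N j‖ ≤ C * r ^ j)
    (hM : HasSum N M) (X : E →L[ℂ] E) :
    ∃ D, HSBound (M ∘L X ∘L ContinuousLinearMap.adjoint M) D := by
  let P : ℕ → E →L[ℂ] F := fun n => ∑ j ∈ Finset.range n, N j
  have hC : 0 ≤ C := by simpa using (norm_nonneg _).trans (hN' 0)
  have hc := (hN 0).nonneg
  have hP : ∀ n, HSBound (P n) (n * c) := fun n => by simpa using HSBound.sum hN n
  let B : ℕ → ℝ := fun n => 2 * C * c * ‖X‖ * ((n + 1) * r ^ n)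
  have hB : Summable B := by
    refine Summable.mul_left _ ?_
    have h1 := summable_pow_mul_geometric_of_norm_lt_one (R := ℝ) 1
      (r := r) (by rwa [Real.norm_of_nonneg hr0])
    have h2 := summable_geometric_of_lt_one hr0 hr
    refine (h1.add h2).congr fun n => ?_
    ring
  have hB0 : ∀ n, 0 ≤ B n := fun n => by positivity
  have key : ∀ n, HSBound (P n ∘L X ∘L ContinuousLinearMap.adjoint (P n))
      (∑ j ∈ Finset.range n, B j) := by
    intro n
    induction n with
    | zero => simpa [P] using HSBound.zero
    | succ n ih =>
      have h1 : HSBound ((N n ∘L X) ∘L ContinuousLinearMap.adjoint (P (n + 1)))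
          (‖N n ∘L X‖ * ((n + 1 : ℕ) * c)) := (hP (n + 1)).adjoint.comp_left _
      have h2 : HSBound (P n ∘L (X ∘L ContinuousLinearMap.adjoint (N n)))
          (‖X ∘L ContinuousLinearMap.adjoint (N n)‖ * (n * c)) := (hP n).comp_right _
      have hPn : P (n + 1) = P n + N n := Finset.sum_range_succ _ _
      -- Telescoping: each of the two new terms contains one factor N n, which supplies rⁿ, and one
      -- partial sum, whose Hilbert-Schmidt norm is at most (n + 1) c.
      have e : P (n + 1) ∘L X ∘L ContinuousLinearMap.adjoint (P (n + 1)) =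
          P n ∘L X ∘L ContinuousLinearMap.adjoint (P n) +
          ((N n ∘L X) ∘L ContinuousLinearMap.adjoint (P (n + 1)) +
          P n ∘L (X ∘L ContinuousLinearMap.adjoint (N n))) := by
        ext x
        simp only [hPn, map_add, add_apply, ContinuousLinearMap.comp_apply]
        abel
      rw [e, Finset.sum_range_succ]
      refine ih.add ((h1.add h2).mono ?_)
      have b1 : ‖N n ∘L X‖ ≤ C * r ^ n * ‖X‖ :=
        (ContinuousLinearMap.opNorm_comp_le _ _).trans (by gcongr; exact hN' n)
      have b2 : ‖X ∘L ContinuousLinearMap.adjoint (N n)‖ ≤ ‖X‖ * (C * r ^ n) := by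
        refine (ContinuousLinearMap.opNorm_comp_le _ _).trans ?_
        rw [LinearIsometryEquiv.norm_map]
        gcongr
        exact hN' n
      calc _ ≤ C * r ^ n * ‖X‖ * ((n + 1 : ℕ) * c) + ‖X‖ * (C * r ^ n) * ((n + 1 : ℕ) * c) := by
            gcongr
            exact n.le_succ
        _ = B n := by
            simp only [B]
            push_cast
            ring
  refine ⟨∑' n, B n, HSBound.of_tendsto (T := fun n =>
    P n ∘L X ∘L ContinuousLinearMap.adjoint (P n)) ?_
    fun n => (key n).mono (hB.sum_le_tsum _ fun i _ => hB0 i)⟩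
  have hPM : Tendsto P atTop (𝓝 M) := hM.tendsto_sum_nat
  have hPM' : Tendsto (fun n => ContinuousLinearMap.adjoint (P n)) atTop
      (𝓝 (ContinuousLinearMap.adjoint M)) :=
    ((ContinuousLinearMap.adjoint (𝕜 := ℂ) (E := E) (F := F)).continuous.tendsto M).comp hPM
  have h1 : Continuous fun p : (E →L[ℂ] F) × (F →L[ℂ] E) => p.1 ∘L X ∘L p.2 := by fun_prop
  exact (h1.tendsto (M, ContinuousLinearMap.adjoint M)).comp (hPM.prodMk_nhds hPM')

end HilbertSchmidt

/-! ### Riesz theory of compact operators and the Riesz projection -/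

section Riesz

variable {H : Type} [NormedAddCommGroup H] [InnerProductSpace ℂ H]

theorem IsCompactOperator.exists_sub_smul_pow {K : H →L[ℂ] H} (hK : IsCompactOperator K) (μ : ℂ)
    (n : ℕ) : ∃ K' : H →L[ℂ] H, IsCompactOperator K' ∧
      (K - μ • 1) ^ n = K' + (-μ) ^ n • (1 : H →L[ℂ] H) := by
  induction n with
  | zero => exact ⟨0, isCompactOperator_zero, by simp⟩
  | succ n ih =>
    obtain ⟨K', hK', h⟩ := ih
    refine ⟨K' * K - μ • K' + (-μ) ^ n • K, ?_, ?_⟩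
    · exact ((hK'.comp_clm K).sub (hK'.smul μ)).add (hK.smul ((-μ) ^ n))
    · rw [pow_succ, h, pow_succ]
      simp only [mul_sub, add_mul, mul_smul_comm, smul_mul_assoc, mul_one, one_mul]
      module

/-- K acts on the kernel as the nonzero scalar -c, so the identity of the kernel is compact. -/
theorem IsCompactOperator.finiteDimensional_ker_add_smul {K A : H →L[ℂ] H}
    (hK : IsCompactOperator K) {c : ℂ} (hc : c ≠ 0) (hA : A = K + c • (1 : H →L[ℂ] H)) :
    FiniteDimensional ℂ (LinearMap.ker (A : H →ₗ[ℂ] H)) := by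
  subst hA
  set N := LinearMap.ker ((K + c • 1 : H →L[ℂ] H) : H →ₗ[ℂ] H) with hN
  have hmem : ∀ x ∈ N, K x = (-c) • x := fun x hx => by
    have h : K x + c • x = 0 := by simpa [hN] using hx
    rw [neg_smul]
    exact eq_neg_of_add_eq_zero_left h
  have hinv : ∀ x ∈ N, (K : H →ₗ[ℂ] H) x ∈ N := fun x hx => by
    have := hmem x hx
    simp only [ContinuousLinearMap.coe_coe, this]
    exact N.smul_mem _ hx
  have hcl : IsClosed (N : Set H) := (K + c • 1).isClosed_ker
  have h1 : IsCompactOperator ((K : H →ₗ[ℂ] H).restrict hinv) :=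
    IsCompactOperator.restrict hK hinv hcl
  have h2 := h1.smul (-c)⁻¹
  suffices e : (id : N → N) = (-c)⁻¹ • ⇑((K : H →ₗ[ℂ] H).restrict hinv) from
    FiniteDimensional.of_isCompactOperator_id (𝕜 := ℂ) (by rw [e]; exact h2)
  funext x
  apply Subtype.ext
  have : (K : H →ₗ[ℂ] H) x = (-c) • (x : H) := hmem x x.2
  simp only [id, Pi.smul_apply, Submodule.coe_smul, LinearMap.coe_restrict_apply, this]
  rw [smul_smul, inv_mul_cancel₀ (neg_ne_zero.2 hc), one_smul]

/-- The kernels of the powers of `K - μ`, `K` compact and `μ ≠ 0`, stabilize. -/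
theorem IsCompactOperator.exists_ker_pow_succ_le {K : H →L[ℂ] H} (hK : IsCompactOperator K) {μ : ℂ}
    (hμ : μ ≠ 0) : ∃ n : ℕ, ∀ x, ((K - μ • 1) ^ (n + 1)) x = 0 → ((K - μ • 1) ^ n) x = 0 := by
  by_contra! hcon
  set T := K - μ • 1 with hT
  let N : ℕ → Submodule ℂ H := fun n => LinearMap.ker ((T ^ n : H →L[ℂ] H) : H →ₗ[ℂ] H)
  have hmem : ∀ n x, x ∈ N n ↔ (T ^ n) x = 0 := fun n x => Iff.rfl
  have hfin : ∀ n, FiniteDimensional ℂ (N n) := fun n => by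
    obtain ⟨K', hK', h⟩ := IsCompactOperator.exists_sub_smul_pow hK μ n
    exact IsCompactOperator.finiteDimensional_ker_add_smul hK'
      (pow_ne_zero _ (neg_ne_zero.2 hμ)) h
  have hmono : Monotone N := monotone_nat_of_le_succ fun n x hx => by
    rw [hmem] at hx ⊢
    rw [pow_succ', mul_apply_eq_comp, hx, map_zero]
  -- If the kernels kept growing there would be unit vectors in N (n + 1) orthogonal to N n. Their
  -- images under K stay at distance at least ‖μ‖, contradicting compactness.
  have hex : ∀ n, ∃ x ∈ N (n + 1), x ∈ (N n)ᗮ ∧ ‖x‖ = 1 := fun n => by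
    obtain ⟨x, hx, hx'⟩ := hcon n
    let y := x - (N n).starProjection x
    have hy : y ∈ N (n + 1) :=
      (N (n + 1)).sub_mem hx (hmono n.le_succ ((N n).starProjection_apply_mem x))
    have hy0 : y ≠ 0 := fun h => hx' <| by
      have : x = (N n).starProjection x := sub_eq_zero.1 h
      rw [← hmem, this]
      exact (N n).starProjection_apply_mem x
    refine ⟨(‖y‖ : ℂ)⁻¹ • y, Submodule.smul_mem _ _ hy,
      Submodule.smul_mem _ _ ((N n).sub_starProjection_mem_orthogonal x), ?_⟩
    have : ‖y‖ ≠ 0 := norm_ne_zero_iff.2 hy0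
    simp [norm_smul, this]
  choose f hf hf' hf1 using hex
  have hsep : ∀ m n, m < n → ‖μ‖ ≤ ‖K (f n) - K (f m)‖ := fun m n hmn => by
    have hy : T (f n) - T (f m) - μ • f m ∈ N n := by
      have h1 : T (f n) ∈ N n := by
        rw [hmem, ← mul_apply_eq_comp, ← pow_succ]
        exact hf n
      have h2 : f m ∈ N n := hmono hmn (hf m)
      have h3 : T (f m) ∈ N n := hmono hmn.le <| by
        rw [hmem, ← mul_apply_eq_comp, ← pow_succ]
        exact hf m
      exact (N n).sub_mem ((N n).sub_mem h1 h3) ((N n).smul_mem _ h2)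
    have he : K (f n) - K (f m) = μ • f n + (T (f n) - T (f m) - μ • f m) := by
      simp only [hT, sub_apply, smul_apply, one_apply_eq_self]
      abel
    have horth : inner ℂ (μ • f n) (T (f n) - T (f m) - μ • f m) = 0 := by
      rw [inner_smul_left, ← inner_conj_symm, hf' n _ hy]
      simp
    have h4 := norm_add_sq_eq_norm_sq_add_norm_sq_of_inner_eq_zero _ _ horth
    rw [← he, norm_smul, hf1, mul_one] at h4
    refine abs_le_of_sq_le_sq' ?_ (norm_nonneg _) |>.2
    nlinarith [norm_nonneg (T (f n) - T (f m) - μ • f m)]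
  obtain ⟨S, hS, hS'⟩ := hK.image_closedBall_subset_compact 1
  obtain ⟨y, -, ψ, hψ, hψy⟩ := hS.tendsto_subseq
    (fun n => hS' ⟨f n, by simp [hf1], rfl⟩ : ∀ n, K (f n) ∈ S)
  have hc := Metric.cauchySeq_iff'.1 hψy.cauchySeq
  obtain ⟨n, hn⟩ := hc ‖μ‖ (norm_pos_iff.2 hμ)
  have := hn (n + 1) n.le_succ
  rw [dist_eq_norm] at this
  exact absurd this (not_lt.2 (hsep _ _ (hψ n.lt_succ_self)))

variable [CompleteSpace H]

/-- `c + K` is invertible as soon as it is injective, for `K` compact and `c ≠ 0`. -/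
theorem IsCompactOperator.isUnit_add_smul {K : H →L[ℂ] H} (hK : IsCompactOperator K) {c : ℂ}
    (hc : c ≠ 0) (h : ∀ x, K x + c • x = 0 → x = 0) : IsUnit (K + c • (1 : H →L[ℂ] H)) := by
  rcases IsCompactOperator.hasEigenvalue_or_mem_resolventSet hK (neg_ne_zero.2 hc) with h' | h'
  · obtain ⟨x, hx⟩ := h'.exists_hasEigenvector
    refine absurd (h x ?_) hx.2
    have : K x = (-c) • x := hx.apply_eq_smul
    rw [this]
    simp
  · rw [spectrum.mem_resolventSet_iff, ← IsUnit.neg_iff] at h'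
    convert h' using 1
    rw [Algebra.algebraMap_eq_smul_one]
    module

theorem circleIntegral_clm_apply {A B : Type*} [NormedAddCommGroup A] [NormedSpace ℂ A]
    [CompleteSpace A] [NormedAddCommGroup B] [NormedSpace ℂ B] [CompleteSpace B] (g : A →L[ℂ] B)
    {f : ℂ → A} {c : ℂ} {r : ℝ} (hf : CircleIntegrable f c r) :
    g (∮ z in C(c, r), f z) = ∮ z in C(c, r), g (f z) := by
  rw [circleIntegral, circleIntegral, ← g.intervalIntegral_comp_comm hf.out]
  simp

/-- N is the generalized eigenspace at μ and E the orthogonal projection onto its complement. As K -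
μ preserves N, it induces a map on the quotient by N. T' realizes that map on the complement, and it
is injective because the kernels of the powers have stabilized. -/
theorem IsCompactOperator.exists_sub_smul_intertwine {K : H →L[ℂ] H} (hK : IsCompactOperator K)
    {μ : ℂ} (hμ : μ ≠ 0) : ∃ (n : ℕ) (N : Submodule ℂ H) (E T' : H →L[ℂ] H),
      (∀ x, x ∈ N ↔ ((K - μ • 1) ^ n) x = 0) ∧ FiniteDimensional ℂ N ∧ (∀ x, E x = 0 ↔ x ∈ N) ∧
      IsUnit T' ∧ E * (K - μ • 1) = T' * E := by
  set T := K - μ • 1 with hT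
  obtain ⟨n, hn⟩ := IsCompactOperator.exists_ker_pow_succ_le hK hμ
  let N : Submodule ℂ H := LinearMap.ker ((T ^ n : H →L[ℂ] H) : H →ₗ[ℂ] H)
  have hmem : ∀ x, x ∈ N ↔ (T ^ n) x = 0 := fun x => Iff.rfl
  have hfin : FiniteDimensional ℂ N := by
    obtain ⟨K', hK', h⟩ := IsCompactOperator.exists_sub_smul_pow hK μ n
    exact IsCompactOperator.finiteDimensional_ker_add_smul hK'
      (pow_ne_zero _ (neg_ne_zero.2 hμ)) h
  have hinv : ∀ x ∈ N, T x ∈ N := fun x hx => by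
    rw [hmem] at hx ⊢
    rw [← mul_apply_eq_comp, ← pow_succ, pow_succ', mul_apply_eq_comp,
      hx, map_zero]
  let Q := N.starProjection
  let E : H →L[ℂ] H := 1 - Q
  have hQ : ∀ x ∈ N, Q x = x := fun x hx => Submodule.starProjection_eq_self_iff.2 hx
  have hQm : ∀ x, Q x ∈ N := fun x => N.starProjection_apply_mem x
  have hE : ∀ x, E x = x - Q x := fun x => rfl
  have hE0 : ∀ x, E x = 0 ↔ x ∈ N := fun x =>
    ⟨fun h => by
      have e : x = Q x := sub_eq_zero.1 h
      rw [e]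
      exact hQm x, fun h => by rw [hE, hQ x h, sub_self]⟩
  have hEE : ∀ x, E (E x) = E x := fun x => by
    nth_rw 2 [hE]
    rw [map_sub, (hE0 _).2 (hQm x), sub_zero]
  have hTQ : ∀ x, E (T (Q x)) = 0 := fun x => (hE0 _).2 (hinv _ (hQm x))
  -- The compression of T to the complement of N, completed by the identity on N so that it can be
  -- invertible on the whole space.
  let T' : H →L[ℂ] H := E * T * E + Q
  refine ⟨n, N, E, T', hmem, hfin, hE0, ?_, ?_⟩
  · have hK' : IsCompactOperator (E * K * E + (1 + μ) • Q : H →L[ℂ] H) := by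
      have h1 : IsCompactOperator (E * K * E : H →L[ℂ] H) := (hK.clm_comp E).comp_clm E
      have h2 : IsCompactOperator Q := by
        have := FiniteDimensional.proper ℂ N
        have : IsCompactOperator N.orthogonalProjectionOnto :=
          isCompactOperator_of_locallyCompactSpace_dom N.orthogonalProjectionOnto
        exact this.clm_comp N.subtypeL
      exact h1.add (h2.smul (1 + μ))
    have hrep : T' = (E * K * E + (1 + μ) • Q) + (-μ) • 1 := by
      ext x
      have h3 : E (T (E x)) = E (K (E x)) - μ • E x := by
        simp only [hT, sub_apply, smul_apply, one_apply_eq_self, map_sub, map_smul, hEE]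
      simp only [T', add_apply, mul_apply_eq_comp, smul_apply,
        one_apply_eq_self, h3]
      rw [hE x]
      module
    rw [hrep]
    refine IsCompactOperator.isUnit_add_smul hK' (neg_ne_zero.2 hμ) fun x hx => ?_
    have hx' : T' x = 0 := by rw [hrep]; exact hx
    have hx2 : E (T (E x)) + Q x = 0 := hx'
    have h4 : E (T (E x)) = 0 := by
      have := congrArg E hx2
      rwa [map_add, hEE, (hE0 _).2 (hQm x), add_zero, map_zero] at this
    rw [h4, zero_add] at hx2
    have h5 : E x = x := by rw [hE, hx2, sub_zero]
    -- T x lies in N, so x is killed by the power n + 1 of T, hence by the power n. Thus x lies both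
    -- in N and in its orthogonal complement.
    rw [h5, hE0, hmem, ← mul_apply_eq_comp, ← pow_succ] at h4
    have h6 := hQ x (hn x h4)
    rw [← h6, hx2]
  · ext x
    have h7 : x = E x + Q x := by rw [hE]; abel
    have h8 : Q (E x) = 0 := by rw [hE, map_sub, hQ _ (hQm x), sub_self]
    simp only [T', add_apply, mul_apply_eq_comp, hEE, h8, add_zero]
    nth_rw 1 [h7]
    rw [map_add, map_add, hTQ, add_zero]

/-- The nonzero points of the spectrum of a compact operator belong to its discrete spectrum. -/
theorem IsCompactOperator.mem_discSpecBdd_iff {K : H →L[ℂ] H} (hK : IsCompactOperator K) {μ : ℂ}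
    (hμ : μ ≠ 0) : μ ∈ discSpecBdd K ↔ μ ∈ spectrum ℂ K := by
  constructor
  · rintro ⟨r, -, h, -⟩
    have : μ ∈ Metric.closedBall μ r ∩ spectrum ℂ K := by rw [h]; exact mem_singleton _
    exact this.2
  intro hμs
  obtain ⟨n, N, E, T', hmem, hfin, hE, hT', hint⟩ :=
    IsCompactOperator.exists_sub_smul_intertwine hK hμ
  have h0 : (0 : ℂ) ∈ resolventSet ℂ T' := by
    rw [spectrum.mem_resolventSet_iff, map_zero, zero_sub]
    exact hT'.neg
  obtain ⟨ρ, hρ, hρT⟩ := Metric.isOpen_iff.1 (spectrum.isOpen_resolventSet (𝕜 := ℂ) T') 0 h0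
  have hμ0 : 0 < ‖μ‖ := norm_pos_iff.2 hμ
  -- The first bound keeps ζ - μ in the resolvent set of T'. The second keeps the disc away from 0,
  -- where the Fredholm alternative fails.
  let r := min (ρ / 2) (‖μ‖ / 2)
  have hr : 0 < r := lt_min (by positivity) (by positivity)
  have hrT : ∀ ζ ∈ Metric.closedBall μ r, ζ - μ ∈ resolventSet ℂ T' := fun ζ hζ => hρT <| by
    rw [Metric.mem_closedBall, dist_eq_norm] at hζ
    rw [mem_ball_zero_iff]
    have : r ≤ ρ / 2 := min_le_left _ _
    linarith
  have hζ0 : ∀ ζ ∈ Metric.closedBall μ r, ζ ≠ 0 := by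
    rintro ζ hζ rfl
    rw [Metric.mem_closedBall, dist_eq_norm, zero_sub, norm_neg] at hζ
    have : r ≤ ‖μ‖ / 2 := min_le_right _ _
    linarith
  have hint' : ∀ ζ : ℂ, E * (algebraMap ℂ _ ζ - K) = (algebraMap ℂ _ (ζ - μ) - T') * E := by
    intro ζ
    have e : algebraMap ℂ (H →L[ℂ] H) ζ - K = (ζ - μ) • 1 - (K - μ • 1) := by
      rw [Algebra.algebraMap_eq_smul_one]
      module
    rw [e, mul_sub, hint, Algebra.algebraMap_eq_smul_one, sub_mul]
    simp
  -- For an eigenvector x at ζ ≠ μ, E x lies in the kernel of ζ - μ - T', so x ∈ N. But (K - μ)ⁿ x =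
  -- (ζ - μ)ⁿ x does not vanish.
  have hunit : ∀ ζ ∈ Metric.closedBall μ r, ζ ≠ μ → ζ ∈ resolventSet ℂ K := by
    intro ζ hζ hne
    refine (IsCompactOperator.hasEigenvalue_or_mem_resolventSet hK (hζ0 ζ hζ)).resolve_left ?_
    intro hev
    obtain ⟨x, hx⟩ := hev.exists_hasEigenvector
    have hKx : K x = ζ • x := hx.apply_eq_smul
    have h1 : (algebraMap ℂ (H →L[ℂ] H) (ζ - μ) - T') (E x) = 0 := by
      rw [← mul_apply_eq_comp, ← hint', mul_apply_eq_comp,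
        Algebra.algebraMap_eq_smul_one]
      simp [hKx]
    have h2 := (ContinuousLinearMap.isUnit_iff_bijective.1
      ((spectrum.mem_resolventSet_iff).1 (hrT ζ hζ))).1
    have h3 : E x = 0 := h2 (by rw [h1, map_zero])
    rw [hE, hmem] at h3
    have h4 : ∀ m : ℕ, ((K - μ • 1) ^ m) x = (ζ - μ) ^ m • x := fun m => by
      induction m with
      | zero => simp
      | succ m ih =>
        have h5 : (K - μ • 1) x = (ζ - μ) • x := by
          simp [hKx, sub_smul]
        rw [pow_succ, mul_apply_eq_comp, h5, map_smul, ih, smul_smul, pow_succ']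
    rw [h4] at h3
    exact (smul_ne_zero (pow_ne_zero _ (sub_ne_zero.2 hne)) hx.2) h3
  refine ⟨r, hr, ?_, ?_⟩
  · ext ζ
    constructor
    · rintro ⟨h1, h2⟩
      by_contra hne
      exact h2 (hunit ζ h1 hne)
    · rintro rfl
      exact ⟨Metric.mem_closedBall_self hr.le, hμs⟩
  · set P : H →L[ℂ] H := ∮ ζ in C(μ, r), resolvent K ζ with hP
    have hsphere : ∀ ζ ∈ Metric.sphere μ r, ζ ∈ resolventSet ℂ K := fun ζ hζ =>
      hunit ζ (Metric.sphere_subset_closedBall hζ) <| by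
        rintro rfl
        rw [mem_sphere_iff_norm, sub_self, norm_zero] at hζ
        exact hr.ne hζ
    have hCI : CircleIntegrable (resolvent K) μ r := by
      refine ContinuousOn.circleIntegrable hr.le fun ζ hζ => ?_
      exact (spectrum.hasDerivAt_resolvent_const_left (hsphere ζ hζ)).continuousAt.continuousWithinAt
    -- Intertwining moves E through the resolvent of K and leaves a function holomorphic in the
    -- whole disc, whose integral vanishes by Cauchy. So the Riesz projection has its range in the
    -- kernel N of E.
    have hEP : E * P = 0 := by
      let f : ℂ → H →L[ℂ] H := fun ζ => resolvent T' (ζ - μ) * E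
      have h1 : E * P = ∮ ζ in C(μ, r), E * resolvent K ζ :=
        circleIntegral_clm_apply (ContinuousLinearMap.mul ℂ (H →L[ℂ] H) E) hCI
      have h2 : ∮ ζ in C(μ, r), E * resolvent K ζ = ∮ ζ in C(μ, r), f ζ := by
        refine circleIntegral.integral_congr hr.le fun ζ hζ => ?_
        have u1 := (spectrum.mem_resolventSet_iff).1 (hrT ζ (Metric.sphere_subset_closedBall hζ))
        have u2 := (spectrum.mem_resolventSet_iff).1 (hsphere ζ hζ)
        show E * Ring.inverse _ = Ring.inverse _ * E
        calc E * Ring.inverse (algebraMap ℂ (H →L[ℂ] H) ζ - K)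
            = (Ring.inverse (algebraMap ℂ (H →L[ℂ] H) (ζ - μ) - T') *
                (algebraMap ℂ (H →L[ℂ] H) (ζ - μ) - T')) * E *
                Ring.inverse (algebraMap ℂ (H →L[ℂ] H) ζ - K) := by
              rw [Ring.inverse_mul_cancel _ u1, one_mul]
          _ = Ring.inverse (algebraMap ℂ (H →L[ℂ] H) (ζ - μ) - T') * E *
                ((algebraMap ℂ (H →L[ℂ] H) ζ - K) *
                Ring.inverse (algebraMap ℂ (H →L[ℂ] H) ζ - K)) := by
              rw [mul_assoc (Ring.inverse _) _ E, ← hint' ζ]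
              simp only [mul_assoc]
          _ = _ := by rw [Ring.mul_inverse_cancel _ u2, mul_one]
      have hdiff : ∀ ζ ∈ Metric.closedBall μ r, DifferentiableAt ℂ f ζ := fun ζ hζ => by
        have h3 : DifferentiableAt ℂ (fun ζ => resolvent T' (ζ - μ)) ζ :=
          DifferentiableAt.comp (g := resolvent T') ζ
            (spectrum.hasDerivAt_resolvent_const_left (hrT ζ hζ)).differentiableAt
            (differentiableAt_id.sub_const μ)
        exact h3.mul_const E
      have h4 : ∮ ζ in C(μ, r), f ζ = 0 :=
        Complex.circleIntegral_eq_zero_of_differentiable_on_off_countable hr.le countable_empty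
          (fun ζ hζ => (hdiff ζ hζ).continuousAt.continuousWithinAt)
          fun ζ hζ => hdiff ζ (Metric.ball_subset_closedBall hζ.1)
      rw [h1, h2, h4]
    refine Submodule.finiteDimensional_of_le (S₂ := N) ?_
    rintro _ ⟨x, rfl⟩
    refine N.smul_mem _ ?_
    rw [← hE]
    exact congrArg (fun A : H →L[ℂ] H => A x) hEP

end Riesz

/-! ### Operators associated with bounded forms, and the abstract Birman-Schwinger principle -/

section FormOperator

theorem inverse_apply_apply {H : Type} [NormedAddCommGroup H] [InnerProductSpace ℂ H]
    {B : H →L[ℂ] H} (hB : IsUnit B) (u : H) :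
    Ring.inverse B (B u) = u := by
  rw [← mul_apply_eq_comp, Ring.inverse_mul_cancel _ hB, one_apply_eq_self]

theorem apply_inverse_apply {H : Type} [NormedAddCommGroup H] [InnerProductSpace ℂ H]
    {B : H →L[ℂ] H} (hB : IsUnit B) (u : H) :
    B (Ring.inverse B u) = u := by
  rw [← mul_apply_eq_comp, Ring.mul_inverse_cancel _ hB, one_apply_eq_self]

variable {H L F : Type} [NormedAddCommGroup H] [InnerProductSpace ℂ H] [CompleteSpace H]
  [NormedAddCommGroup L] [InnerProductSpace ℂ L] [CompleteSpace L]
  [NormedAddCommGroup F] [InnerProductSpace ℂ F] [CompleteSpace F]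

open ContinuousLinearMap (adjoint)

/-- `T` is the operator in `L` associated with the bounded form `⟨φ, A ψ⟩` on the form domain `H`,
which is embedded in `L` by `j`. -/
def IsFormOperator (T : L →ₗ.[ℂ] L) (j : H →L[ℂ] L) (A : H →L[ℂ] H) : Prop :=
  ∀ x h, (x, h) ∈ T.graph ↔ ∃ u, j u = x ∧ A u = adjoint j h

/-- The operator of the form shifted by `z`. -/
def shiftOp (j : H →L[ℂ] L) (A : H →L[ℂ] H) (z : ℂ) : H →L[ℂ] H := A - z • (adjoint j ∘L j)

theorem shiftOp_apply (j : H →L[ℂ] L) (A : H →L[ℂ] H) (z : ℂ) (u : H) :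
    shiftOp j A z u = A u - z • adjoint j (j u) := rfl

theorem shiftOp_eq_add (j : H →L[ℂ] L) (A : H →L[ℂ] H) (z w : ℂ) :
    shiftOp j A z = shiftOp j A w + (w - z) • (adjoint j ∘L j) := by
  rw [shiftOp, shiftOp]
  module

theorem continuous_shiftOp (j : H →L[ℂ] L) (A : H →L[ℂ] H) : Continuous (shiftOp j A) := by
  unfold shiftOp
  fun_prop

theorem isUnit_of_coercive {B : H →L[ℂ] H} {c : ℝ} (hc : 0 < c)
    (h : ∀ u, c * ‖u‖ ^ 2 ≤ (inner ℂ (B u) u).re) : IsUnit B := by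
  refine ContinuousLinearMap.isUnit_of_forall_le_norm_inner_map B
    (c := ⟨c, hc.le⟩) (by exact_mod_cast hc) fun x => ?_
  rw [mul_comm]
  exact (h x).trans (Complex.re_le_norm _)

theorem IsFormOperator.mem_graph_shift {T : L →ₗ.[ℂ] L} {j : H →L[ℂ] L} {A : H →L[ℂ] H}
    (hT : IsFormOperator T j A) (x h : L) (z : ℂ) :
    (x, h + z • x) ∈ T.graph ↔ ∃ u, j u = x ∧ shiftOp j A z u = adjoint j h := by
  rw [hT]
  refine exists_congr fun u => and_congr_right fun hu => ?_
  rw [shiftOp_apply, map_add, map_smul, hu, sub_eq_iff_eq_add]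

/-- The inverse of A - z j*j, placed between j* and j, is the resolvent. Conversely the resolvent
solves equations only for right sides in the range of j*. One point z₀ of invertibility of the
shifted form operator reduces a general right side to that case. -/
theorem IsFormOperator.mem_resSet_iff {T : L →ₗ.[ℂ] L} {j : H →L[ℂ] L} {A : H →L[ℂ] H}
    (hT : IsFormOperator T j A) (hj : Function.Injective j) {z₀ : ℂ}
    (hz₀ : IsUnit (shiftOp j A z₀)) (z : ℂ) : z ∈ resSet T ↔ IsUnit (shiftOp j A z) := by
  constructor
  · rintro ⟨R, hR⟩
    simp only [hT.mem_graph_shift] at hR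
    rw [ContinuousLinearMap.isUnit_iff_bijective]
    constructor
    · rw [injective_iff_map_eq_zero]
      intro u hu
      have : j u = R 0 := (hR (j u) 0).1 ⟨u, rfl, by rw [hu, map_zero]⟩
      rw [map_zero] at this
      exact hj (by rw [this, map_zero])
    · intro w
      -- Solving at z₀ first leaves the error (z₀ - z) j*j v₀, which lies in the range of j* and is
      -- removed by the resolvent at z.
      obtain ⟨v, -, hv⟩ := (hR (R (-((z₀ - z) • j (Ring.inverse (shiftOp j A z₀) w)))) _).2 rfl
      refine ⟨Ring.inverse (shiftOp j A z₀) w + v, ?_⟩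
      rw [map_add, hv, shiftOp_eq_add j A z z₀]
      simp only [add_apply, smul_apply, ContinuousLinearMap.comp_apply, apply_inverse_apply hz₀,
        map_neg, map_smul]
      abel
  · intro hu
    refine ⟨j ∘L Ring.inverse (shiftOp j A z) ∘L adjoint j, fun x h => ?_⟩
    rw [hT.mem_graph_shift]
    constructor
    · rintro ⟨u, rfl, hu'⟩
      rw [ContinuousLinearMap.comp_apply, ContinuousLinearMap.comp_apply, ← hu',
        inverse_apply_apply hu]
    · rintro rfl
      exact ⟨_, rfl, apply_inverse_apply hu _⟩

theorem IsFormOperator.mem_kerSub {T : L →ₗ.[ℂ] L} {j : H →L[ℂ] L} {A : H →L[ℂ] H}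
    (hT : IsFormOperator T j A) (z : ℂ) (x : L) :
    x ∈ kerSub T z ↔ ∃ u, j u = x ∧ shiftOp j A z u = 0 := by
  have := hT.mem_graph_shift x 0 z
  rw [zero_add, map_zero] at this
  rw [← this]
  rfl

/-- The abstract Birman-Schwinger operator. -/
def bsOp (j : H →L[ℂ] L) (A₀ : H →L[ℂ] H) (M : H →L[ℂ] F) (σ : F →L[ℂ] F) (z : ℂ) : F →L[ℂ] F :=
  M ∘L Ring.inverse (shiftOp j A₀ z) ∘L adjoint M ∘L σ

theorem bsOp_apply (j : H →L[ℂ] L) (A₀ : H →L[ℂ] H) (M : H →L[ℂ] F) (σ : F →L[ℂ] F) (z : ℂ)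
    (v : F) : bsOp j A₀ M σ z v = M (Ring.inverse (shiftOp j A₀ z) (adjoint M (σ v))) := rfl

variable {j : H →L[ℂ] L} {A₀ : H →L[ℂ] H} {M : H →L[ℂ] F} {σ : F →L[ℂ] F} {z : ℂ}

/-- The form operator perturbed by the form `⟨M φ, σ M ψ⟩`. -/
def pertOp (A₀ : H →L[ℂ] H) (M : H →L[ℂ] F) (σ : F →L[ℂ] F) : H →L[ℂ] H :=
  A₀ + adjoint M ∘L σ ∘L M

theorem shiftOp_pertOp (j : H →L[ℂ] L) (A₀ : H →L[ℂ] H) (M : H →L[ℂ] F) (σ : F →L[ℂ] F) (z : ℂ) :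
    shiftOp j (pertOp A₀ M σ) z = shiftOp j A₀ z + adjoint M ∘L σ ∘L M := by
  rw [shiftOp, shiftOp, pertOp]
  abel

theorem shiftOp_pertOp_apply (u : H) :
    shiftOp j (pertOp A₀ M σ) z u = shiftOp j A₀ z u + adjoint M (σ (M u)) := by
  rw [shiftOp_pertOp]
  rfl

theorem add_bsOp_apply_eq_zero (hz : IsUnit (shiftOp j A₀ z)) {u : H}
    (hu : shiftOp j (pertOp A₀ M σ) z u = 0) : M u + bsOp j A₀ M σ z (M u) = 0 := by
  rw [shiftOp_pertOp_apply] at hu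
  have : adjoint M (σ (M u)) = - shiftOp j A₀ z u := by
    rw [eq_neg_iff_add_eq_zero, add_comm, hu]
  rw [bsOp_apply, this, map_neg, inverse_apply_apply hz, map_neg, add_neg_cancel]

theorem exists_of_add_bsOp_apply_eq_zero (hz : IsUnit (shiftOp j A₀ z)) {v : F}
    (hv : v + bsOp j A₀ M σ z v = 0) : ∃ u, shiftOp j (pertOp A₀ M σ) z u = 0 ∧ M u = v := by
  have hM : M (-Ring.inverse (shiftOp j A₀ z) (adjoint M (σ v))) = v := by
    rw [map_neg, ← bsOp_apply, ← eq_neg_of_add_eq_zero_left hv]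
  refine ⟨_, ?_, hM⟩
  rw [shiftOp_pertOp_apply, hM, map_neg, apply_inverse_apply hz, neg_add_cancel]

/-- Both kernels are injective images of Ker(A - z j*j), one under j and the other under M.
Injectivity of M there holds because M u = 0 leaves (A₀ - z j*j) u = 0. -/
theorem IsFormOperator.rank_kerSub {T : L →ₗ.[ℂ] L} (hT : IsFormOperator T j (pertOp A₀ M σ))
    (hj : Function.Injective j) (hz : IsUnit (shiftOp j A₀ z)) :
    Module.rank ℂ (kerSub T z) =
      Module.rank ℂ (LinearMap.ker ((1 + bsOp j A₀ M σ z : F →L[ℂ] F) : F →ₗ[ℂ] F)) := by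
  have e1 : kerSub T z = (LinearMap.ker
      (shiftOp j (pertOp A₀ M σ) z : H →ₗ[ℂ] H)).map (j : H →ₗ[ℂ] L) := by
    ext x
    rw [hT.mem_kerSub, Submodule.mem_map]
    exact exists_congr fun u => and_comm
  have e2 : LinearMap.ker ((1 + bsOp j A₀ M σ z : F →L[ℂ] F) : F →ₗ[ℂ] F) = (LinearMap.ker
      (shiftOp j (pertOp A₀ M σ) z : H →ₗ[ℂ] H)).map (M : H →ₗ[ℂ] F) := by
    ext x
    rw [Submodule.mem_map]
    constructor
    · intro hx
      exact exists_of_add_bsOp_apply_eq_zero hz hx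
    · rintro ⟨u, hu, rfl⟩
      exact add_bsOp_apply_eq_zero hz hu
  have hinj : ∀ u ∈ LinearMap.ker (shiftOp j (pertOp A₀ M σ) z : H →ₗ[ℂ] H), M u = 0 → u = 0 := by
    intro u hu h
    have hu' : shiftOp j (pertOp A₀ M σ) z u = 0 := hu
    rw [shiftOp_pertOp_apply, h, map_zero, map_zero, add_zero] at hu'
    rw [← inverse_apply_apply hz u, hu', map_zero]
  set N := LinearMap.ker (shiftOp j (pertOp A₀ M σ) z : H →ₗ[ℂ] H) with hN
  rw [e1, e2]
  have f1 : Module.rank ℂ (N.map (j : H →ₗ[ℂ] L)) = Module.rank ℂ N :=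
    (Submodule.equivMapOfInjective (j : H →ₗ[ℂ] L) hj N).rank_eq.symm
  have f2 : Module.rank ℂ (N.map (M : H →ₗ[ℂ] F)) = Module.rank ℂ N := by
    have : Function.Injective ((M : H →ₗ[ℂ] F).domRestrict N) := by
      rw [injective_iff_map_eq_zero]
      intro u hu
      exact Subtype.ext (hinj u u.2 hu)
    have e := (LinearEquiv.ofInjective _ this).rank_eq
    rw [LinearMap.range_domRestrict] at e
    exact e.symm
  rw [f1, f2]

/-- Factor out B and apply the Fredholm alternative to 1 + B⁻¹C. -/
theorem isUnit_add_of_injective {B C : H →L[ℂ] H} (hB : IsUnit B) (hC : IsCompactOperator C)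
    (h : ∀ u, B u + C u = 0 → u = 0) : IsUnit (B + C) := by
  have h1 : IsUnit (Ring.inverse B * C + (1 : ℂ) • (1 : H →L[ℂ] H)) := by
    refine IsCompactOperator.isUnit_add_smul (hC.clm_comp (Ring.inverse B)) one_ne_zero
      fun x hx => h x ?_
    have := congrArg B hx
    rw [one_smul, map_add, mul_apply_eq_comp, apply_inverse_apply hB, map_zero] at this
    rw [add_comm, this]
  have h2 : B + C = B * (Ring.inverse B * C + (1 : ℂ) • (1 : H →L[ℂ] H)) := by
    rw [mul_add, ← mul_assoc, Ring.mul_inverse_cancel _ hB, one_mul, one_smul, mul_one, add_comm]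
  rw [h2]
  exact hB.mul h1

/-- A vector in Ker(1 + K) is M u with u in the kernel of the perturbed shifted form, which is
trivial. -/
theorem isUnit_one_add_bsOp (hz : IsUnit (shiftOp j A₀ z))
    (hK : IsCompactOperator (bsOp j A₀ M σ z))
    (hz' : IsUnit (shiftOp j (pertOp A₀ M σ) z)) : IsUnit (1 + bsOp j A₀ M σ z) := by
  have := IsCompactOperator.isUnit_add_smul hK one_ne_zero fun v hv => ?_
  · rwa [one_smul, add_comm] at this
  · rw [one_smul, add_comm] at hv
    obtain ⟨u, hu, rfl⟩ := exists_of_add_bsOp_apply_eq_zero hz hv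
    rw [← inverse_apply_apply hz' u, hu, map_zero, map_zero]

theorem shiftOp_inner (hA : ∀ u v, inner ℂ (A₀ u) v = inner ℂ u (A₀ v)) (z : ℂ) (u v : H) :
    inner ℂ (shiftOp j A₀ (conj z) u) v = inner ℂ u (shiftOp j A₀ z v) := by
  rw [shiftOp_apply, shiftOp_apply, inner_sub_left, inner_sub_right, hA, inner_smul_left,
    inner_smul_right, ContinuousLinearMap.adjoint_inner_left,
    ContinuousLinearMap.adjoint_inner_right, Complex.conj_conj]

/-- An eigenvalue of the perturbed operator in the resolvent set of the unperturbed one is an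
isolated point of its spectrum. -/
theorem exists_isUnit_punctured {A : H →L[ℂ] H} (hj : Function.Injective j)
    (hA : ∀ u v, inner ℂ (A u) v = inner ℂ u (A v)) {C : H →L[ℂ] H} (hC : IsCompactOperator C)
    (hAC : A = A₀ + C) (hz : IsUnit (shiftOp j A₀ z)) {u₀ : H} (hu₀ : u₀ ≠ 0)
    (hker : shiftOp j A z u₀ = 0) :
    ∃ r > 0, ∀ w ∈ Metric.ball z r, w ≠ z → IsUnit (shiftOp j A w) := by
  -- The eigenvalue is real by symmetry of A, and this makes A - z j*j symmetric as well.
  have hzr : conj z = z := by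
    have h1 : A u₀ = z • adjoint j (j u₀) := sub_eq_zero.1 hker
    have h2 := hA u₀ u₀
    rw [h1, inner_smul_left, inner_smul_right, ContinuousLinearMap.adjoint_inner_left,
      ContinuousLinearMap.adjoint_inner_right] at h2
    refine mul_right_cancel₀ ?_ h2
    rw [inner_self_ne_zero]
    exact fun h => hu₀ (hj (by rw [h, map_zero]))
  have hAw : ∀ w, shiftOp j A w = shiftOp j A₀ w + C := fun w => by
    rw [shiftOp, shiftOp, hAC]
    abel
  let N := LinearMap.ker (shiftOp j A z : H →ₗ[ℂ] H)
  have hmem : ∀ u, u ∈ N ↔ shiftOp j A z u = 0 := fun u => Iff.rfl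
  have hNfin : FiniteDimensional ℂ N := by
    have h1 : LinearMap.ker ((Ring.inverse (shiftOp j A₀ z) * C + (1 : ℂ) • 1 : H →L[ℂ] H) :
        H →ₗ[ℂ] H) = N := by
      ext u
      have : (Ring.inverse (shiftOp j A₀ z) * C + (1 : ℂ) • 1 : H →L[ℂ] H) u =
          Ring.inverse (shiftOp j A₀ z) (shiftOp j A z u) := by
        rw [hAw, add_apply, add_apply, map_add, inverse_apply_apply hz, one_smul, add_comm]
        rfl
      rw [hmem, LinearMap.mem_ker, ContinuousLinearMap.coe_coe, this]
      constructor
      · intro h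
        rw [← apply_inverse_apply hz (shiftOp j A z u), h, map_zero]
      · intro h
        rw [h, map_zero]
    rw [← h1]
    exact IsCompactOperator.finiteDimensional_ker_add_smul
      (hC.clm_comp (Ring.inverse (shiftOp j A₀ z))) one_ne_zero rfl
  let W := N.map (j : H →ₗ[ℂ] L)
  have hWfin : FiniteDimensional ℂ W := inferInstance
  let Q : L →L[ℂ] L := W.starProjection
  -- A finite-rank correction that acts on the eigenspace only: it makes the form invertible at z,
  -- hence also near z.
  let D : H →L[ℂ] H := adjoint j ∘L Q ∘L j
  have hD : ∀ u, D u = adjoint j (Q (j u)) := fun u => rfl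
  have hDc : IsCompactOperator D := by
    have h2 : IsCompactOperator Q := by
      have := FiniteDimensional.proper ℂ W
      have : IsCompactOperator W.orthogonalProjectionOnto :=
        isCompactOperator_of_locallyCompactSpace_dom W.orthogonalProjectionOnto
      exact this.clm_comp W.subtypeL
    exact (h2.clm_comp (adjoint j)).comp_clm j
  have hQ0 : ∀ x, (∀ n ∈ N, inner ℂ (j n) x = 0) → Q x = 0 := fun x hx => by
    refine (Submodule.starProjection_apply_eq_zero_iff W).2 ?_
    rintro _ ⟨n, hn, rfl⟩
    exact hx n hn
  have hsymm : ∀ n ∈ N, ∀ u, inner ℂ n (shiftOp j A z u) = 0 := fun n hn u => by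
    rw [← shiftOp_inner hA, hzr, (hmem n).1 hn, inner_zero_left]
  have hunit : IsUnit (shiftOp j A z + D) := by
    have h3 : shiftOp j A z + D = shiftOp j A₀ z + (C + D) := by rw [hAw, add_assoc]
    rw [h3]
    refine isUnit_add_of_injective hz (hC.add hDc) fun u hu => ?_
    have hu' : shiftOp j A z u + D u = 0 := by
      rw [hAw, add_apply, add_assoc]
      exact hu
    have h4 : Q (j u) = 0 := by
      have h5 : Q (Q (j u)) = 0 := hQ0 _ fun n hn => by
        have h6 := congrArg (inner ℂ n) hu'
        rw [inner_add_right, hsymm n hn u, zero_add, inner_zero_right] at h6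
        rw [← ContinuousLinearMap.adjoint_inner_right, ← hD]
        exact h6
      rwa [Submodule.starProjection_eq_self_iff.2 (W.starProjection_apply_mem (j u))] at h5
    rw [hD, h4, map_zero, add_zero] at hu'
    have h6 : j u ∈ W := ⟨u, hu', rfl⟩
    have h7 : Q (j u) = j u := Submodule.starProjection_eq_self_iff.2 h6
    exact hj (by rw [map_zero, ← h7, h4])
  have ev1 : ∀ᶠ w in 𝓝 z, IsUnit (shiftOp j A w + D) :=
    (((continuous_shiftOp j A).add continuous_const).tendsto z).eventually
      (Units.isOpen.mem_nhds hunit)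
  have ev2 : ∀ᶠ w in 𝓝 z, IsUnit (shiftOp j A₀ w) :=
    ((continuous_shiftOp j A₀).tendsto z).eventually (Units.isOpen.mem_nhds hz)
  obtain ⟨r, hr, hr'⟩ := Metric.eventually_nhds_iff_ball.1 (ev1.and ev2)
  refine ⟨r, hr, fun w hw hne => ?_⟩
  obtain ⟨u1, u2⟩ := hr' w hw
  rw [hAw]
  refine isUnit_add_of_injective u2 hC fun u hu => ?_
  have hu' : shiftOp j A w u = 0 := by rw [hAw]; exact hu
  -- A null vector at w ≠ z is L-orthogonal to the eigenspace at z, so D does not see it and the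
  -- corrected operator kills it as well.
  have h8 : Q (j u) = 0 := hQ0 _ fun n hn => by
    have h9 := hsymm n hn u
    rw [shiftOp_eq_add j A z w, add_apply, hu', zero_add, smul_apply, inner_smul_right,
      ContinuousLinearMap.comp_apply, ContinuousLinearMap.adjoint_inner_right] at h9
    exact (mul_eq_zero.1 h9).resolve_left (sub_ne_zero.2 hne)
  have h10 : (shiftOp j A w + D) u = 0 := by
    rw [add_apply, hu', hD, h8, map_zero, add_zero]
  rw [← inverse_apply_apply u1 u, h10, map_zero]

/-- The Birman-Schwinger principle for form operators. -/
theorem IsFormOperator.mem_discSpec_iff {T : L →ₗ.[ℂ] L}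
    (hT : IsFormOperator T j (pertOp A₀ M σ)) (hj : Function.Injective j)
    (hA : ∀ u v, inner ℂ (pertOp A₀ M σ u) v = inner ℂ u (pertOp A₀ M σ v))
    (hM : IsCompactOperator M) (hz : IsUnit (shiftOp j A₀ z)) {z₀ : ℂ}
    (hz₀ : IsUnit (shiftOp j (pertOp A₀ M σ) z₀)) :
    z ∈ discSpec T ↔ (-1 : ℂ) ∈ discSpecBdd (bsOp j A₀ M σ z) := by
  have hK : IsCompactOperator (bsOp j A₀ M σ z) :=
    hM.comp_clm (Ring.inverse (shiftOp j A₀ z) ∘L adjoint M ∘L σ)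
  have hrank := hT.rank_kerSub hj hz
  rw [IsCompactOperator.mem_discSpecBdd_iff hK (neg_ne_zero.2 one_ne_zero),
    ← IsCompactOperator.hasEigenvalue_iff_mem_spectrum hK (neg_ne_zero.2 one_ne_zero)]
  have hker : kerSub T z ≠ ⊥ ↔ Module.End.HasEigenvalue
      (bsOp j A₀ M σ z : Module.End ℂ F) (-1) := by
    rw [Module.End.hasEigenvalue_iff]
    have e : Module.End.eigenspace (bsOp j A₀ M σ z : Module.End ℂ F) (-1) =
        LinearMap.ker ((1 + bsOp j A₀ M σ z : F →L[ℂ] F) : F →ₗ[ℂ] F) := by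
      ext v
      rw [Module.End.mem_eigenspace_iff, LinearMap.mem_ker, neg_one_smul, eq_neg_iff_add_eq_zero,
        add_comm]
      rfl
    rw [e, ne_eq, ne_eq, ← Submodule.rank_eq_zero, hrank, Submodule.rank_eq_zero]
  rw [← hker]
  -- Only the existence of an eigenvector carries information. Isolation and finite multiplicity
  -- follow from compactness and from the invertibility of the unperturbed form at z.
  refine ⟨fun h => h.2.1, fun h => ?_⟩
  obtain ⟨x, hx, hx0⟩ := (Submodule.ne_bot_iff _).1 h
  obtain ⟨u, rfl, hu⟩ := (hT.mem_kerSub z x).1 hx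
  have hu0 : u ≠ 0 := by
    rintro rfl
    exact hx0 (map_zero j)
  obtain ⟨r, hr, hr'⟩ := exists_isUnit_punctured hj hA
    ((hM.clm_comp (adjoint M ∘L σ)) : IsCompactOperator (adjoint M ∘L σ ∘L M)) rfl hz hu0 hu
  refine ⟨⟨r, hr, ?_⟩, h, ?_⟩
  · ext w
    constructor
    · rintro ⟨hw, hws⟩
      by_contra hne
      exact hws ((hT.mem_resSet_iff hj hz₀ w).2 (hr' w hw hne))
    · rintro rfl
      refine ⟨Metric.mem_ball_self hr, fun hres => ?_⟩
      rw [hT.mem_resSet_iff hj hz₀] at hres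
      exact hu0 (by rw [← inverse_apply_apply hres u, hu, map_zero])
  · have h1 : FiniteDimensional ℂ
        (LinearMap.ker ((1 + bsOp j A₀ M σ z : F →L[ℂ] F) : F →ₗ[ℂ] F)) :=
      IsCompactOperator.finiteDimensional_ker_add_smul hK one_ne_zero
        (by rw [one_smul, add_comm])
    refine Module.rank_lt_aleph0_iff.1 ?_
    rw [hrank]
    exact Module.rank_lt_aleph0_iff.2 h1

/-- Ehrling's inequality. -/
theorem exists_norm_le_of_isCompactOperator_adjoint (hj : Function.Injective j)
    (hM : IsCompactOperator (adjoint M)) {δ : ℝ} (hδ : 0 < δ) :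
    ∃ C : ℝ, 0 ≤ C ∧ ∀ u, ‖M u‖ ≤ δ * ‖u‖ + C * ‖j u‖ := by
  -- The orthogonal complement of the range of j* is the kernel of j.
  have hdense : DenseRange (adjoint j) := by
    have h1 : (LinearMap.range (adjoint j : L →ₗ[ℂ] H)).topologicalClosure = ⊤ := by
      rw [Submodule.topologicalClosure_eq_top_iff, Submodule.eq_bot_iff]
      intro u hu
      refine hj (ext_inner_left ℂ fun h => ?_)
      rw [map_zero, inner_zero_right, ← ContinuousLinearMap.adjoint_inner_left]
      exact hu _ ⟨h, rfl⟩
    have h2 := Submodule.dense_iff_topologicalClosure_eq_top.2 h1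
    exact h2
  obtain ⟨S, hS, hS'⟩ := hM.image_closedBall_subset_compact 1
  -- The image of the unit ball under M* is covered by finitely many δ-balls around vectors j*h, and
  -- these finitely many h produce the constant C.
  obtain ⟨t, ht⟩ := hS.elim_finite_subcover (fun h : L => Metric.ball (adjoint j h) δ)
    (fun _ => Metric.isOpen_ball) fun s _ => by
      obtain ⟨h, hh⟩ := hdense.exists_dist_lt s hδ
      exact mem_iUnion.2 ⟨h, hh⟩
  refine ⟨∑ h ∈ t, ‖h‖, Finset.sum_nonneg fun _ _ => norm_nonneg _, fun u => ?_⟩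
  rcases eq_or_ne (M u) 0 with h0 | h0
  · rw [h0, norm_zero]
    have : 0 ≤ ∑ h ∈ t, ‖h‖ := Finset.sum_nonneg fun _ _ => norm_nonneg _
    positivity
  have hn : ‖M u‖ ≠ 0 := norm_ne_zero_iff.2 h0
  let g : F := (‖M u‖ : ℂ)⁻¹ • M u
  have hg : ‖g‖ = 1 := by simp [g, norm_smul, hn]
  obtain ⟨h, hht, hh⟩ : ∃ h ∈ t, adjoint M g ∈ Metric.ball (adjoint j h) δ := by
    simpa using ht (hS' ⟨g, by simp [hg], rfl⟩)
  -- Write ‖M u‖ = ⟨M*g, u⟩ with g the direction of M u, and replace M*g by a nearby j*h.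
  have h1 : (‖M u‖ : ℂ) = inner ℂ (adjoint M g - adjoint j h) u + inner ℂ h (j u) := by
    rw [inner_sub_left, ContinuousLinearMap.adjoint_inner_left,
      ContinuousLinearMap.adjoint_inner_left, sub_add_cancel, inner_smul_left,
      inner_self_eq_norm_sq_to_K, map_inv₀, Complex.conj_ofReal, sq]
    exact (inv_mul_cancel_left₀ (by exact_mod_cast hn) _).symm
  have h2 : ‖M u‖ = ‖(‖M u‖ : ℂ)‖ := by simp
  rw [h2, h1]
  refine (norm_add_le _ _).trans (add_le_add ?_ ?_)
  · refine (norm_inner_le_norm _ _).trans ?_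
    rw [mem_ball_iff_norm] at hh
    gcongr
  · refine (norm_inner_le_norm _ _).trans ?_
    gcongr
    exact Finset.single_le_sum (f := fun h => ‖h‖) (fun _ _ => norm_nonneg _) hht

end FormOperator

/-! ### Integral operators with kernels localized in boxes -/

section KernelOperator

open scoped ENNReal

theorem lintegral_enorm_sq {X : Type*} [MeasurableSpace X] {μ : Measure X} (g : Lp ℂ 2 μ) :
    ∫⁻ x, ‖g x‖ₑ ^ 2 ∂μ = ENNReal.ofReal (‖g‖ ^ 2) := by
  have h := eLpNorm_nnreal_pow_eq_lintegral (μ := μ) (f := g) (p := 2) two_ne_zero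
  simp only [NNReal.coe_ofNat, ENNReal.rpow_ofNat, ENNReal.coe_ofNat] at h
  rw [← h, Lp.norm_def, ENNReal.ofReal_pow ENNReal.toReal_nonneg,
    ENNReal.ofReal_toReal (Lp.eLpNorm_ne_top g)]

theorem memLp_two_of_lintegral_ne_top {X : Type*} [MeasurableSpace X] {μ : Measure X} {g : X → ℂ}
    (hg : AEStronglyMeasurable g μ) (h : ∫⁻ x, ‖g x‖ₑ ^ 2 ∂μ ≠ ⊤) : MemLp g 2 μ := by
  refine ⟨hg, ?_⟩
  have h' := eLpNorm_nnreal_pow_eq_lintegral (μ := μ) (f := g) (p := 2) two_ne_zero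
  simp only [NNReal.coe_ofNat, ENNReal.rpow_ofNat, ENNReal.coe_ofNat] at h'
  rw [← h'] at h
  rw [lt_top_iff_ne_top]
  intro h''
  exact h (by rw [h'']; simp)

theorem lintegral_mul_sq_le {X : Type*} [MeasurableSpace X] {μ : Measure X} {f g : X → ℝ≥0∞}
    (hf : AEMeasurable f μ) (hg : AEMeasurable g μ) :
    (∫⁻ x, f x * g x ∂μ) ^ 2 ≤ (∫⁻ x, f x ^ 2 ∂μ) * ∫⁻ x, g x ^ 2 ∂μ := by
  have h := ENNReal.lintegral_mul_le_Lp_mul_Lq μ Real.HolderConjugate.two_two hf hg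
  simp only [Pi.mul_apply, ENNReal.rpow_ofNat] at h
  refine (pow_le_pow_left' h 2).trans (le_of_eq ?_)
  rw [mul_pow, ← ENNReal.rpow_natCast, ← ENNReal.rpow_natCast, ← ENNReal.rpow_mul,
    ← ENNReal.rpow_mul]
  norm_num

/-- Cauchy-Schwarz that keeps the localization: only the part of h on the support of k enters. -/
theorem enorm_integral_mul_sq_le {X : Type*} [MeasurableSpace X] {μ : Measure X} {k h : X → ℂ}
    (hk : AEStronglyMeasurable k μ) (hh : AEStronglyMeasurable h μ) {S : Set X}
    (hS : MeasurableSet S) (hkS : ∀ x ∉ S, k x = 0) :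
    ‖∫ x, k x * h x ∂μ‖ₑ ^ 2 ≤ (∫⁻ x, ‖k x‖ₑ ^ 2 ∂μ) * ∫⁻ x in S, ‖h x‖ₑ ^ 2 ∂μ := by
  have h1 : ‖∫ x, k x * h x ∂μ‖ₑ ≤ ∫⁻ x, ‖k x‖ₑ * S.indicator (fun x => ‖h x‖ₑ) x ∂μ := by
    refine (enorm_integral_le_lintegral_enorm _).trans (lintegral_mono fun x => ?_)
    by_cases hx : x ∈ S
    · simp [hx]
    · simp [hkS x hx]
  refine (pow_le_pow_left' h1 2).trans ((lintegral_mul_sq_le hk.enorm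
    (hh.enorm.indicator hS)).trans (le_of_eq ?_))
  rw [← lintegral_indicator hS]
  congr 2
  funext x
  by_cases hx : x ∈ S <;> simp [hx]

/-- The box attached to the point `x` of the barrier at scale `a`. -/
def box (x a : ℝ) : Set (ℝ × ℝ) := Icc x (x + a) ×ˢ Icc 0 a

theorem measurableSet_box (x a : ℝ) : MeasurableSet (box x a) :=
  measurableSet_Icc.prod measurableSet_Icc

theorem volume_box (x a : ℝ) : volume (box x a) = ENNReal.ofReal a ^ 2 := by
  rw [box, Measure.volume_eq_prod, Measure.prod_prod, Real.volume_Icc, Real.volume_Icc, sq]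
  simp

/-- The box has area a² and the kernel squared is at most (2/a)², so the bound does not depend on
the scale. -/
theorem lintegral_kernel_sq_le {μ : Measure (ℝ × ℝ)} (hμ : μ ≤ volume) {a : ℝ} (ha : 0 < a) (x : ℝ)
    {k : ℝ × ℝ → ℂ} (hk0 : ∀ q ∉ box x a, k q = 0) (hk : ∀ q, ‖k q‖ ≤ 2 / a) :
    ∫⁻ q, ‖k q‖ₑ ^ 2 ∂μ ≤ 4 := by
  calc ∫⁻ q, ‖k q‖ₑ ^ 2 ∂μ
      ≤ ∫⁻ q, (box x a).indicator (fun _ => ENNReal.ofReal (2 / a) ^ 2) q ∂volume := by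
        refine lintegral_mono' hμ fun q => ?_
        by_cases hq : q ∈ box x a
        · simp only [hq, indicator_of_mem]
          rw [← ofReal_norm]
          gcongr
          exact hk q
        · simp [hk0 q hq]
    _ = 4 := by
        rw [lintegral_indicator_const (measurableSet_box x a), volume_box, ← mul_pow,
          ← ENNReal.ofReal_mul (by positivity), div_mul_cancel₀ _ ha.ne']
        norm_num

/-- By Tonelli: a point q lies in the box at x only if x ∈ [q.1 - a, q.1], so integrating in x first
collects F over an interval of length a. -/
theorem lintegral_weighted_box_le {μ : Measure (ℝ × ℝ)} [SFinite μ] {a : ℝ} {F : ℝ → ℝ≥0∞}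
    (hF : Measurable F) {G : ℝ × ℝ → ℝ≥0∞} (hG : Measurable G) {w : ℝ≥0∞}
    (hw : ∀ u, ∫⁻ x in Icc (u - a) u, F x ≤ w) :
    ∫⁻ x, F x * ∫⁻ q in box x a, G q ∂μ ≤ w * ∫⁻ q, G q ∂μ := by
  have hS : MeasurableSet {p : ℝ × (ℝ × ℝ) | p.2 ∈ box p.1 a} := by
    have : {p : ℝ × (ℝ × ℝ) | p.2 ∈ box p.1 a} =
        {p | p.1 ≤ p.2.1} ∩ {p | p.2.1 ≤ p.1 + a} ∩ ({p | 0 ≤ p.2.2} ∩ {p | p.2.2 ≤ a}) := by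
      ext p
      simp only [box, mem_prod, mem_Icc, mem_ofPred_eq, mem_inter_iff, and_assoc]
    rw [this]
    refine ((measurableSet_le (by fun_prop) (by fun_prop)).inter
      (measurableSet_le (by fun_prop) (by fun_prop))).inter
      ((measurableSet_le (by fun_prop) (by fun_prop)).inter
      (measurableSet_le (by fun_prop) (by fun_prop)))
  let Φ : ℝ → ℝ × ℝ → ℝ≥0∞ := fun x q => F x * (box x a).indicator G q
  have hΦ : Measurable (Function.uncurry Φ) := by
    refine (hF.comp measurable_fst).mul ?_
    have : (fun p : ℝ × (ℝ × ℝ) => (box p.1 a).indicator G p.2) =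
        {p : ℝ × (ℝ × ℝ) | p.2 ∈ box p.1 a}.indicator fun p => G p.2 := by
      funext p
      by_cases hp : p.2 ∈ box p.1 a
      · rw [indicator_of_mem hp]
        exact (indicator_of_mem (s := {p : ℝ × (ℝ × ℝ) | p.2 ∈ box p.1 a})
          hp (fun p => G p.2)).symm
      · rw [indicator_of_notMem hp]
        exact (indicator_of_notMem (s := {p : ℝ × (ℝ × ℝ) | p.2 ∈ box p.1 a})
          hp (fun p => G p.2)).symm
    rw [this]
    exact (hG.comp measurable_snd).indicator hS
  calc ∫⁻ x, F x * ∫⁻ q in box x a, G q ∂μ = ∫⁻ x, ∫⁻ q, Φ x q ∂μ := by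
        refine lintegral_congr fun x => ?_
        rw [← lintegral_indicator (measurableSet_box x a),
          lintegral_const_mul _ (hG.indicator (measurableSet_box x a))]
    _ = ∫⁻ q, ∫⁻ x, Φ x q ∂volume ∂μ := lintegral_lintegral_swap hΦ.aemeasurable
    _ ≤ ∫⁻ q, w * G q ∂μ := by
        refine lintegral_mono fun q => ?_
        calc ∫⁻ x, Φ x q ≤ ∫⁻ x, (Icc (q.1 - a) q.1).indicator F x * G q := by
              refine lintegral_mono fun x => ?_
              by_cases hq : q ∈ box x a
              · have hx : x ∈ Icc (q.1 - a) q.1 := ⟨by linarith [hq.1.2], hq.1.1⟩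
                simp only [Φ, indicator_of_mem hq, indicator_of_mem hx, le_refl]
              · simp [Φ, indicator_of_notMem hq]
          _ ≤ w * G q := by
              rw [lintegral_mul_const _ (hF.indicator measurableSet_Icc),
                lintegral_indicator measurableSet_Icc]
              gcongr
              exact hw q.1
    _ = w * ∫⁻ q, G q ∂μ := lintegral_const_mul _ hG

/-- The integral operator with kernel `f(x) k(x, q)`, where `k(x, ·)` is supported in the box of
size `a` at `x` and bounded by `2 / a`: bounds for its operator and Hilbert-Schmidt norms. -/
theorem exists_kernelOp {μ : Measure (ℝ × ℝ)} [SFinite μ] (hμ : μ ≤ volume) {a : ℝ} (ha : 0 < a)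
    {f : ℝ → ℝ} (hf : Measurable f) {I w : ℝ}
    (hI : ∫⁻ x, ‖f x‖ₑ ^ 2 ≤ ENNReal.ofReal (I ^ 2)) (hI0 : 0 ≤ I) (hw0 : 0 ≤ w)
    (hw : ∀ u, ∫⁻ x in Icc (u - a) u, ‖f x‖ₑ ^ 2 ≤ ENNReal.ofReal (w ^ 2))
    {k : ℝ → ℝ × ℝ → ℂ} (hkm : StronglyMeasurable (Function.uncurry k))
    (hk0 : ∀ x, ∀ q ∉ box x a, k x q = 0) (hk : ∀ x q, ‖k x q‖ ≤ 2 / a) :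
    ∃ N : Lp ℂ 2 μ →L[ℂ] Lp ℂ 2 (volume : Measure ℝ),
      (∀ h : Lp ℂ 2 μ, N h =ᵐ[volume] fun x => (f x : ℂ) * ∫ q, k x q * h q ∂μ) ∧
      ‖N‖ ≤ 2 * w ∧ HSBound N (2 * I) := by
  have hkx : ∀ x, StronglyMeasurable (k x) := fun x => hkm.comp_measurable measurable_prodMk_left
  have hk4 : ∀ x, ∫⁻ q, ‖k x q‖ₑ ^ 2 ∂μ ≤ 4 := fun x =>
    lintegral_kernel_sq_le hμ ha x (hk0 x) (hk x)
  have hkL : ∀ x, MemLp (k x) 2 μ := fun x =>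
    memLp_two_of_lintegral_ne_top (hkx x).aestronglyMeasurable
      ((hk4 x).trans_lt (by norm_num)).ne
  have hint : ∀ x (h : Lp ℂ 2 μ), Integrable (fun q => k x q * h q) μ := fun x h =>
    (hkL x).integrable_mul (Lp.memLp h)
  let g : Lp ℂ 2 μ → ℝ → ℂ := fun h x => (f x : ℂ) * ∫ q, k x q * h q ∂μ
  have hgm : ∀ h, StronglyMeasurable (g h) := fun h => by
    have h1 : StronglyMeasurable (Function.uncurry fun (x : ℝ) (q : ℝ × ℝ) => k x q * h q) :=
      hkm.mul ((Lp.stronglyMeasurable h).comp_measurable measurable_snd)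
    exact (Complex.measurable_ofReal.comp hf).stronglyMeasurable.mul h1.integral_prod_right
  have hgb : ∀ h, ∫⁻ x, ‖g h x‖ₑ ^ 2 ≤ ENNReal.ofReal ((2 * w * ‖h‖) ^ 2) := fun h => by
    calc ∫⁻ x, ‖g h x‖ₑ ^ 2
        ≤ ∫⁻ x, 4 * (‖f x‖ₑ ^ 2 * ∫⁻ q in box x a, ‖h q‖ₑ ^ 2 ∂μ) := by
          refine lintegral_mono fun x => ?_
          simp only [g, enorm_mul, mul_pow]
          have h1 := (enorm_integral_mul_sq_le (hkx x).aestronglyMeasurable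
            (Lp.aestronglyMeasurable h) (measurableSet_box x a) (hk0 x)).trans
            (mul_le_mul_left (hk4 x) _)
          have h2 : ‖(f x : ℂ)‖ₑ = ‖f x‖ₑ := by
            rw [← ofReal_norm, Complex.norm_real, ofReal_norm]
          rw [h2, mul_left_comm]
          gcongr
      _ = 4 * ∫⁻ x, ‖f x‖ₑ ^ 2 * ∫⁻ q in box x a, ‖h q‖ₑ ^ 2 ∂μ :=
          lintegral_const_mul' _ _ (by norm_num)
      _ ≤ 4 * (ENNReal.ofReal (w ^ 2) * ∫⁻ q, ‖h q‖ₑ ^ 2 ∂μ) := by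
          gcongr
          exact lintegral_weighted_box_le (hf.enorm.pow_const 2)
            ((Lp.stronglyMeasurable h).measurable.enorm.pow_const 2) hw
      _ = ENNReal.ofReal ((2 * w * ‖h‖) ^ 2) := by
          rw [lintegral_enorm_sq, ← ENNReal.ofReal_mul (by positivity),
            show (4 : ℝ≥0∞) = ENNReal.ofReal 4 by norm_num, ← ENNReal.ofReal_mul (by norm_num)]
          congr 1
          ring
  have hgL : ∀ h, MemLp (g h) 2 volume := fun h =>
    memLp_two_of_lintegral_ne_top (hgm h).aestronglyMeasurable
      ((hgb h).trans_lt ENNReal.ofReal_lt_top).ne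
  let N₀ : Lp ℂ 2 μ →ₗ[ℂ] Lp ℂ 2 (volume : Measure ℝ) :=
    { toFun := fun h => (hgL h).toLp
      map_add' := fun h₁ h₂ => by
        rw [← MemLp.toLp_add]
        refine MemLp.toLp_congr _ _ (Eventually.of_forall fun x => ?_)
        simp only [g, Pi.add_apply]
        rw [← mul_add, ← integral_add (hint x h₁) (hint x h₂)]
        congr 1
        refine integral_congr_ae ?_
        filter_upwards [Lp.coeFn_add h₁ h₂] with q hq
        rw [hq, Pi.add_apply, mul_add]
      map_smul' := fun c h => by
        rw [RingHom.id_apply, ← MemLp.toLp_const_smul]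
        refine MemLp.toLp_congr _ _ (Eventually.of_forall fun x => ?_)
        simp only [g, Pi.smul_apply, smul_eq_mul]
        rw [mul_left_comm c, ← integral_const_mul c]
        congr 1
        refine integral_congr_ae ?_
        filter_upwards [Lp.coeFn_smul c h] with q hq
        rw [hq, Pi.smul_apply, smul_eq_mul, mul_left_comm] }
  have hN₀ : ∀ h, N₀ h =ᵐ[volume] g h := fun h => MemLp.coeFn_toLp (hgL h)
  have hN₀n : ∀ h, ENNReal.ofReal (‖N₀ h‖ ^ 2) = ∫⁻ x, ‖g h x‖ₑ ^ 2 := fun h => by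
    rw [← lintegral_enorm_sq]
    refine lintegral_congr_ae ?_
    filter_upwards [hN₀ h] with x hx
    rw [hx]
  have hbound : ∀ h, ‖N₀ h‖ ≤ 2 * w * ‖h‖ := fun h => by
    refine (pow_le_pow_iff_left₀ (norm_nonneg _) (by positivity) two_ne_zero).1 ?_
    rw [← ENNReal.ofReal_le_ofReal_iff (by positivity), hN₀n]
    exact hgb h
  refine ⟨N₀.mkContinuous _ hbound, hN₀, LinearMap.mkContinuous_norm_le _ (by positivity) _, ?_⟩
  rw [hsBound_iff (by positivity)]
  intro ι _ e he
  simp only [LinearMap.mkContinuous_apply]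
  rw [← ENNReal.ofReal_le_ofReal_iff (by positivity),
    ENNReal.ofReal_sum_of_nonneg fun _ _ => by positivity]
  simp only [hN₀n]
  rw [← lintegral_finsetSum _ fun i _ => (hgm (e i)).measurable.enorm.pow_const 2]
  -- At fixed x the integrals are the inner products of the conjugate kernel with an orthonormal
  -- family. Bessel bounds them by the squared L² norm of the kernel, and integrating against f²
  -- gives the Hilbert-Schmidt bound.
  have hbessel : ∀ x, ∑ i, ‖∫ q, k x q * e i q ∂μ‖ₑ ^ 2 ≤ 4 := fun x => by
    have hc : MemLp (fun q => conj (k x q)) 2 μ := (hkL x).star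
    have h1 : ∀ i, ∫ q, k x q * e i q ∂μ = inner ℂ (hc.toLp) (e i) := fun i => by
      rw [L2.inner_def]
      refine integral_congr_ae ?_
      filter_upwards [hc.coeFn_toLp] with q hq
      rw [hq, RCLike.inner_apply, Complex.conj_conj, mul_comm]
    have h2 : ENNReal.ofReal (‖hc.toLp‖ ^ 2) ≤ 4 := by
      rw [← lintegral_enorm_sq]
      refine le_trans (le_of_eq (lintegral_congr_ae ?_)) (hk4 x)
      filter_upwards [hc.coeFn_toLp] with q hq
      rw [hq, ← ofReal_norm, RCLike.norm_conj, ofReal_norm]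
    refine le_trans ?_ h2
    have h3 : ∀ i, ‖∫ q, k x q * e i q ∂μ‖ₑ ^ 2 =
        ENNReal.ofReal (‖inner ℂ (e i) (hc.toLp)‖ ^ 2) := fun i => by
      rw [h1, ← ofReal_norm, norm_inner_symm, ENNReal.ofReal_pow (norm_nonneg _)]
    simp only [h3]
    rw [← ENNReal.ofReal_sum_of_nonneg fun _ _ => by positivity]
    exact ENNReal.ofReal_le_ofReal (he.sum_inner_products_le _)
  calc ∫⁻ x, ∑ i, ‖g (e i) x‖ₑ ^ 2 ≤ ∫⁻ x, ‖f x‖ₑ ^ 2 * 4 := by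
        refine lintegral_mono fun x => ?_
        have h2 : ‖(f x : ℂ)‖ₑ = ‖f x‖ₑ := by
          rw [← ofReal_norm, Complex.norm_real, ofReal_norm]
        simp only [g, enorm_mul, mul_pow, h2]
        rw [← Finset.mul_sum]
        gcongr
        exact hbessel x
    _ ≤ ENNReal.ofReal (I ^ 2) * 4 := by
        rw [lintegral_mul_const' _ _ (by norm_num)]
        gcongr
    _ = ENNReal.ofReal ((2 * I) ^ 2) := by
        rw [show (4 : ℝ≥0∞) = ENNReal.ofReal 4 by norm_num, ← ENNReal.ofReal_mul (by positivity)]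
        congr 1
        ring

end KernelOperator

/-! ### Test functions, the trace inequality and integration by parts -/

section TestFunctions

/-- `φ ∈ C_c^∞(Ω)`. -/
structure IsTest (d₁ d₂ : ℝ) (φ : ℝ × ℝ → ℂ) : Prop where
  contDiff : ContDiff ℝ ∞ φ
  hasCompactSupport : HasCompactSupport φ
  tsupport_subset : tsupport φ ⊆ strip d₁ d₂

variable {d₁ d₂ : ℝ} {φ : ℝ × ℝ → ℂ}

theorem isOpen_strip (d₁ d₂ : ℝ) : IsOpen (strip d₁ d₂) := isOpen_univ.prod isOpen_Ioo

theorem measurableSet_strip (d₁ d₂ : ℝ) : MeasurableSet (strip d₁ d₂) :=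
  (isOpen_strip d₁ d₂).measurableSet

namespace IsTest

theorem eq_zero (h : IsTest d₁ d₂ φ) {q : ℝ × ℝ} (hq : q ∉ strip d₁ d₂) : φ q = 0 :=
  image_eq_zero_of_notMem_tsupport fun h' => hq (h.tsupport_subset h')

theorem differentiable (h : IsTest d₁ d₂ φ) : Differentiable ℝ φ :=
  h.contDiff.differentiable (by simp)

theorem fderiv_apply (h : IsTest d₁ d₂ φ) (e : ℝ × ℝ) :
    IsTest d₁ d₂ fun q => fderiv ℝ φ q e where
  contDiff := (h.contDiff.fderiv_right (m := ∞) (by simp)).clm_apply contDiff_const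
  hasCompactSupport := h.hasCompactSupport.fderiv_apply ℝ e
  tsupport_subset := (tsupport_fderiv_apply_subset ℝ e).trans h.tsupport_subset

theorem memLp (h : IsTest d₁ d₂ φ) (μ : Measure (ℝ × ℝ)) [IsFiniteMeasureOnCompacts μ] :
    MemLp φ 2 μ :=
  h.contDiff.continuous.memLp_of_hasCompactSupport h.hasCompactSupport

theorem memLp_line (h : IsTest d₁ d₂ φ) : MemLp (fun x => φ (x, 0)) 2 (volume : Measure ℝ) := by
  refine (h.contDiff.continuous.comp (by fun_prop)).memLp_of_hasCompactSupport ?_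
  have : Isometry fun x : ℝ => (x, (0 : ℝ)) := Isometry.of_dist_eq fun x y => by
    simp [Prod.dist_eq]
  exact h.hasCompactSupport.comp_isClosedEmbedding this.isClosedEmbedding

theorem add {ψ : ℝ × ℝ → ℂ} (h : IsTest d₁ d₂ φ) (h' : IsTest d₁ d₂ ψ) :
    IsTest d₁ d₂ fun q => φ q + ψ q where
  contDiff := h.contDiff.add h'.contDiff
  hasCompactSupport := h.hasCompactSupport.add h'.hasCompactSupport
  tsupport_subset := (tsupport_add φ ψ).trans
    (union_subset h.tsupport_subset h'.tsupport_subset)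

theorem const_mul (h : IsTest d₁ d₂ φ) (c : ℂ) : IsTest d₁ d₂ fun q => c * φ q where
  contDiff := contDiff_const.mul h.contDiff
  hasCompactSupport := h.hasCompactSupport.mul_left
  tsupport_subset := (tsupport_mul_subset_right).trans h.tsupport_subset

theorem hasDerivAt_slant (h : IsTest d₁ d₂ φ) (x s v : ℝ) :
    HasDerivAt (fun v => φ (x + v * s, v))
      ((s : ℂ) * fderiv ℝ φ (x + v * s, v) (1, 0) + fderiv ℝ φ (x + v * s, v) (0, 1)) v := by
  have h1 : HasDerivAt (fun v : ℝ => (x + v * s, v)) (s, (1 : ℝ)) v := by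
    have := (((hasDerivAt_id v).mul_const s).const_add x).prodMk (hasDerivAt_id v)
    simpa using this
  have h2 := HasFDerivAt.comp_hasDerivAt (f := fun v : ℝ => (x + v * s, v)) v
    (h.differentiable (x + v * s, v)).hasFDerivAt h1
  have h3 : ((s, 1) : ℝ × ℝ) = s • (1, 0) + (0, 1) := by simp
  rw [h3, map_add, map_smul, Complex.real_smul] at h2
  exact h2

/-- Integrate the derivative of |φ(x, ·)|² from the barrier up to y = d₁, where φ vanishes, and
split the product by Young's inequality with parameter δ. -/
theorem enorm_sq_barrier_le (h : IsTest d₁ d₂ φ) (hd : 0 < d₁) {δ : ℝ} (hδ : 0 < δ) (x : ℝ) :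
    ‖φ (x, 0)‖ₑ ^ 2 ≤ ∫⁻ v, ENNReal.ofReal (δ * ‖fderiv ℝ φ (x, v) (0, 1)‖ ^ 2 +
      δ⁻¹ * ‖φ (x, v)‖ ^ 2) := by
  set ψ : ℝ × ℝ → ℂ := fun q => fderiv ℝ φ q (0, 1) with hψ
  have hψc : Continuous ψ := (h.fderiv_apply (0, 1)).contDiff.continuous
  have hφc : Continuous φ := h.contDiff.continuous
  have h1 : ∀ v, HasDerivAt (fun v => ‖φ (x, v)‖ ^ 2) (2 * inner ℝ (φ (x, v)) (ψ (x, v))) v :=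
    fun v => by
      have h2 := h.hasDerivAt_slant x 0 v
      simp only [mul_zero, add_zero, Complex.ofReal_zero, zero_mul, zero_add] at h2
      exact h2.norm_sq
  have hcont : Continuous fun v => 2 * inner ℝ (φ (x, v)) (ψ (x, v)) := by fun_prop
  have h2 := intervalIntegral.integral_eq_sub_of_hasDerivAt (a := 0) (b := d₁) (fun v _ => h1 v)
    (hcont.intervalIntegrable _ _)
  have h3 : φ (x, d₁) = 0 := h.eq_zero fun hq => lt_irrefl _ hq.2.2
  rw [h3] at h2
  let G : ℝ → ℝ := fun v => δ * ‖ψ (x, v)‖ ^ 2 + δ⁻¹ * ‖φ (x, v)‖ ^ 2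
  have hG : Continuous G := by fun_prop
  have hG0 : ∀ v, 0 ≤ G v := fun v => by positivity
  have h4 : ‖φ (x, 0)‖ ^ 2 ≤ ∫ v in Ioc 0 d₁, G v := by
    rw [← intervalIntegral.integral_of_le hd.le]
    have h5 : ‖φ (x, 0)‖ ^ 2 = ∫ v in (0)..d₁, -(2 * inner ℝ (φ (x, v)) (ψ (x, v))) := by
      rw [intervalIntegral.integral_neg, h2]
      simp
    rw [h5]
    refine intervalIntegral.integral_mono_on hd.le (hcont.neg.intervalIntegrable _ _)
      (hG.intervalIntegrable _ _) fun v _ => ?_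
    have h6 := (abs_le.1 (abs_real_inner_le_norm (φ (x, v)) (ψ (x, v)))).1
    have h7 : G v - 2 * (‖φ (x, v)‖ * ‖ψ (x, v)‖) =
        δ⁻¹ * (δ * ‖ψ (x, v)‖ - ‖φ (x, v)‖) ^ 2 := by
      simp only [G]
      field_simp
      ring
    have h8 : 0 ≤ δ⁻¹ * (δ * ‖ψ (x, v)‖ - ‖φ (x, v)‖) ^ 2 := by positivity
    linarith
  calc ‖φ (x, 0)‖ₑ ^ 2 = ENNReal.ofReal (‖φ (x, 0)‖ ^ 2) := by
        rw [ENNReal.ofReal_pow (norm_nonneg _), ofReal_norm]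
    _ ≤ ENNReal.ofReal (∫ v in Ioc 0 d₁, G v) := ENNReal.ofReal_le_ofReal h4
    _ = ∫⁻ v in Ioc 0 d₁, ENNReal.ofReal (G v) :=
        ofReal_integral_eq_lintegral_ofReal (hG.integrableOn_Ioc)
          (Eventually.of_forall hG0)
    _ ≤ ∫⁻ v, ENNReal.ofReal (G v) := setLIntegral_le_lintegral _ _

/-- The trace inequality for test functions. -/
theorem lintegral_barrier_le (h : IsTest d₁ d₂ φ) (hd : 0 < d₁) {δ : ℝ} (hδ : 0 < δ) :
    ∫⁻ x, ‖φ (x, 0)‖ₑ ^ 2 ≤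
      ENNReal.ofReal δ * (∫⁻ q in strip d₁ d₂, ‖fderiv ℝ φ q (0, 1)‖ₑ ^ 2) +
      ENNReal.ofReal δ⁻¹ * ∫⁻ q in strip d₁ d₂, ‖φ q‖ₑ ^ 2 := by
  set ψ : ℝ × ℝ → ℂ := fun q => fderiv ℝ φ q (0, 1) with hψ
  have hψt : IsTest d₁ d₂ ψ := h.fderiv_apply (0, 1)
  have hψc : Continuous ψ := hψt.contDiff.continuous
  have hφc : Continuous φ := h.contDiff.continuous
  have e : ∀ q, ENNReal.ofReal (δ * ‖ψ q‖ ^ 2 + δ⁻¹ * ‖φ q‖ ^ 2) =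
      ENNReal.ofReal δ * ‖ψ q‖ₑ ^ 2 + ENNReal.ofReal δ⁻¹ * ‖φ q‖ₑ ^ 2 := fun q => by
    rw [ENNReal.ofReal_add (by positivity) (by positivity), ENNReal.ofReal_mul hδ.le,
      ENNReal.ofReal_mul (by positivity), ENNReal.ofReal_pow (norm_nonneg _),
      ENNReal.ofReal_pow (norm_nonneg _), ofReal_norm, ofReal_norm]
  have hr : ∀ χ : ℝ × ℝ → ℂ, IsTest d₁ d₂ χ →
      ∫⁻ q, ‖χ q‖ₑ ^ 2 = ∫⁻ q in strip d₁ d₂, ‖χ q‖ₑ ^ 2 := fun χ hχ => by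
    rw [← lintegral_indicator (measurableSet_strip d₁ d₂)]
    refine lintegral_congr fun q => ?_
    by_cases hq : q ∈ strip d₁ d₂ <;> simp [hq, hχ.eq_zero]
  calc ∫⁻ x, ‖φ (x, 0)‖ₑ ^ 2
      ≤ ∫⁻ x, ∫⁻ v, ENNReal.ofReal (δ * ‖ψ (x, v)‖ ^ 2 + δ⁻¹ * ‖φ (x, v)‖ ^ 2) :=
        lintegral_mono fun x => h.enorm_sq_barrier_le hd hδ x
    _ = ∫⁻ q, ENNReal.ofReal (δ * ‖ψ q‖ ^ 2 + δ⁻¹ * ‖φ q‖ ^ 2) := by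
        rw [Measure.volume_eq_prod, lintegral_prod _ (by fun_prop)]
    _ = _ := by
        simp only [e]
        rw [lintegral_add_left (by fun_prop), lintegral_const_mul _ (by fun_prop),
          lintegral_const_mul _ (by fun_prop), hr φ h, hr ψ hψt]

theorem integral_mul_fderiv (h : IsTest d₁ d₂ φ) {g : ℝ × ℝ → ℂ} (hg : IsTest d₁ d₂ g)
    (e : ℝ × ℝ) : ∫ q in strip d₁ d₂, g q * fderiv ℝ φ q e =
      - ∫ q in strip d₁ d₂, fderiv ℝ g q e * φ q := by
  have hr : ∀ χ η : ℝ × ℝ → ℂ, IsTest d₁ d₂ χ →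
      ∫ q in strip d₁ d₂, η q * χ q = ∫ q, η q * χ q := fun χ η hχ =>
    setIntegral_eq_integral_of_forall_compl_eq_zero fun q hq => by rw [hχ.eq_zero hq, mul_zero]
  rw [hr _ _ (h.fderiv_apply e), hr _ _ h]
  exact integral_mul_fderiv_eq_neg_fderiv_mul_of_integrable
    (((hg.fderiv_apply e).memLp volume).integrable_mul (h.memLp volume))
    ((hg.memLp volume).integrable_mul ((h.fderiv_apply e).memLp volume))
    ((hg.memLp volume).integrable_mul (h.memLp volume))
    (fun q _ => hg.differentiable q) (fun q _ => h.differentiable q)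

end IsTest

end TestFunctions

/-! ### Representation of the boundary value by dyadic sector averages -/

section SectorKernel

/-- The part of the sector at the point `x` of the barrier at heights between `a / 2` and `a`. -/
def sector (x a : ℝ) : Set (ℝ × ℝ) := {q | q.2 ∈ Ioc (a / 2) a ∧ q.1 ∈ Ioc x (x + q.2)}

/-- The kernel acting on `∂φ/∂x` in the representation of `φ(x, 0)` by the gradient of `φ`. -/
def kerX (a x : ℝ) : ℝ × ℝ → ℂ := (sector x a).indicator fun q => (((q.1 - x) / q.2 ^ 2 : ℝ) : ℂ)

/-- The kernel acting on `∂φ/∂y` in the representation of `φ(x, 0)` by the gradient of `φ`. -/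
def kerY (a x : ℝ) : ℝ × ℝ → ℂ := (sector x a).indicator fun q => ((1 / q.2 : ℝ) : ℂ)

theorem measurableSet_sector_prod (a : ℝ) :
    MeasurableSet {p : ℝ × (ℝ × ℝ) | p.2 ∈ sector p.1 a} := by
  have : {p : ℝ × (ℝ × ℝ) | p.2 ∈ sector p.1 a} =
      ({p | a / 2 < p.2.2} ∩ {p | p.2.2 ≤ a}) ∩
        ({p | p.1 < p.2.1} ∩ {p | p.2.1 ≤ p.1 + p.2.2}) := by
    ext p
    simp only [sector, mem_Ioc, mem_ofPred_eq, mem_inter_iff]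
  rw [this]
  exact ((measurableSet_lt (by fun_prop) (by fun_prop)).inter
    (measurableSet_le (by fun_prop) (by fun_prop))).inter
    ((measurableSet_lt (by fun_prop) (by fun_prop)).inter
    (measurableSet_le (by fun_prop) (by fun_prop)))

theorem stronglyMeasurable_sector_indicator (a : ℝ) {g : ℝ × (ℝ × ℝ) → ℝ} (hg : Measurable g) :
    StronglyMeasurable (Function.uncurry fun x : ℝ =>
      (sector x a).indicator fun q => ((g (x, q) : ℝ) : ℂ)) := by
  have : (Function.uncurry fun x : ℝ => (sector x a).indicator fun q => ((g (x, q) : ℝ) : ℂ)) =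
      {p : ℝ × (ℝ × ℝ) | p.2 ∈ sector p.1 a}.indicator fun p => (g p : ℂ) := by
    funext p
    by_cases hp : p.2 ∈ sector p.1 a
    · exact (indicator_of_mem hp (fun q => ((g (p.1, q) : ℝ) : ℂ))).trans (indicator_of_mem
        (s := {p : ℝ × (ℝ × ℝ) | p.2 ∈ sector p.1 a}) hp (fun p => (g p : ℂ))).symm
    · exact (indicator_of_notMem hp (fun q => ((g (p.1, q) : ℝ) : ℂ))).trans (indicator_of_notMem
        (s := {p : ℝ × (ℝ × ℝ) | p.2 ∈ sector p.1 a}) hp (fun p => (g p : ℂ))).symm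
  rw [this]
  exact ((Complex.measurable_ofReal.comp hg).indicator
    (measurableSet_sector_prod a)).stronglyMeasurable

theorem stronglyMeasurable_kerX (a : ℝ) : StronglyMeasurable (Function.uncurry (kerX a)) :=
  stronglyMeasurable_sector_indicator a (g := fun p => (p.2.1 - p.1) / p.2.2 ^ 2) (by fun_prop)

theorem stronglyMeasurable_kerY (a : ℝ) : StronglyMeasurable (Function.uncurry (kerY a)) :=
  stronglyMeasurable_sector_indicator a (g := fun p => 1 / p.2.2) (by fun_prop)

theorem sector_subset_box {a : ℝ} (ha : 0 < a) (x : ℝ) : sector x a ⊆ box x a := fun q hq =>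
  ⟨⟨hq.2.1.le, by linarith [hq.2.2, hq.1.2]⟩, by linarith [hq.1.1], hq.1.2⟩

theorem kerX_eq_zero {a : ℝ} (ha : 0 < a) (x : ℝ) : ∀ q ∉ box x a, kerX a x q = 0 := fun _ hq =>
  indicator_of_notMem (fun h => hq (sector_subset_box ha x h)) _

theorem kerY_eq_zero {a : ℝ} (ha : 0 < a) (x : ℝ) : ∀ q ∉ box x a, kerY a x q = 0 := fun _ hq =>
  indicator_of_notMem (fun h => hq (sector_subset_box ha x h)) _

theorem norm_kerY_le {a : ℝ} (ha : 0 < a) (x : ℝ) (q : ℝ × ℝ) : ‖kerY a x q‖ ≤ 2 / a := by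
  by_cases hq : q ∈ sector x a
  · rw [kerY, indicator_of_mem hq, Complex.norm_real, Real.norm_eq_abs]
    have h1 : 0 < q.2 := by linarith [hq.1.1]
    rw [abs_of_pos (by positivity), div_le_div_iff₀ h1 ha]
    linarith [hq.1.1]
  · rw [kerY, indicator_of_notMem hq, norm_zero]
    positivity

/-- On the sector 0 < q.1 - x ≤ q.2, so this kernel is dominated by `kerY`. -/
theorem norm_kerX_le {a : ℝ} (ha : 0 < a) (x : ℝ) (q : ℝ × ℝ) : ‖kerX a x q‖ ≤ 2 / a := by
  by_cases hq : q ∈ sector x a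
  · refine le_trans ?_ (norm_kerY_le ha x q)
    rw [kerX, kerY, indicator_of_mem hq, indicator_of_mem hq, Complex.norm_real, Complex.norm_real,
      Real.norm_eq_abs, Real.norm_eq_abs]
    have h1 : 0 < q.2 := by linarith [hq.1.1]
    have h2 : 0 < q.1 - x := sub_pos.2 hq.2.1
    rw [abs_of_pos (by positivity), abs_of_pos (by positivity), div_le_div_iff₀ (by positivity) h1]
    nlinarith [hq.2.2]
  · rw [kerX, indicator_of_notMem hq, norm_zero]
    positivity

theorem memLp_of_kernel {μ : Measure (ℝ × ℝ)} (hμ : μ ≤ volume) {a : ℝ} (ha : 0 < a) (x : ℝ)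
    {k : ℝ → ℝ × ℝ → ℂ} (hkm : StronglyMeasurable (Function.uncurry k))
    (hk0 : ∀ q ∉ box x a, k x q = 0) (hk : ∀ q, ‖k x q‖ ≤ 2 / a) : MemLp (k x) 2 μ :=
  memLp_two_of_lintegral_ne_top
    (hkm.comp_measurable measurable_prodMk_left).aestronglyMeasurable
    ((lintegral_kernel_sq_le hμ ha x hk0 hk).trans_lt (by norm_num)).ne

/-- The average of `φ` over the part of the sector at `x` at height `a`. -/
def sectorAvg (φ : ℝ × ℝ → ℂ) (a x : ℝ) : ℂ := ∫ s in (0 : ℝ)..1, φ (x + a * s, a)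

variable {d₁ d₂ : ℝ} {φ : ℝ × ℝ → ℂ}

/-- The fundamental theorem of calculus along each ray v ↦ (x + v s, v), averaged over the slope s.
-/
theorem IsTest.sectorAvg_sub (h : IsTest d₁ d₂ φ) (a x : ℝ) :
    sectorAvg φ a x - sectorAvg φ (a / 2) x =
      ∫ v in (a / 2)..a, ∫ s in (0 : ℝ)..1, ((s : ℂ) * fderiv ℝ φ (x + v * s, v) (1, 0) +
        fderiv ℝ φ (x + v * s, v) (0, 1)) := by
  have c0 : Continuous φ := h.contDiff.continuous
  have c1 : Continuous fun q => fderiv ℝ φ q (1, 0) := (h.fderiv_apply (1, 0)).contDiff.continuous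
  have c2 : Continuous fun q => fderiv ℝ φ q (0, 1) := (h.fderiv_apply (0, 1)).contDiff.continuous
  have c : Continuous fun p : ℝ × ℝ => (p.2 : ℂ) * fderiv ℝ φ (x + p.1 * p.2, p.1) (1, 0) +
      fderiv ℝ φ (x + p.1 * p.2, p.1) (0, 1) := by
    have e : Continuous fun p : ℝ × ℝ => (x + p.1 * p.2, p.1) := by fun_prop
    exact ((Complex.continuous_ofReal.comp continuous_snd).mul (c1.comp e)).add (c2.comp e)
  rw [intervalIntegral_intervalIntegral_swap]
  · rw [sectorAvg, sectorAvg, ← intervalIntegral.integral_sub]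
    · refine intervalIntegral.integral_congr fun s _ => ?_
      have := intervalIntegral.integral_eq_sub_of_hasDerivAt (a := a / 2) (b := a)
        (fun v _ => h.hasDerivAt_slant x s v) (Continuous.intervalIntegrable
          (c.comp (continuous_id.prodMk continuous_const) :
            Continuous fun v : ℝ => (s : ℂ) * fderiv ℝ φ (x + v * s, v) (1, 0) +
              fderiv ℝ φ (x + v * s, v) (0, 1)) _ _)
      exact this.symm
    · exact Continuous.intervalIntegrable (by fun_prop) _ _
    · exact Continuous.intervalIntegrable (by fun_prop) _ _
  · refine IntegrableOn.mono_set ?_ (prod_mono uIoc_subset_uIcc uIoc_subset_uIcc)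
    exact c.continuousOn.integrableOn_compact (isCompact_uIcc.prod isCompact_uIcc)

/-- In the coordinate u = x + v s one has s = (u - x)/v and ds = du/v. The coefficients s and 1 of
the two derivatives become (u - x)/v² and 1/v, which are the two kernels. -/
theorem IsTest.integral_kernel (h : IsTest d₁ d₂ φ) {a : ℝ} (ha : 0 < a) (x : ℝ) :
    (∫ q in strip d₁ d₂, kerX a x q * fderiv ℝ φ q (1, 0)) +
      (∫ q in strip d₁ d₂, kerY a x q * fderiv ℝ φ q (0, 1)) =
      sectorAvg φ a x - sectorAvg φ (a / 2) x := by
  have t1 := h.fderiv_apply (1, 0)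
  have t2 := h.fderiv_apply (0, 1)
  have c1 := t1.contDiff.continuous
  have c2 := t2.contDiff.continuous
  have hr : ∀ χ η : ℝ × ℝ → ℂ, IsTest d₁ d₂ χ →
      ∫ q in strip d₁ d₂, η q * χ q = ∫ q, η q * χ q := fun χ η hχ =>
    setIntegral_eq_integral_of_forall_compl_eq_zero fun q hq => by rw [hχ.eq_zero hq, mul_zero]
  have i1 : Integrable (fun q => kerX a x q * fderiv ℝ φ q (1, 0)) :=
    (memLp_of_kernel le_rfl ha x (stronglyMeasurable_kerX a) (kerX_eq_zero ha x)
      (norm_kerX_le ha x)).integrable_mul (t1.memLp volume)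
  have i2 : Integrable (fun q => kerY a x q * fderiv ℝ φ q (0, 1)) :=
    (memLp_of_kernel le_rfl ha x (stronglyMeasurable_kerY a) (kerY_eq_zero ha x)
      (norm_kerY_le ha x)).integrable_mul (t2.memLp volume)
  have i3 : Integrable (fun q => kerX a x q * fderiv ℝ φ q (1, 0) +
      kerY a x q * fderiv ℝ φ q (0, 1)) := i1.add i2
  rw [Measure.volume_eq_prod] at i3
  rw [hr _ _ t1, hr _ _ t2, ← integral_add i1 i2, h.sectorAvg_sub, Measure.volume_eq_prod,
    integral_prod_symm _ i3, intervalIntegral.integral_of_le (by linarith),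
    ← integral_indicator measurableSet_Ioc]
  refine integral_congr_ae (Eventually.of_forall fun v => ?_)
  by_cases hv : v ∈ Ioc (a / 2) a
  · have hv0 : 0 < v := by linarith [hv.1]
    let ψ : ℝ → ℂ := fun u => (((u - x) / v ^ 2 : ℝ) : ℂ) * fderiv ℝ φ (u, v) (1, 0) +
      ((1 / v : ℝ) : ℂ) * fderiv ℝ φ (u, v) (0, 1)
    have e1 : ∀ u, kerX a x (u, v) * fderiv ℝ φ (u, v) (1, 0) +
        kerY a x (u, v) * fderiv ℝ φ (u, v) (0, 1) = (Ioc x (x + v)).indicator ψ u := fun u => by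
      by_cases hu : u ∈ Ioc x (x + v)
      · have hq : (u, v) ∈ sector x a := ⟨hv, hu⟩
        rw [kerX, kerY, indicator_of_mem hq, indicator_of_mem hq, indicator_of_mem hu]
      · have hq : (u, v) ∉ sector x a := fun hq => hu hq.2
        rw [kerX, kerY, indicator_of_notMem hq, indicator_of_notMem hq, indicator_of_notMem hu,
          zero_mul, zero_mul, add_zero]
    simp only [e1, indicator_of_mem hv]
    rw [integral_indicator measurableSet_Ioc, ← intervalIntegral.integral_of_le (by linarith)]
    have e2 := intervalIntegral.smul_integral_comp_add_mul (a := 0) (b := 1) (f := ψ) v x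
    rw [mul_zero, mul_one, add_zero] at e2
    rw [← e2, ← intervalIntegral.integral_smul]
    refine intervalIntegral.integral_congr fun s _ => ?_
    have hvc : (v : ℂ) ≠ 0 := by exact_mod_cast hv0.ne'
    simp only [ψ, Complex.real_smul]
    push_cast
    field_simp
    ring
  · have e1 : ∀ u, kerX a x (u, v) * fderiv ℝ φ (u, v) (1, 0) +
        kerY a x (u, v) * fderiv ℝ φ (u, v) (0, 1) = 0 := fun u => by
      have hq : (u, v) ∉ sector x a := fun hq => hv hq.1
      rw [kerX, kerY, indicator_of_notMem hq, indicator_of_notMem hq, zero_mul, zero_mul, add_zero]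
    simp only [e1, indicator_of_notMem hv, integral_zero]

theorem IsTest.sectorAvg_eq_zero (h : IsTest d₁ d₂ φ) (x : ℝ) : sectorAvg φ d₁ x = 0 := by
  have : ∀ s : ℝ, φ (x + d₁ * s, d₁) = 0 := fun s => h.eq_zero fun hq => lt_irrefl _ hq.2.2
  simp [sectorAvg, this]

/-- The average is continuous in its height, and at height 0 every ray sits at (x, 0). -/
theorem IsTest.tendsto_sectorAvg (h : IsTest d₁ d₂ φ) (d x : ℝ) :
    Tendsto (fun n : ℕ => sectorAvg φ (d / 2 ^ n) x) atTop (𝓝 (φ (x, 0))) := by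
  have c0 : Continuous φ := h.contDiff.continuous
  have h1 : Continuous fun a => sectorAvg φ a x := by
    unfold sectorAvg
    exact intervalIntegral.continuous_parametric_intervalIntegral_of_continuous'
      (by fun_prop) 0 1
  have h2 : sectorAvg φ 0 x = φ (x, 0) := by simp [sectorAvg]
  rw [← h2]
  refine (h1.tendsto 0).comp ?_
  have := (tendsto_pow_atTop_nhds_zero_of_lt_one (r := (1 / 2 : ℝ)) (by norm_num)
    (by norm_num)).const_mul d
  rw [mul_zero] at this
  refine this.congr fun n => ?_
  rw [div_pow, one_pow, mul_one_div]

/-- The value on the barrier is a sum of integrals of the gradient. -/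
theorem IsTest.tendsto_sum_kernel (h : IsTest d₁ d₂ φ) (hd : 0 < d₁) (x : ℝ) :
    Tendsto (fun n : ℕ => ∑ j ∈ Finset.range n,
      ((∫ q in strip d₁ d₂, kerX (d₁ / 2 ^ j) x q * fderiv ℝ φ q (1, 0)) +
      (∫ q in strip d₁ d₂, kerY (d₁ / 2 ^ j) x q * fderiv ℝ φ q (0, 1)))) atTop
      (𝓝 (-φ (x, 0))) := by
  have e : ∀ n : ℕ, ∑ j ∈ Finset.range n,
      ((∫ q in strip d₁ d₂, kerX (d₁ / 2 ^ j) x q * fderiv ℝ φ q (1, 0)) +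
      (∫ q in strip d₁ d₂, kerY (d₁ / 2 ^ j) x q * fderiv ℝ φ q (0, 1))) =
      - sectorAvg φ (d₁ / 2 ^ n) x := fun n => by
    induction n with
    | zero => simp [h.sectorAvg_eq_zero x]
    | succ n ih =>
      rw [Finset.sum_range_succ, ih, h.integral_kernel (by positivity), pow_succ, div_div]
      ring
  simp only [e]
  exact (h.tendsto_sectorAvg d₁ x).neg

end SectorKernel

/-! ### The Hilbert space H¹₀(Ω) with its embedding, gradient and trace -/

section FormSpace

/-- `L²(Ω) × L²(Ω) × L²(Ω) × L²(m)` with its Hilbert space structure. -/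
abbrev QuadSpace (d₁ d₂ : ℝ) : Type :=
  WithLp 2 (WithLp 2 (L2Strip d₁ d₂ × L2Strip d₁ d₂) × WithLp 2 (L2Strip d₁ d₂ × L2Line))

/-- The components of an element of `QuadSpace`. -/
def quadProd (d₁ d₂ : ℝ) :
    QuadSpace d₁ d₂ →L[ℂ] L2Strip d₁ d₂ × L2Strip d₁ d₂ × L2Strip d₁ d₂ × L2Line :=
  (WithLp.fstL 2 ℂ _ _ ∘L WithLp.fstL 2 ℂ _ _).prod
    ((WithLp.sndL 2 ℂ _ _ ∘L WithLp.fstL 2 ℂ _ _).prod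
      ((WithLp.fstL 2 ℂ _ _ ∘L WithLp.sndL 2 ℂ _ _).prod
        (WithLp.sndL 2 ℂ _ _ ∘L WithLp.sndL 2 ℂ _ _)))

/-- `H¹₀(Ω)` as a closed subspace of the Hilbert space of quadruples. -/
def formSubmodule (d₁ d₂ : ℝ) : Submodule ℂ (QuadSpace d₁ d₂) :=
  (sobolevTrace d₁ d₂).comap (quadProd d₁ d₂ : QuadSpace d₁ d₂ →ₗ[ℂ] _)

theorem isClosed_formSubmodule (d₁ d₂ : ℝ) :
    IsClosed (formSubmodule d₁ d₂ : Set (QuadSpace d₁ d₂)) :=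
  (Submodule.isClosed_topologicalClosure _).preimage (quadProd d₁ d₂).continuous

/-- `H¹₀(Ω)` as a Hilbert space. -/
def FormSpace (d₁ d₂ : ℝ) : Type := ↥(formSubmodule d₁ d₂)

instance (d₁ d₂ : ℝ) : NormedAddCommGroup (FormSpace d₁ d₂) :=
  inferInstanceAs (NormedAddCommGroup ↥(formSubmodule d₁ d₂))

instance (d₁ d₂ : ℝ) : InnerProductSpace ℂ (FormSpace d₁ d₂) :=
  inferInstanceAs (InnerProductSpace ℂ ↥(formSubmodule d₁ d₂))

instance (d₁ d₂ : ℝ) : CompleteSpace (FormSpace d₁ d₂) :=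
  (isClosed_formSubmodule d₁ d₂).completeSpace_coe

/-- The inclusion of `H¹₀(Ω)` in the space of quadruples. -/
def formIncl (d₁ d₂ : ℝ) : FormSpace d₁ d₂ →L[ℂ] QuadSpace d₁ d₂ := (formSubmodule d₁ d₂).subtypeL

/-- The embedding of `H¹₀(Ω)` in `L²(Ω)`. -/
def embL (d₁ d₂ : ℝ) : FormSpace d₁ d₂ →L[ℂ] L2Strip d₁ d₂ :=
  (WithLp.fstL 2 ℂ _ _ ∘L WithLp.fstL 2 ℂ _ _) ∘L formIncl d₁ d₂

/-- `∂/∂x` on `H¹₀(Ω)`. -/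
def gradX (d₁ d₂ : ℝ) : FormSpace d₁ d₂ →L[ℂ] L2Strip d₁ d₂ :=
  (WithLp.sndL 2 ℂ _ _ ∘L WithLp.fstL 2 ℂ _ _) ∘L formIncl d₁ d₂

/-- `∂/∂y` on `H¹₀(Ω)`. -/
def gradY (d₁ d₂ : ℝ) : FormSpace d₁ d₂ →L[ℂ] L2Strip d₁ d₂ :=
  (WithLp.fstL 2 ℂ _ _ ∘L WithLp.sndL 2 ℂ _ _) ∘L formIncl d₁ d₂

/-- The trace operator `I_m`. -/
def traceL (d₁ d₂ : ℝ) : FormSpace d₁ d₂ →L[ℂ] L2Line :=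
  (WithLp.sndL 2 ℂ _ _ ∘L WithLp.sndL 2 ℂ _ _) ∘L formIncl d₁ d₂

variable {d₁ d₂ : ℝ}

theorem mem_sobolevTrace_of_formSpace (u : FormSpace d₁ d₂) :
    (embL d₁ d₂ u, gradX d₁ d₂ u, gradY d₁ d₂ u, traceL d₁ d₂ u) ∈ sobolevTrace d₁ d₂ := u.2

theorem exists_formSpace {ψ ψx ψy : L2Strip d₁ d₂} {t : L2Line}
    (h : (ψ, ψx, ψy, t) ∈ sobolevTrace d₁ d₂) :
    ∃ u : FormSpace d₁ d₂, embL d₁ d₂ u = ψ ∧ gradX d₁ d₂ u = ψx ∧ gradY d₁ d₂ u = ψy ∧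
      traceL d₁ d₂ u = t :=
  ⟨⟨WithLp.toLp 2 (WithLp.toLp 2 (ψ, ψx), WithLp.toLp 2 (ψy, t)), h⟩, rfl, rfl, rfl, rfl⟩

theorem formSpace_norm_sq (u : FormSpace d₁ d₂) : ‖u‖ ^ 2 =
    ‖embL d₁ d₂ u‖ ^ 2 + ‖gradX d₁ d₂ u‖ ^ 2 + (‖gradY d₁ d₂ u‖ ^ 2 + ‖traceL d₁ d₂ u‖ ^ 2) := by
  have h : ‖u‖ = ‖formIncl d₁ d₂ u‖ := rfl
  rw [h, WithLp.prod_norm_sq_eq_of_L2, WithLp.prod_norm_sq_eq_of_L2,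
    WithLp.prod_norm_sq_eq_of_L2]
  rfl

/-- The quadruple `p` is given by the test function `φ`. -/
def IsTestQuad (d₁ d₂ : ℝ) (φ : ℝ × ℝ → ℂ)
    (p : L2Strip d₁ d₂ × L2Strip d₁ d₂ × L2Strip d₁ d₂ × L2Line) : Prop :=
  p.1 =ᵐ[volume.restrict (strip d₁ d₂)] φ ∧
  p.2.1 =ᵐ[volume.restrict (strip d₁ d₂)] (fun q => fderiv ℝ φ q (1, 0)) ∧
  p.2.2.1 =ᵐ[volume.restrict (strip d₁ d₂)] (fun q => fderiv ℝ φ q (0, 1)) ∧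
  p.2.2.2 =ᵐ[volume] (fun x => φ (x, 0))

theorem IsTest.exists_isTestQuad {φ : ℝ × ℝ → ℂ} (h : IsTest d₁ d₂ φ) :
    ∃ p ∈ sobolevTrace d₁ d₂, IsTestQuad d₁ d₂ φ p := by
  let p : L2Strip d₁ d₂ × L2Strip d₁ d₂ × L2Strip d₁ d₂ × L2Line :=
    ((h.memLp _).toLp, ((h.fderiv_apply (1, 0)).memLp _).toLp,
      ((h.fderiv_apply (0, 1)).memLp _).toLp, h.memLp_line.toLp)
  have hp : IsTestQuad d₁ d₂ φ p := ⟨(h.memLp _).coeFn_toLp,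
    ((h.fderiv_apply (1, 0)).memLp _).coeFn_toLp, ((h.fderiv_apply (0, 1)).memLp _).coeFn_toLp,
    h.memLp_line.coeFn_toLp⟩
  exact ⟨p, Submodule.le_topologicalClosure _ (Submodule.subset_span
    ⟨φ, h.contDiff, h.hasCompactSupport, h.tsupport_subset, hp⟩), hp⟩

/-- A closed property of quadruples holds on `H¹₀(Ω)` if it holds for test functions. -/
theorem sobolevTrace_induction
    {P : L2Strip d₁ d₂ × L2Strip d₁ d₂ × L2Strip d₁ d₂ × L2Line → Prop}
    (hP : IsClosed {p | P p}) (h : ∀ φ p, IsTest d₁ d₂ φ → IsTestQuad d₁ d₂ φ p → P p)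
    {p : L2Strip d₁ d₂ × L2Strip d₁ d₂ × L2Strip d₁ d₂ × L2Line} (hp : p ∈ sobolevTrace d₁ d₂) :
    P p := by
  have hp' := hp
  rw [sobolevTrace, ← SetLike.mem_coe, Submodule.topologicalClosure_coe] at hp'
  refine closure_minimal (fun q hq => ?_) hP hp'
  -- The test quadruples already form a subspace, so the span adds nothing and P need not be linear.
  -- The quadratic trace inequality uses this.
  suffices hq' : ∃ φ, IsTest d₁ d₂ φ ∧ IsTestQuad d₁ d₂ φ q by
    obtain ⟨φ, h1, h2⟩ := hq'
    exact h φ q h1 h2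
  induction hq using Submodule.span_induction with
  | mem q hq =>
    obtain ⟨φ, h1, h2, h3, h4⟩ := hq
    exact ⟨φ, ⟨h1, h2, h3⟩, h4⟩
  | zero =>
    refine ⟨fun _ => 0, ⟨contDiff_const, HasCompactSupport.zero, ?_⟩, ?_, ?_, ?_, ?_⟩
    · rw [show (fun _ : ℝ × ℝ => (0 : ℂ)) = 0 from rfl, tsupport_zero]
      exact empty_subset _
    · exact Lp.coeFn_zero _ _ _
    · filter_upwards [Lp.coeFn_zero ℂ 2 (volume.restrict (strip d₁ d₂))] with x hx
      simpa using hx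
    · filter_upwards [Lp.coeFn_zero ℂ 2 (volume.restrict (strip d₁ d₂))] with x hx
      simpa using hx
    · exact Lp.coeFn_zero _ _ _
  | add p q _ _ hp hq =>
    obtain ⟨φ, h1, a1, a2, a3, a4⟩ := hp
    obtain ⟨ψ, h2, b1, b2, b3, b4⟩ := hq
    have hf : ∀ x e, fderiv ℝ (fun q => φ q + ψ q) x e = fderiv ℝ φ x e + fderiv ℝ ψ x e :=
      fun x e => by
        rw [fderiv_fun_add (h1.differentiable x) (h2.differentiable x)]
        rfl
    refine ⟨fun q => φ q + ψ q, h1.add h2, ?_, ?_, ?_, ?_⟩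
    · filter_upwards [a1, b1, Lp.coeFn_add p.1 q.1] with x e1 e2 e3
      rw [Prod.fst_add, e3, Pi.add_apply, e1, e2]
    · filter_upwards [a2, b2, Lp.coeFn_add p.2.1 q.2.1] with x e1 e2 e3
      rw [Prod.snd_add, Prod.fst_add, e3, Pi.add_apply, e1, e2, hf]
    · filter_upwards [a3, b3, Lp.coeFn_add p.2.2.1 q.2.2.1] with x e1 e2 e3
      rw [Prod.snd_add, Prod.snd_add, Prod.fst_add, e3, Pi.add_apply, e1, e2, hf]
    · filter_upwards [a4, b4, Lp.coeFn_add p.2.2.2 q.2.2.2] with x e1 e2 e3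
      rw [Prod.snd_add, Prod.snd_add, Prod.snd_add, e3, Pi.add_apply, e1, e2]
  | smul c q _ hq =>
    obtain ⟨φ, h1, a1, a2, a3, a4⟩ := hq
    have hf : ∀ x e, fderiv ℝ (fun q => c * φ q) x e = c * fderiv ℝ φ x e :=
      fun x e => by
        rw [fderiv_const_mul (h1.differentiable x)]
        rfl
    refine ⟨fun q => c * φ q, h1.const_mul c, ?_, ?_, ?_, ?_⟩
    · filter_upwards [a1, Lp.coeFn_smul c q.1] with x e1 e3
      rw [Prod.smul_fst, e3, Pi.smul_apply, e1, smul_eq_mul]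
    · filter_upwards [a2, Lp.coeFn_smul c q.2.1] with x e1 e3
      rw [Prod.smul_snd, Prod.smul_fst, e3, Pi.smul_apply, e1, hf, smul_eq_mul]
    · filter_upwards [a3, Lp.coeFn_smul c q.2.2.1] with x e1 e3
      rw [Prod.smul_snd, Prod.smul_snd, Prod.smul_fst, e3, Pi.smul_apply, e1, hf, smul_eq_mul]
    · filter_upwards [a4, Lp.coeFn_smul c q.2.2.2] with x e1 e3
      rw [Prod.smul_snd, Prod.smul_snd, Prod.smul_snd, e3, Pi.smul_apply, e1, smul_eq_mul]

/-- The trace inequality. -/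
theorem norm_sq_trace_le (hd : 0 < d₁) {δ : ℝ} (hδ : 0 < δ) (u : FormSpace d₁ d₂) :
    ‖traceL d₁ d₂ u‖ ^ 2 ≤ δ * ‖gradY d₁ d₂ u‖ ^ 2 + δ⁻¹ * ‖embL d₁ d₂ u‖ ^ 2 := by
  suffices key : ∀ p ∈ sobolevTrace d₁ d₂,
      ‖p.2.2.2‖ ^ 2 ≤ δ * ‖p.2.2.1‖ ^ 2 + δ⁻¹ * ‖p.1‖ ^ 2 by
    have := key _ (mem_sobolevTrace_of_formSpace u)
    exact this
  intro p hp
  refine sobolevTrace_induction (P := fun p =>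
    ‖p.2.2.2‖ ^ 2 ≤ δ * ‖p.2.2.1‖ ^ 2 + δ⁻¹ * ‖p.1‖ ^ 2) ?_ ?_ hp
  · exact isClosed_le (by fun_prop) (by fun_prop)
  clear hp p
  rintro φ p h ⟨h1, -, h3, h4⟩
  have key := h.lintegral_barrier_le hd hδ
  have e1 : ∫⁻ q in strip d₁ d₂, ‖φ q‖ₑ ^ 2 = ENNReal.ofReal (‖p.1‖ ^ 2) := by
    rw [← lintegral_enorm_sq]
    refine lintegral_congr_ae ?_
    filter_upwards [h1] with q hq
    rw [hq]
  have e2 : ∫⁻ q in strip d₁ d₂, ‖fderiv ℝ φ q (0, 1)‖ₑ ^ 2 = ENNReal.ofReal (‖p.2.2.1‖ ^ 2) := by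
    rw [← lintegral_enorm_sq]
    refine lintegral_congr_ae ?_
    filter_upwards [h3] with q hq
    rw [hq]
  have e3 : ∫⁻ x, ‖φ (x, 0)‖ₑ ^ 2 = ENNReal.ofReal (‖p.2.2.2‖ ^ 2) := by
    rw [← lintegral_enorm_sq]
    refine lintegral_congr_ae ?_
    filter_upwards [h4] with q hq
    rw [hq]
  rwa [e1, e2, e3, ← ENNReal.ofReal_mul hδ.le, ← ENNReal.ofReal_mul (by positivity),
    ← ENNReal.ofReal_add (by positivity) (by positivity),
    ENNReal.ofReal_le_ofReal_iff (by positivity)] at key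

theorem exists_integral_mul_eq_inner {X : Type*} [MeasurableSpace X] {μ : Measure X} {g : X → ℂ}
    (hg : MemLp g 2 μ) : ∃ w : Lp ℂ 2 μ, ∀ h : Lp ℂ 2 μ, ∫ q, g q * h q ∂μ = inner ℂ w h := by
  have hc : MemLp (fun q => conj (g q)) 2 μ := hg.star
  refine ⟨hc.toLp, fun h => ?_⟩
  rw [L2.inner_def]
  refine integral_congr_ae ?_
  filter_upwards [hc.coeFn_toLp] with q hq
  rw [hq, RCLike.inner_apply, Complex.conj_conj, mul_comm]

theorem continuous_integral_mul {X : Type*} [MeasurableSpace X] {μ : Measure X} {g : X → ℂ}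
    (hg : MemLp g 2 μ) : Continuous fun h : Lp ℂ 2 μ => ∫ q, g q * h q ∂μ := by
  obtain ⟨w, hw⟩ := exists_integral_mul_eq_inner hg
  simp only [hw]
  fun_prop

/-- The fundamental lemma of the calculus of variations on the open strip. -/
theorem L2Strip_eq_zero {h : L2Strip d₁ d₂}
    (hh : ∀ g, IsTest d₁ d₂ g → ∫ q in strip d₁ d₂, g q * h q = 0) : h = 0 := by
  have hloc : LocallyIntegrableOn h (strip d₁ d₂) volume :=
    locallyIntegrableOn_of_locallyIntegrable_restrict
      ((Lp.memLp h).locallyIntegrable (by norm_num))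
  have key := (isOpen_strip d₁ d₂).ae_eq_zero_of_integral_contDiff_smul_eq_zero hloc
    fun g hg hgc hgs => by
      have ht : IsTest d₁ d₂ fun q => (g q : ℂ) := by
        have hs : tsupport (fun q => (g q : ℂ)) ⊆ tsupport g :=
          tsupport_comp_subset Complex.ofReal_zero g
        exact ⟨Complex.ofRealCLM.contDiff.comp hg,
          hgc.comp_left (g := fun r : ℝ => (r : ℂ)) Complex.ofReal_zero, hs.trans hgs⟩
      have h1 := hh _ ht
      rw [← setIntegral_eq_integral_of_forall_compl_eq_zero (s := strip d₁ d₂)]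
      · simpa only [Complex.real_smul] using h1
      · intro q hq
        have : g q = 0 := by exact_mod_cast ht.eq_zero hq
        rw [this, zero_smul]
  rw [← ae_restrict_iff' (measurableSet_strip d₁ d₂)] at key
  exact (Lp.eq_zero_iff_ae_eq_zero).2 key

/-- The function determines its weak derivatives by integration by parts, and then its trace by the
trace inequality. So a quadruple in the closure is determined by its first entry. -/
theorem embL_injective (hd : 0 < d₁) : Function.Injective (embL d₁ d₂) := by
  rw [injective_iff_map_eq_zero]
  intro u hu
  have hpair : ∀ g, IsTest d₁ d₂ g →
      ∫ q in strip d₁ d₂, g q * gradX d₁ d₂ u q = - ∫ q in strip d₁ d₂,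
        fderiv ℝ g q (1, 0) * embL d₁ d₂ u q ∧
      ∫ q in strip d₁ d₂, g q * gradY d₁ d₂ u q = - ∫ q in strip d₁ d₂,
        fderiv ℝ g q (0, 1) * embL d₁ d₂ u q := fun g hg => by
    refine sobolevTrace_induction (P := fun p =>
      ∫ q in strip d₁ d₂, g q * p.2.1 q = - ∫ q in strip d₁ d₂, fderiv ℝ g q (1, 0) * p.1 q ∧
      ∫ q in strip d₁ d₂, g q * p.2.2.1 q = - ∫ q in strip d₁ d₂, fderiv ℝ g q (0, 1) * p.1 q)
      ?_ ?_ (mem_sobolevTrace_of_formSpace u)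
    · have c0 := continuous_integral_mul (hg.memLp (volume.restrict (strip d₁ d₂)))
      have c1 := continuous_integral_mul
        ((hg.fderiv_apply (1, 0)).memLp (volume.restrict (strip d₁ d₂)))
      have c2 := continuous_integral_mul
        ((hg.fderiv_apply (0, 1)).memLp (volume.restrict (strip d₁ d₂)))
      exact (isClosed_eq (c0.comp (by fun_prop)) (c1.comp (by fun_prop)).neg).inter
        (isClosed_eq (c0.comp (by fun_prop)) (c2.comp (by fun_prop)).neg)
    · rintro φ p h ⟨h1, h2, h3, -⟩
      have e0 : ∀ χ : ℝ × ℝ → ℂ, ∫ q in strip d₁ d₂, χ q * p.1 q =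
          ∫ q in strip d₁ d₂, χ q * φ q := fun χ => integral_congr_ae <| by
        filter_upwards [h1] with q hq
        rw [hq]
      refine ⟨?_, ?_⟩
      · rw [e0, ← h.integral_mul_fderiv hg]
        refine integral_congr_ae ?_
        filter_upwards [h2] with q hq
        rw [hq]
      · rw [e0, ← h.integral_mul_fderiv hg]
        refine integral_congr_ae ?_
        filter_upwards [h3] with q hq
        rw [hq]
  have hz : ∀ χ : ℝ × ℝ → ℂ, ∫ q in strip d₁ d₂, χ q * embL d₁ d₂ u q = 0 := fun χ => by
    rw [← integral_zero (ℝ × ℝ) ℂ (μ := volume.restrict (strip d₁ d₂))]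
    refine integral_congr_ae ?_
    rw [hu]
    filter_upwards [Lp.coeFn_zero ℂ 2 (volume.restrict (strip d₁ d₂))] with q hq
    rw [hq]
    simp
  have hx : gradX d₁ d₂ u = 0 := L2Strip_eq_zero fun g hg => by
    rw [(hpair g hg).1, hz, neg_zero]
  have hy : gradY d₁ d₂ u = 0 := L2Strip_eq_zero fun g hg => by
    rw [(hpair g hg).2, hz, neg_zero]
  have ht := norm_sq_trace_le hd one_pos u
  have hn := formSpace_norm_sq u
  rw [hx, hy, hu] at hn
  rw [hy, hu] at ht
  simp only [norm_zero] at hn ht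
  have : ‖u‖ ^ 2 ≤ 0 := by rw [hn]; linarith
  exact norm_eq_zero.1 (pow_eq_zero_iff two_ne_zero |>.1 (le_antisymm this (sq_nonneg _)))

/-- Density of H¹₀(Ω) in L²(Ω), which makes the graph of the Hamiltonian single valued. -/
theorem eq_zero_of_adjoint_embL {h : L2Strip d₁ d₂}
    (hh : ContinuousLinearMap.adjoint (embL d₁ d₂) h = 0) : h = 0 := by
  refine L2Strip_eq_zero fun g hg => ?_
  have hc : IsTest d₁ d₂ fun q => conj (g q) :=
    ⟨Complex.conjCLE.contDiff.comp hg.contDiff,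
      hg.hasCompactSupport.comp_left (g := fun z : ℂ => conj z) (map_zero _),
      (tsupport_comp_subset (g := fun z : ℂ => conj z) (map_zero _) g).trans hg.tsupport_subset⟩
  obtain ⟨⟨ψ, ψx, ψy, t⟩, hp, hq, -⟩ := hc.exists_isTestQuad
  obtain ⟨u, rfl, -⟩ := exists_formSpace hp
  have h1 : inner ℂ (embL d₁ d₂ u) h = 0 := by
    rw [← ContinuousLinearMap.adjoint_inner_right, hh, inner_zero_right]
  rw [← h1, L2.inner_def]
  refine integral_congr_ae ?_
  filter_upwards [hq] with q hq
  rw [hq, RCLike.inner_apply, Complex.conj_conj, mul_comm]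

end FormSpace

/-! ### Multiplication operators on the barrier -/

section Multiplication

theorem exists_mulOp {b : ℝ → ℝ} (hb : Measurable b) (hb1 : ∀ x, |b x| ≤ 1) :
    ∃ S : L2Line →L[ℂ] L2Line, ∀ h : L2Line, S h =ᵐ[volume] fun x => (b x : ℂ) * h x := by
  have hbd : ∀ (h : L2Line) x, ‖(b x : ℂ) * h x‖ ≤ ‖h x‖ := fun h x => by
    rw [norm_mul, Complex.norm_real, Real.norm_eq_abs]
    exact mul_le_of_le_one_left (norm_nonneg _) (hb1 x)
  have hm : ∀ h : L2Line, MemLp (fun x => (b x : ℂ) * h x) 2 volume := fun h =>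
    (Lp.memLp h).mono ((Complex.measurable_ofReal.comp hb).aestronglyMeasurable.mul
      (Lp.aestronglyMeasurable h)) (Eventually.of_forall (hbd h))
  let S₀ : L2Line →ₗ[ℂ] L2Line :=
    { toFun := fun h => (hm h).toLp
      map_add' := fun h₁ h₂ => by
        rw [← MemLp.toLp_add]
        refine MemLp.toLp_congr _ _ ?_
        filter_upwards [Lp.coeFn_add h₁ h₂] with q hq
        rw [hq, Pi.add_apply, Pi.add_apply, mul_add]
      map_smul' := fun c h => by
        rw [RingHom.id_apply, ← MemLp.toLp_const_smul]
        refine MemLp.toLp_congr _ _ ?_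
        filter_upwards [Lp.coeFn_smul c h] with q hq
        rw [hq, Pi.smul_apply, Pi.smul_apply, smul_eq_mul, smul_eq_mul, mul_left_comm] }
  have hS₀ : ∀ h, S₀ h =ᵐ[volume] fun x => (b x : ℂ) * h x := fun h => (hm h).coeFn_toLp
  refine ⟨S₀.mkContinuous 1 fun h => ?_, hS₀⟩
  rw [one_mul]
  refine Lp.norm_le_norm_of_ae_le ?_
  filter_upwards [hS₀ h] with x hx
  rw [hx]
  exact hbd h x

theorem inner_mulOp {b : ℝ → ℝ} {u v w z : L2Line} (hw : w =ᵐ[volume] fun x => (b x : ℂ) * u x)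
    (hz : z =ᵐ[volume] fun x => (b x : ℂ) * v x) : inner ℂ w v = inner ℂ u z := by
  rw [L2.inner_def, L2.inner_def]
  refine integral_congr_ae ?_
  filter_upwards [hw, hz] with x h1 h2
  rw [h1, h2, RCLike.inner_apply, RCLike.inner_apply, map_mul, Complex.conj_ofReal]
  ring

theorem ae_eq_of_tendsto_Lp {F : ℕ → L2Line} {G : L2Line} {g : ℝ → ℂ}
    (hF : Tendsto F atTop (𝓝 G)) (hg : ∀ᵐ x, Tendsto (fun n => F n x) atTop (𝓝 (g x))) :
    G =ᵐ[volume] g := by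
  obtain ⟨ns, hns, h⟩ := (tendstoInMeasure_of_tendsto_Lp hF).exists_seq_tendsto_ae
  filter_upwards [hg, h] with x h1 h2
  exact tendsto_nhds_unique h2 (h1.comp hns.tendsto_atTop)

/-- The graph of a multiplication operator is closed. -/
theorem isClosed_mulGraph (f : ℝ → ℝ) :
    IsClosed {p : L2Line × L2Line | p.1 =ᵐ[volume] fun x => (f x : ℂ) * p.2 x} := by
  refine IsSeqClosed.isClosed fun p q hp hpq => ?_
  have h1 : Tendsto (fun n => (p n).1) atTop (𝓝 q.1) := (continuous_fst.tendsto q).comp hpq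
  have h2 : Tendsto (fun n => (p n).2) atTop (𝓝 q.2) := (continuous_snd.tendsto q).comp hpq
  obtain ⟨ns, hns, h⟩ := (tendstoInMeasure_of_tendsto_Lp h2).exists_seq_tendsto_ae
  refine ae_eq_of_tendsto_Lp (h1.comp hns.tendsto_atTop) ?_
  filter_upwards [h, ae_all_iff.2 fun n => hp (ns n)] with x h3 h4
  simp only [Function.comp_apply, h4]
  exact h3.const_mul _

end Multiplication

/-! ### The weighted trace as a sum of Hilbert-Schmidt operators -/

section TraceMultiplier

variable {d₁ d₂ : ℝ}

/-- For suitable weights `f` the product of `f` and the trace is given by operators applied to the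
gradient, which are sums of Hilbert-Schmidt operators with geometrically decaying norms. -/
theorem exists_grad_eq_mul_trace (hd : 0 < d₁) {f : ℝ → ℝ} (hf : Measurable f) {I W θ : ℝ}
    (hI0 : 0 ≤ I) (hI : ∫⁻ x, ‖f x‖ₑ ^ 2 ≤ ENNReal.ofReal (I ^ 2)) (hW0 : 0 ≤ W) (hθ : 0 < θ)
    (hW : ∀ a, 0 < a → ∀ u, ∫⁻ x in Icc (u - a) u, ‖f x‖ₑ ^ 2 ≤
      ENNReal.ofReal ((W * a ^ θ) ^ 2)) :
    ∃ (X Y : ℕ → L2Strip d₁ d₂ →L[ℂ] L2Line) (SX SY : L2Strip d₁ d₂ →L[ℂ] L2Line) (c C r : ℝ),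
      0 ≤ r ∧ r < 1 ∧ (∀ j, HSBound (X j) c ∧ HSBound (Y j) c) ∧
      (∀ j, ‖X j‖ ≤ C * r ^ j ∧ ‖Y j‖ ≤ C * r ^ j) ∧ HasSum X SX ∧ HasSum Y SY ∧
      ∀ p ∈ sobolevTrace d₁ d₂,
        SX p.2.1 + SY p.2.2.1 =ᵐ[volume] fun x => (f x : ℂ) * p.2.2.2 x := by
  let r : ℝ := (1 / 2) ^ θ
  have hr0 : 0 ≤ r := by positivity
  have hr1 : r < 1 := Real.rpow_lt_one (by norm_num) (by norm_num) hθ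
  let a : ℕ → ℝ := fun j => d₁ / 2 ^ j
  have ha : ∀ j, 0 < a j := fun j => by positivity
  let w : ℕ → ℝ := fun j => W * a j ^ θ
  have hw0 : ∀ j, 0 ≤ w j := fun j => by have := ha j; positivity
  have hwr : ∀ j, w j = W * d₁ ^ θ * r ^ j := fun j => by
    have : a j = d₁ * (1 / 2) ^ j := by simp [a, div_eq_mul_inv]
    simp only [w, r]
    rw [this, Real.mul_rpow hd.le (by positivity), ← Real.rpow_natCast, ← Real.rpow_natCast,
      ← Real.rpow_mul (by norm_num), ← Real.rpow_mul (by norm_num), mul_comm (j : ℝ) θ]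
    ring
  -- The telescoped sum converges to -φ(x, 0), so the kernel operators are taken with weight -f.
  have hfn : Measurable fun x => -f x := hf.neg
  have hI' : ∫⁻ x, ‖-f x‖ₑ ^ 2 ≤ ENNReal.ofReal (I ^ 2) := by simpa only [enorm_neg] using hI
  have hW' : ∀ j u, ∫⁻ x in Icc (u - a j) u, ‖-f x‖ₑ ^ 2 ≤ ENNReal.ofReal (w j ^ 2) :=
    fun j u => by simpa only [enorm_neg] using hW (a j) (ha j) u
  have hμ : volume.restrict (strip d₁ d₂) ≤ (volume : Measure (ℝ × ℝ)) := Measure.restrict_le_self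
  choose X hX hXn hXs using fun j => exists_kernelOp hμ (ha j) hfn hI' hI0 (hw0 j) (hW' j)
    (stronglyMeasurable_kerX (a j)) (kerX_eq_zero (ha j)) (norm_kerX_le (ha j))
  choose Y hY hYn hYs using fun j => exists_kernelOp hμ (ha j) hfn hI' hI0 (hw0 j) (hW' j)
    (stronglyMeasurable_kerY (a j)) (kerY_eq_zero (ha j)) (norm_kerY_le (ha j))
  have hgeo : Summable fun j => 2 * w j := by
    simp only [hwr]
    exact ((summable_geometric_of_lt_one hr0 hr1).mul_left _).mul_left _
  obtain ⟨SX, hSX⟩ : Summable X := Summable.of_norm_bounded hgeo hXn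
  obtain ⟨SY, hSY⟩ : Summable Y := Summable.of_norm_bounded hgeo hYn
  refine ⟨X, Y, SX, SY, 2 * I, 2 * (W * d₁ ^ θ), r, hr0, hr1, fun j => ⟨hXs j, hYs j⟩, fun j => ?_,
    hSX, hSY, fun p hp => ?_⟩
  · have e : 2 * (W * d₁ ^ θ) * r ^ j = 2 * w j := by rw [hwr, mul_assoc]
    rw [e]
    exact ⟨hXn j, hYn j⟩
  -- The identity is a closed condition because the graph of multiplication by f is closed, even for
  -- unbounded f. So it suffices to check test functions.
  · refine sobolevTrace_induction (P := fun p =>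
      ((SX p.2.1 + SY p.2.2.1, p.2.2.2) : L2Line × L2Line) ∈
        {p : L2Line × L2Line | p.1 =ᵐ[volume] fun x => (f x : ℂ) * p.2 x}) ?_ ?_ hp
    · exact (isClosed_mulGraph f).preimage (by fun_prop)
    clear hp p
    rintro φ p h ⟨-, h2, h3, h4⟩
    have hs : Tendsto (fun n => ∑ j ∈ Finset.range n, (X j p.2.1 + Y j p.2.2.1)) atTop
        (𝓝 (SX p.2.1 + SY p.2.2.1)) := by
      have e1 := (ContinuousLinearMap.apply ℂ L2Line p.2.1).hasSum hSX
      have e2 := (ContinuousLinearMap.apply ℂ L2Line p.2.2.1).hasSum hSY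
      exact (e1.add e2).tendsto_sum_nat
    have hlim : SX p.2.1 + SY p.2.2.1 =ᵐ[volume]
        fun x => (f x : ℂ) * φ (x, 0) := by
      refine ae_eq_of_tendsto_Lp hs ?_
      have hpart : ∀ n, (∑ j ∈ Finset.range n, (X j p.2.1 + Y j p.2.2.1) : L2Line) =ᵐ[volume]
          fun x => -(f x : ℂ) * ∑ j ∈ Finset.range n,
            ((∫ q in strip d₁ d₂, kerX (d₁ / 2 ^ j) x q * fderiv ℝ φ q (1, 0)) +
            (∫ q in strip d₁ d₂, kerY (d₁ / 2 ^ j) x q * fderiv ℝ φ q (0, 1))) := by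
        intro n
        induction n with
        | zero =>
          simp only [Finset.range_zero, Finset.sum_empty, mul_zero]
          exact Lp.coeFn_zero _ _ _
        | succ n ih =>
          rw [Finset.sum_range_succ]
          filter_upwards [Lp.coeFn_add (∑ j ∈ Finset.range n, (X j p.2.1 + Y j p.2.2.1))
            (X n p.2.1 + Y n p.2.2.1), ih, Lp.coeFn_add (X n p.2.1) (Y n p.2.2.1),
            hX n p.2.1, hY n p.2.2.1] with x i1 i2 i3 i4 i5
          have e1 : ∫ q in strip d₁ d₂, kerX (a n) x q * p.2.1 q =
              ∫ q in strip d₁ d₂, kerX (d₁ / 2 ^ n) x q * fderiv ℝ φ q (1, 0) :=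
            integral_congr_ae <| by
              filter_upwards [h2] with q hq
              rw [hq]
          have e2 : ∫ q in strip d₁ d₂, kerY (a n) x q * p.2.2.1 q =
              ∫ q in strip d₁ d₂, kerY (d₁ / 2 ^ n) x q * fderiv ℝ φ q (0, 1) :=
            integral_congr_ae <| by
              filter_upwards [h3] with q hq
              rw [hq]
          rw [i1, Pi.add_apply, i2, i3, Pi.add_apply, i4, i5, e1, e2, Finset.sum_range_succ]
          push_cast
          ring
      filter_upwards [ae_all_iff.2 hpart] with x hx
      simp only [hx]
      have := (h.tendsto_sum_kernel hd x).const_mul (-(f x : ℂ))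
      rwa [neg_mul_neg] at this
    show (SX p.2.1 + SY p.2.2.1 : L2Line) =ᵐ[volume]
      fun x => (f x : ℂ) * p.2.2.2 x
    filter_upwards [hlim, h4] with x i1 i2
    rw [i1, i2]

theorem _root_.HasSum.clm_comp {E F G : Type*} [NormedAddCommGroup E] [NormedSpace ℂ E]
    [NormedAddCommGroup F] [NormedSpace ℂ F] [NormedAddCommGroup G] [NormedSpace ℂ G]
    {X : ℕ → F →L[ℂ] G} {S : F →L[ℂ] G} (h : HasSum X S) (T : E →L[ℂ] F) :
    HasSum (fun j => X j ∘L T) (S ∘L T) :=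
  h.mapL ((ContinuousLinearMap.compL ℂ E F G).flip T)

/-- For suitable weights `f` the operator `f I_m` is bounded on `H¹₀(Ω)`, and it is a sum of
Hilbert-Schmidt operators with geometrically decaying operator norms. -/
theorem exists_mul_trace (hd : 0 < d₁) {f : ℝ → ℝ} (hf : Measurable f) {I W θ : ℝ}
    (hI0 : 0 ≤ I) (hI : ∫⁻ x, ‖f x‖ₑ ^ 2 ≤ ENNReal.ofReal (I ^ 2)) (hW0 : 0 ≤ W) (hθ : 0 < θ)
    (hW : ∀ a, 0 < a → ∀ u, ∫⁻ x in Icc (u - a) u, ‖f x‖ₑ ^ 2 ≤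
      ENNReal.ofReal ((W * a ^ θ) ^ 2)) :
    ∃ (N : ℕ → FormSpace d₁ d₂ →L[ℂ] L2Line) (M : FormSpace d₁ d₂ →L[ℂ] L2Line) (c C r : ℝ),
      0 ≤ r ∧ r < 1 ∧ (∀ j, HSBound (N j) c) ∧ (∀ j, ‖N j‖ ≤ C * r ^ j) ∧ HasSum N M ∧
      ∀ u, M u =ᵐ[volume] fun x => (f x : ℂ) * traceL d₁ d₂ u x := by
  obtain ⟨X, Y, SX, SY, c, C, r, hr0, hr1, hs, hn, hSX, hSY, key⟩ :=
    exists_grad_eq_mul_trace (d₂ := d₂) hd hf hI0 hI hW0 hθ hW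
  let gX := gradX d₁ d₂
  let gY := gradY d₁ d₂
  refine ⟨fun j => X j ∘L gX + Y j ∘L gY, SX ∘L gX + SY ∘L gY, ‖gX‖ * c + ‖gY‖ * c,
    C * (‖gX‖ + ‖gY‖), r, hr0, hr1, fun j =>
    ((hs j).1.comp_right gX).add ((hs j).2.comp_right gY), fun j => ?_, ?_, fun u => ?_⟩
  · calc ‖X j ∘L gX + Y j ∘L gY‖ ≤ ‖X j‖ * ‖gX‖ + ‖Y j‖ * ‖gY‖ :=
        (norm_add_le _ _).trans (add_le_add (ContinuousLinearMap.opNorm_comp_le _ _)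
          (ContinuousLinearMap.opNorm_comp_le _ _))
      _ ≤ C * r ^ j * ‖gX‖ + C * r ^ j * ‖gY‖ := by
        gcongr
        exacts [(hn j).1, (hn j).2]
      _ = _ := by ring
  · exact (hSX.clm_comp gX).add (hSY.clm_comp gY)
  · exact key (embL d₁ d₂ u, gradX d₁ d₂ u, gradY d₁ d₂ u, traceL d₁ d₂ u)
      (mem_sobolevTrace_of_formSpace u)

end TraceMultiplier

/-! ### Integrability of the coupling -/

section Weight

/-- A function in `L^p`, `p ≥ 1`, with finite first absolute moment is integrable. -/
theorem integrable_of_memLp_of_weighted {V : ℝ → ℝ} (hV : Measurable V) {p : ENNReal} (hp : 1 ≤ p)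
    (h1 : MemLp V p volume) (h2 : Integrable (fun x => |x| * V x) volume) : Integrable V := by
  have hin : IntegrableOn V (Icc (-1) 1) := by
    have : MemLp V p (volume.restrict (Icc (-1 : ℝ) 1)) := h1.restrict _
    exact (this.mono_exponent hp).integrable le_rfl
  have hout : IntegrableOn V (Icc (-1) 1)ᶜ := by
    refine Integrable.mono h2.integrableOn hV.aestronglyMeasurable ?_
    refine (ae_restrict_iff' measurableSet_Icc.compl).2 (Eventually.of_forall fun x hx => ?_)
    have hx1 : 1 ≤ |x| := by
      by_contra hlt
      exact hx (abs_le.1 (not_le.1 hlt).le)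
    rw [norm_mul, norm_abs_eq_norm, Real.norm_eq_abs x]
    exact le_mul_of_one_le_left (norm_nonneg _) hx1
  have := hin.union hout
  rwa [union_compl_self, integrableOn_univ] at this

theorem enorm_sqrt_abs_sq (v : ℝ) : ‖√|v|‖ₑ ^ 2 = ‖v‖ₑ := by
  rw [← ofReal_norm, ← ENNReal.ofReal_pow (norm_nonneg _), Real.norm_eq_abs, sq_abs,
    Real.sq_sqrt (abs_nonneg v), ← Real.norm_eq_abs, ofReal_norm]

/-- Hölder's inequality on an interval of length a. The exponent of a is positive because ε > 0, and
it is the source of the geometric decay of the scales. -/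
theorem lintegral_Icc_le {V : ℝ → ℝ} {ε : ℝ} (hε : 0 < ε)
    (h1 : MemLp V (ENNReal.ofReal (1 + ε)) volume) {a : ℝ} (ha : 0 < a) (u : ℝ) :
    ∫⁻ x in Icc (u - a) u, ‖V x‖ₑ ≤
      ENNReal.ofReal ((eLpNorm V (ENNReal.ofReal (1 + ε)) volume).toReal *
        a ^ (1 - 1 / (1 + ε))) := by
  have hp : (1 : ENNReal) ≤ ENNReal.ofReal (1 + ε) := by
    rw [← ENNReal.ofReal_one]
    exact ENNReal.ofReal_le_ofReal (by linarith)
  have key := eLpNorm_le_eLpNorm_mul_rpow_measure_univ (μ := volume.restrict (Icc (u - a) u)) hp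
    h1.aestronglyMeasurable.restrict
  rw [eLpNorm_one_eq_lintegral_enorm, Measure.restrict_apply_univ, Real.volume_Icc, sub_sub_cancel,
    ENNReal.toReal_one, ENNReal.toReal_ofReal (by linarith), div_one] at key
  refine key.trans ?_
  rw [ENNReal.ofReal_mul ENNReal.toReal_nonneg, ENNReal.ofReal_toReal h1.eLpNorm_ne_top,
    ENNReal.ofReal_rpow_of_pos ha]
  gcongr
  exact Measure.restrict_le_self

end Weight

/-! ### The Hamiltonians as form operators, and coercivity far to the left -/

section Forms

open ContinuousLinearMap (adjoint)

variable {d₁ d₂ : ℝ}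

/-- The operator on `H¹₀(Ω)` of the form with the constant coupling `a`. -/
def constForm (d₁ d₂ a : ℝ) : FormSpace d₁ d₂ →L[ℂ] FormSpace d₁ d₂ :=
  adjoint (gradX d₁ d₂) ∘L gradX d₁ d₂ + adjoint (gradY d₁ d₂) ∘L gradY d₁ d₂ +
    (a : ℂ) • (adjoint (traceL d₁ d₂) ∘L traceL d₁ d₂)

theorem inner_constForm (a : ℝ) (u v : FormSpace d₁ d₂) : inner ℂ u (constForm d₁ d₂ a v) =
    inner ℂ (gradX d₁ d₂ u) (gradX d₁ d₂ v) + inner ℂ (gradY d₁ d₂ u) (gradY d₁ d₂ v) +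
      a * inner ℂ (traceL d₁ d₂ u) (traceL d₁ d₂ v) := by
  simp only [constForm, add_apply, smul_apply, ContinuousLinearMap.comp_apply, inner_add_right,
    inner_smul_right, ContinuousLinearMap.adjoint_inner_right]

theorem constForm_symm (a : ℝ) (u v : FormSpace d₁ d₂) :
    inner ℂ (constForm d₁ d₂ a u) v = inner ℂ u (constForm d₁ d₂ a v) := by
  rw [← inner_conj_symm, inner_constForm, inner_constForm, map_add, map_add, map_mul,
    inner_conj_symm, inner_conj_symm, inner_conj_symm, Complex.conj_ofReal]

theorem inner_pertOp {H F : Type} [NormedAddCommGroup H] [InnerProductSpace ℂ H] [CompleteSpace H]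
    [NormedAddCommGroup F] [InnerProductSpace ℂ F] [CompleteSpace F] (A₀ : H →L[ℂ] H)
    (M : H →L[ℂ] F) (σ : F →L[ℂ] F) (u v : H) :
    inner ℂ u (pertOp A₀ M σ v) = inner ℂ u (A₀ v) + inner ℂ (M u) (σ (M v)) := by
  rw [pertOp, add_apply, inner_add_right, ContinuousLinearMap.comp_apply,
    ContinuousLinearMap.adjoint_inner_right, ContinuousLinearMap.comp_apply]

theorem pertOp_symm {H F : Type} [NormedAddCommGroup H] [InnerProductSpace ℂ H] [CompleteSpace H]
    [NormedAddCommGroup F] [InnerProductSpace ℂ F] [CompleteSpace F] {A₀ : H →L[ℂ] H}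
    (M : H →L[ℂ] F) {σ : F →L[ℂ] F} (hA : ∀ u v, inner ℂ (A₀ u) v = inner ℂ u (A₀ v))
    (hσ : ∀ u v, inner ℂ (σ u) v = inner ℂ u (σ v)) (u v : H) :
    inner ℂ (pertOp A₀ M σ u) v = inner ℂ u (pertOp A₀ M σ v) := by
  rw [← inner_conj_symm, inner_pertOp, inner_pertOp, map_add, inner_conj_symm, inner_conj_symm,
    hA, hσ]

/-- Quadruples in `sobolevTrace` are exactly the elements of `FormSpace`, so the weak equation says
A u = j*h. Injectivity of j and of j* shows that the relation is the graph of an operator. -/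
theorem isFormOperator_ham (hd : 0 < d₁) {α : ℝ → ℝ} {A : FormSpace d₁ d₂ →L[ℂ] FormSpace d₁ d₂}
    (hA : ∀ u v, Integrable (fun x => (α x : ℂ) * conj (traceL d₁ d₂ u x) * traceL d₁ d₂ v x) ∧
      inner ℂ (gradX d₁ d₂ u) (gradX d₁ d₂ v) + inner ℂ (gradY d₁ d₂ u) (gradY d₁ d₂ v) +
        ∫ x, (α x : ℂ) * conj (traceL d₁ d₂ u x) * traceL d₁ d₂ v x = inner ℂ u (A v)) :
    IsFormOperator (ham d₁ d₂ α) (embL d₁ d₂) A := by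
  have hg : ∀ x h, (x, h) ∈ hamGraph d₁ d₂ α ↔
      ∃ u, embL d₁ d₂ u = x ∧ A u = adjoint (embL d₁ d₂) h := by
    intro x h
    constructor
    · rintro ⟨ψx, ψy, t, ht, hE⟩
      obtain ⟨u, hu, rfl, rfl, rfl⟩ := exists_formSpace ht
      refine ⟨u, hu, ext_inner_left ℂ fun v => ?_⟩
      rw [← (hA v u).2, ContinuousLinearMap.adjoint_inner_right]
      exact (hE _ _ _ _ (mem_sobolevTrace_of_formSpace v)).2
    · rintro ⟨u, rfl, hu⟩
      refine ⟨gradX d₁ d₂ u, gradY d₁ d₂ u, traceL d₁ d₂ u, mem_sobolevTrace_of_formSpace u,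
        fun φ φx φy s hs => ?_⟩
      obtain ⟨v, rfl, rfl, rfl, rfl⟩ := exists_formSpace hs
      refine ⟨(hA v u).1, (hA v u).2.trans ?_⟩
      rw [hu, ContinuousLinearMap.adjoint_inner_right]
  intro x h
  rw [ham, Submodule.toLinearPMap_graph_eq]
  · exact hg x h
  · rintro ⟨x, h⟩ hx hx0
    obtain ⟨u, hu, hu'⟩ := (hg x h).1 hx
    have hu0 : u = 0 := embL_injective hd (by rw [map_zero, hu]; exact hx0)
    exact eq_zero_of_adjoint_embL (by rw [← hu', hu0, map_zero])

theorem integral_const_mul_conj (a : ℝ) (s t : L2Line) :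
    Integrable (fun x => (a : ℂ) * conj (s x) * t x) ∧
      ∫ x, (a : ℂ) * conj (s x) * t x = a * inner ℂ s t := by
  have e : (fun x => (a : ℂ) * conj (s x) * t x) = fun x => (a : ℂ) * inner ℂ (s x) (t x) := by
    ext x
    rw [RCLike.inner_apply]
    ring
  rw [e, integral_const_mul, L2.inner_def]
  exact ⟨(L2.integrable_inner s t).const_mul _, rfl⟩

theorem integral_weight_mul_conj {V f b : ℝ → ℝ} (hV : ∀ x, V x = f x * (b x * f x))
    {s t Ms Mt w : L2Line} (hs : Ms =ᵐ[volume] fun x => (f x : ℂ) * s x)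
    (ht : Mt =ᵐ[volume] fun x => (f x : ℂ) * t x)
    (hw : w =ᵐ[volume] fun x => (b x : ℂ) * Mt x) :
    Integrable (fun x => (V x : ℂ) * conj (s x) * t x) ∧
      ∫ x, (V x : ℂ) * conj (s x) * t x = inner ℂ Ms w := by
  have e : (fun x => (V x : ℂ) * conj (s x) * t x) =ᵐ[volume] fun x => inner ℂ (Ms x) (w x) := by
    filter_upwards [hs, ht, hw] with x h1 h2 h3
    rw [h1, h3, h2, RCLike.inner_apply, map_mul, Complex.conj_ofReal, hV]
    push_cast
    ring
  rw [integral_congr_ae e, L2.inner_def, integrable_congr e]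
  exact ⟨L2.integrable_inner Ms w, rfl⟩

theorem isFormOperator_hamConst (hd : 0 < d₁) (a : ℝ) :
    IsFormOperator (hamConst d₁ d₂ a) (embL d₁ d₂) (constForm d₁ d₂ a) := by
  refine isFormOperator_ham hd fun u v => ?_
  obtain ⟨h1, h2⟩ := integral_const_mul_conj a (traceL d₁ d₂ u) (traceL d₁ d₂ v)
  exact ⟨h1, by rw [h2, inner_constForm]⟩

theorem isFormOperator_ham_pertOp (hd : 0 < d₁) {α f b : ℝ → ℝ} {a : ℝ}
    (hV : ∀ x, α x - a = f x * (b x * f x)) {M : FormSpace d₁ d₂ →L[ℂ] L2Line}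
    {σ : L2Line →L[ℂ] L2Line} (hM : ∀ u, M u =ᵐ[volume] fun x => (f x : ℂ) * traceL d₁ d₂ u x)
    (hσ : ∀ h, σ h =ᵐ[volume] fun x => (b x : ℂ) * h x) :
    IsFormOperator (ham d₁ d₂ α) (embL d₁ d₂) (pertOp (constForm d₁ d₂ a) M σ) := by
  refine isFormOperator_ham hd fun u v => ?_
  obtain ⟨h1, h2⟩ := integral_const_mul_conj a (traceL d₁ d₂ u) (traceL d₁ d₂ v)
  obtain ⟨h3, h4⟩ := integral_weight_mul_conj hV (hM u) (hM v) (hσ (M v))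
  have e : (fun x => (α x : ℂ) * conj (traceL d₁ d₂ u x) * traceL d₁ d₂ v x) = fun x =>
      (a : ℂ) * conj (traceL d₁ d₂ u x) * traceL d₁ d₂ v x +
        ((α x - a : ℝ) : ℂ) * conj (traceL d₁ d₂ u x) * traceL d₁ d₂ v x := by
    ext x
    push_cast
    ring
  rw [e, integral_add h1 h3, h2, h4, inner_pertOp, inner_constForm, add_assoc, add_assoc, add_assoc]
  exact ⟨h1.add h3, rfl⟩

/-- Far to the left the shifted form is coercive. -/
theorem exists_isUnit_shiftOp (hd : 0 < d₁) (a : ℝ) {b : ℝ} (hb : 0 ≤ b)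
    {M : FormSpace d₁ d₂ →L[ℂ] L2Line} (hM : IsCompactOperator (adjoint M)) :
    ∃ κ₀ > 0, ∀ κ : ℝ, κ₀ ≤ κ → ∀ A : FormSpace d₁ d₂ →L[ℂ] FormSpace d₁ d₂,
      (∀ u, ‖gradX d₁ d₂ u‖ ^ 2 + ‖gradY d₁ d₂ u‖ ^ 2 + a * ‖traceL d₁ d₂ u‖ ^ 2 - b * ‖M u‖ ^ 2 ≤
        (inner ℂ u (A u)).re) → IsUnit (shiftOp (embL d₁ d₂) A ((Complex.I * κ) ^ 2)) := by
  -- This δ gives b ‖M u‖² ≤ ‖u‖²/8 + 2bC² ‖j u‖².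
  obtain ⟨C, hC, hE⟩ := exists_norm_le_of_isCompactOperator_adjoint (embL_injective hd) hM
    (δ := 1 / (4 * (b + 1))) (by positivity)
  refine ⟨1 + 2 * b * C ^ 2 + 2 * (|a| + 1) ^ 2, by positivity, fun κ hκ A hA =>
    isUnit_of_coercive (c := 1 / 4) (by norm_num) fun u => ?_⟩
  have hz : (Complex.I * κ) ^ 2 = ((-κ ^ 2 : ℝ) : ℂ) := by
    rw [mul_pow, Complex.I_sq]
    push_cast
    ring
  have e1 : (inner ℂ (shiftOp (embL d₁ d₂) A ((Complex.I * κ) ^ 2) u) u).re =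
      (inner ℂ u (A u)).re + κ ^ 2 * ‖embL d₁ d₂ u‖ ^ 2 := by
    rw [← inner_conj_symm, Complex.conj_re, shiftOp_apply, inner_sub_right, inner_smul_right,
      ContinuousLinearMap.adjoint_inner_right, inner_self_eq_norm_sq_to_K, hz, Complex.sub_re]
    have : (((-κ ^ 2 : ℝ) : ℂ) * (RCLike.ofReal ‖embL d₁ d₂ u‖ : ℂ) ^ 2).re =
        -κ ^ 2 * ‖embL d₁ d₂ u‖ ^ 2 := by
      rw [RCLike.ofReal_eq_complex_ofReal, ← Complex.ofReal_pow, ← Complex.ofReal_mul,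
        Complex.ofReal_re]
    rw [this]
    ring
  rw [e1]
  have hN := formSpace_norm_sq u
  -- This δ lets half of the y-gradient term absorb (|a| + 1) times the squared trace. Of this 3/8 =
  -- 1/4 + 1/8 is kept: 1/4 for coercivity and 1/8 for the Ehrling term.
  have ht := norm_sq_trace_le hd (δ := 1 / (2 * (|a| + 1))) (by positivity) u
  have hAu := hA u
  have hEu := hE u
  set m := ‖M u‖
  set n := ‖u‖
  set e := ‖embL d₁ d₂ u‖
  set X := ‖gradX d₁ d₂ u‖
  set Y := ‖gradY d₁ d₂ u‖
  set t := ‖traceL d₁ d₂ u‖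
  have hm0 : 0 ≤ m := norm_nonneg _
  have hm : m ^ 2 ≤ 2 * (1 / (4 * (b + 1))) ^ 2 * n ^ 2 + 2 * C ^ 2 * e ^ 2 := by
    have := pow_le_pow_left₀ hm0 hEu 2
    nlinarith [sq_nonneg (1 / (4 * (b + 1)) * n - C * e)]
  have hbm : b * m ^ 2 ≤ 1 / 8 * n ^ 2 + 2 * b * C ^ 2 * e ^ 2 := by
    have h1 : b * (2 * (1 / (4 * (b + 1))) ^ 2) ≤ 1 / 8 := by
      rw [div_pow, one_pow, mul_one_div, ← mul_div_assoc,
        div_le_div_iff₀ (by positivity) (by norm_num)]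
      nlinarith
    have h2 := mul_le_mul_of_nonneg_left hm hb
    have h3 := mul_le_mul_of_nonneg_right h1 (sq_nonneg n)
    linarith
  have hat : (|a| + 3 / 8) * t ^ 2 ≤ 1 / 2 * Y ^ 2 + 2 * (|a| + 1) ^ 2 * e ^ 2 := by
    have h1 : (|a| + 1) * t ^ 2 ≤ 1 / 2 * Y ^ 2 + 2 * (|a| + 1) ^ 2 * e ^ 2 := by
      have h2 := mul_le_mul_of_nonneg_left ht (by positivity : 0 ≤ |a| + 1)
      have h3 : |a| + 1 ≠ 0 := by positivity
      refine h2.trans_eq ?_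
      field_simp
    nlinarith [sq_nonneg t]
  have hat' : -(|a| * t ^ 2) ≤ a * t ^ 2 := by
    rw [← neg_mul]
    exact mul_le_mul_of_nonneg_right (neg_abs_le a) (sq_nonneg t)
  have hκ' : (1 + 2 * b * C ^ 2 + 2 * (|a| + 1) ^ 2) * e ^ 2 ≤ κ ^ 2 * e ^ 2 := by
    refine mul_le_mul_of_nonneg_right ?_ (sq_nonneg e)
    have h1 : 1 ≤ κ := le_trans (by
      have : 0 ≤ 2 * b * C ^ 2 + 2 * (|a| + 1) ^ 2 := by positivity
      linarith) hκ
    nlinarith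
  nlinarith [sq_nonneg X, sq_nonneg Y, sq_nonneg e]

end Forms

/-! ### Traces of the resolvent and the closure of the sandwiched product -/

section ResolventTraces

open ContinuousLinearMap (adjoint)

variable {d₁ d₂ : ℝ}

/-- Passing from z to its conjugate takes the adjoint of the shifted symmetric form operator, and
inversion commutes with adjoints. -/
theorem inverse_shiftOp_conj {H L : Type} [NormedAddCommGroup H] [InnerProductSpace ℂ H]
    [CompleteSpace H] [NormedAddCommGroup L] [InnerProductSpace ℂ L] [CompleteSpace L]
    {j : H →L[ℂ] L} {A : H →L[ℂ] H} (hA : ∀ u v, inner ℂ (A u) v = inner ℂ u (A v)) {z : ℂ}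
    (hz : IsUnit (shiftOp j A z)) : IsUnit (shiftOp j A (conj z)) ∧
      Ring.inverse (shiftOp j A (conj z)) = adjoint (Ring.inverse (shiftOp j A z)) := by
  have e : shiftOp j A (conj z) = star (shiftOp j A z) := by
    rw [ContinuousLinearMap.star_eq_adjoint, ContinuousLinearMap.eq_adjoint_iff]
    exact shiftOp_inner hA z
  rw [e, ← ContinuousLinearMap.star_eq_adjoint]
  exact ⟨hz.star, Ring.inverse_star _⟩

theorem isResolventTrace_iff (hd : 0 < d₁) {a : ℝ} {k : ℂ}
    (hk : IsUnit (shiftOp (embL d₁ d₂) (constForm d₁ d₂ a) (k ^ 2)))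
    (S : L2Strip d₁ d₂ →L[ℂ] L2Line) : IsResolventTrace d₁ d₂ a k S ↔
      S = traceL d₁ d₂ ∘L Ring.inverse (shiftOp (embL d₁ d₂) (constForm d₁ d₂ a) (k ^ 2)) ∘L
        adjoint (embL d₁ d₂) := by
  have hF := isFormOperator_hamConst (d₂ := d₂) hd a
  constructor
  · intro hS
    ext1 h
    obtain ⟨ψ, hg, ψx, ψy, ht⟩ := hS h
    obtain ⟨u, hu, hu'⟩ := (hF.mem_graph_shift _ _ _).1 hg
    obtain ⟨v, hv, -, -, hv'⟩ := exists_formSpace ht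
    have huv : v = u := embL_injective hd (hv.trans hu.symm)
    rw [← hv', huv, ContinuousLinearMap.comp_apply, ContinuousLinearMap.comp_apply, ← hu',
      inverse_apply_apply hk]
  · rintro rfl h
    exact ⟨_, (hF.mem_graph_shift _ _ _).2 ⟨_, rfl, apply_inverse_apply hk _⟩, _, _,
      mem_sobolevTrace_of_formSpace _⟩

/-- The adjoint of I_m R at the conjugate parameter is j (A₀ - k² j*j)⁻¹ I_m*. Its values lie in the
range of j, and injectivity of j leaves only one possible trace. -/
theorem isResolventTraceTrace_iff (hd : 0 < d₁) {a : ℝ} {k : ℂ}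
    (hk : IsUnit (shiftOp (embL d₁ d₂) (constForm d₁ d₂ a) (k ^ 2)))
    (T : L2Line →L[ℂ] L2Line) : IsResolventTraceTrace d₁ d₂ a k T ↔
      T = traceL d₁ d₂ ∘L Ring.inverse (shiftOp (embL d₁ d₂) (constForm d₁ d₂ a) (k ^ 2)) ∘L
        adjoint (traceL d₁ d₂) := by
  obtain ⟨hc, hinv⟩ := inverse_shiftOp_conj (constForm_symm a) hk
  rw [map_pow] at hc hinv
  have hadj : adjoint (traceL d₁ d₂ ∘L
      Ring.inverse (shiftOp (embL d₁ d₂) (constForm d₁ d₂ a) (conj k ^ 2)) ∘L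
        adjoint (embL d₁ d₂)) = embL d₁ d₂ ∘L
      Ring.inverse (shiftOp (embL d₁ d₂) (constForm d₁ d₂ a) (k ^ 2)) ∘L
        adjoint (traceL d₁ d₂) := by
    rw [hinv, ContinuousLinearMap.adjoint_comp, ContinuousLinearMap.adjoint_comp,
      ContinuousLinearMap.adjoint_adjoint, ContinuousLinearMap.adjoint_adjoint]
    rfl
  constructor
  · rintro ⟨S, hS, hT⟩
    rw [isResolventTrace_iff hd hc] at hS
    ext1 h
    obtain ⟨ψx, ψy, ht⟩ := hT h
    rw [hS, hadj] at ht
    obtain ⟨v, hv, -, -, hv'⟩ := exists_formSpace ht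
    rw [← hv', embL_injective hd hv]
    rfl
  · rintro rfl
    refine ⟨_, (isResolventTrace_iff hd hc _).2 rfl, fun h => ?_⟩
    rw [hadj]
    exact ⟨_, _, mem_sobolevTrace_of_formSpace _⟩

/-- M* h is defined for every h, while I_m* needs f h to be square integrable. The two agree on the
natural domain, so the abstract operator extends the literal product. -/
theorem adjoint_traceL_apply_eq {f b : ℝ → ℝ} {M : FormSpace d₁ d₂ →L[ℂ] L2Line} {g h w : L2Line}
    (hM : ∀ u, M u =ᵐ[volume] fun x => (f x : ℂ) * traceL d₁ d₂ u x)
    (hh : h =ᵐ[volume] fun x => (b x : ℂ) * g x)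
    (hw : w =ᵐ[volume] fun x => ((b x * f x : ℝ) : ℂ) * g x) :
    adjoint (traceL d₁ d₂) w = adjoint M h := by
  refine ext_inner_left ℂ fun u => ?_
  rw [ContinuousLinearMap.adjoint_inner_right, ContinuousLinearMap.adjoint_inner_right]
  refine (inner_mulOp (hM u) ?_).symm
  filter_upwards [hh, hw] with x h1 h2
  rw [h1, h2]
  push_cast
  ring

/-- S is symmetric, so the complement of its range is its kernel, which is trivial since b never
vanishes. -/
theorem denseRange_mulOp {b : ℝ → ℝ} (hb : ∀ x, b x ≠ 0) {S : L2Line →L[ℂ] L2Line}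
    (hS : ∀ h, S h =ᵐ[volume] fun x => (b x : ℂ) * h x) : DenseRange S := by
  have h1 : (LinearMap.range (S : L2Line →ₗ[ℂ] L2Line)).topologicalClosure = ⊤ := by
    rw [Submodule.topologicalClosure_eq_top_iff, Submodule.eq_bot_iff]
    intro u hu
    have h2 : S u = 0 := ext_inner_left ℂ fun g => by
      rw [← inner_mulOp (hS g) (hS u), inner_zero_right]
      exact hu _ ⟨g, rfl⟩
    refine Lp.eq_zero_iff_ae_eq_zero.2 ?_
    filter_upwards [hS u, Lp.eq_zero_iff_ae_eq_zero.1 h2] with x h3 h4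
    rw [h4] at h3
    exact (mul_eq_zero.1 h3.symm).resolve_left (by exact_mod_cast hb x)
  have h2 := Submodule.dense_iff_topologicalClosure_eq_top.2 h1
  exact h2

theorem abs_signedSqrt_le (v : ℝ) : |signedSqrt v| ≤ √|v| := by
  rw [signedSqrt, abs_mul, abs_of_nonneg (Real.sqrt_nonneg |v|)]
  refine mul_le_of_le_one_left (Real.sqrt_nonneg _) ?_
  rcases Real.sign_apply_eq v with h | h | h <;> rw [h] <;> norm_num

theorem _root_.Real.measurable_sign : Measurable Real.sign :=
  Measurable.ite measurableSet_Iio measurable_const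
    (Measurable.ite measurableSet_Ioi measurable_const measurable_const)

theorem closure_sandwichGraph {α : ℝ → ℝ} (hα : Measurable α) {a : ℝ} {T K : L2Line →L[ℂ] L2Line}
    (hK : ∀ g w : L2Line, w =ᵐ[volume] (fun x => (signedSqrt (α x - a) : ℂ) * g x) →
      K g =ᵐ[volume] fun x => ((√|α x - a| : ℝ) : ℂ) * T w x) :
    closure (sandwichGraph α a T) = {p | p.2 = K p.1} := by
  refine Subset.antisymm (closure_minimal ?_ (isClosed_eq (by fun_prop) (by fun_prop))) ?_
  · rintro p ⟨w, hw, hp⟩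
    exact Lp.ext (hp.trans (hK _ w hw).symm)
  rintro ⟨x, y⟩ hy
  obtain rfl : y = K x := hy
  have hV : Measurable fun x => α x - a := hα.sub_const a
  have hf : Measurable fun x => √|α x - a| := Real.continuous_sqrt.measurable.comp hV.abs
  -- Multiplication by (1 + |V|^{1/2})⁻¹ maps L² densely into the natural domain, because its
  -- product with the signed root of V stays bounded by 1.
  let b : ℝ → ℝ := fun x => (1 + √|α x - a|)⁻¹
  have hpos : ∀ x, 0 < 1 + √|α x - a| := fun x => by positivity
  have hb0 : ∀ x, 0 < b x := fun x => inv_pos.2 (hpos x)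
  have hb : Measurable b := (hf.const_add 1).inv
  obtain ⟨S, hS⟩ := exists_mulOp hb fun x => by
    rw [abs_of_pos (hb0 x)]
    exact inv_le_one_of_one_le₀ (by linarith [Real.sqrt_nonneg |α x - a|])
  obtain ⟨S', hS'⟩ := exists_mulOp (b := fun x => signedSqrt (α x - a) * b x)
    (((Real.measurable_sign.comp hV).mul hf).mul hb) fun x => by
      rw [abs_mul, abs_of_pos (hb0 x), ← div_eq_mul_inv, div_le_one (hpos x)]
      linarith [abs_signedSqrt_le (α x - a)]
  refine map_mem_closure (f := fun x => (x, K x)) (by fun_prop)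
    (denseRange_mulOp (fun x => (hb0 x).ne') hS x) ?_
  rintro _ ⟨g, rfl⟩
  have hw : S' g =ᵐ[volume] fun x => (signedSqrt (α x - a) : ℂ) * S g x := by
    filter_upwards [hS g, hS' g] with x h1 h2
    rw [h1, h2]
    push_cast
    ring
  exact ⟨S' g, hw, hK _ _ hw⟩

end ResolventTraces

/-! ### The square root of the coupling -/

section Main

open ContinuousLinearMap (adjoint)

theorem self_eq_sqrt_mul_sign_mul_sqrt (v : ℝ) : v = √|v| * (Real.sign v * √|v|) := by
  rw [mul_left_comm, Real.mul_self_sqrt (abs_nonneg v)]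
  rcases lt_trichotomy v 0 with h | rfl | h
  · rw [Real.sign_of_neg h, abs_of_neg h]
    ring
  · simp
  · rw [Real.sign_of_pos h, abs_of_pos h, one_mul]

theorem abs_sign_le_one (v : ℝ) : |Real.sign v| ≤ 1 := by
  rcases Real.sign_apply_eq v with h | h | h <;> rw [h] <;> norm_num

/-- Multiplication by the square root of the coupling after the trace. -/
theorem exists_sqrt_mul_trace {d₁ : ℝ} (d₂ : ℝ) (hd : 0 < d₁) {V : ℝ → ℝ} (hV : Measurable V)
    {ε : ℝ} (hε : 0 < ε) (h1 : MemLp V (ENNReal.ofReal (1 + ε)) volume)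
    (h2 : Integrable (fun x => |x| * V x) volume) :
    ∃ (N : ℕ → FormSpace d₁ d₂ →L[ℂ] L2Line) (M : FormSpace d₁ d₂ →L[ℂ] L2Line) (c C r : ℝ),
      0 ≤ r ∧ r < 1 ∧ (∀ j, HSBound (N j) c) ∧ (∀ j, ‖N j‖ ≤ C * r ^ j) ∧ HasSum N M ∧
      ∀ u, M u =ᵐ[volume] fun x => ((√|V x| : ℝ) : ℂ) * traceL d₁ d₂ u x := by
  have hp : (1 : ENNReal) ≤ ENNReal.ofReal (1 + ε) := by
    rw [← ENNReal.ofReal_one]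
    exact ENNReal.ofReal_le_ofReal (by linarith)
  have hVi := integrable_of_memLp_of_weighted hV hp h1 h2
  -- Half of the Hölder exponent, since W a^θ enters squared.
  have hθ : 0 < (1 - 1 / (1 + ε)) / 2 := by
    have : 1 / (1 + ε) < 1 := by
      rw [div_lt_one (by linarith)]
      linarith
    linarith
  refine exists_mul_trace hd (Real.continuous_sqrt.measurable.comp hV.abs)
    (I := √(∫⁻ x, ‖V x‖ₑ).toReal)
    (W := √(eLpNorm V (ENNReal.ofReal (1 + ε)) volume).toReal)
    (Real.sqrt_nonneg _) ?_ (Real.sqrt_nonneg _) hθ fun a ha u => ?_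
  · simp only [enorm_sqrt_abs_sq]
    rw [Real.sq_sqrt ENNReal.toReal_nonneg, ENNReal.ofReal_toReal hVi.2.ne]
  · simp only [enorm_sqrt_abs_sq]
    rw [mul_pow, Real.sq_sqrt ENNReal.toReal_nonneg, ← Real.rpow_natCast, ← Real.rpow_mul ha.le,
      Nat.cast_ofNat, div_mul_cancel₀ _ two_ne_zero]
    exact lintegral_Icc_le hε h1 ha u

end Main

end DoubleGuide

end

/-! ### The Birman-Schwinger principle for the double guide -/

open DoubleGuide in
theorem corollary3p4 (d₁ d₂ : ℝ) (hd₁ : 0 < d₁) (hd₂ : 0 < d₂)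
    (α : ℝ → ℝ) (hα : Measurable α) (α₀ ε : ℝ) (hε : 0 < ε)
    (ha1 : MemLp (fun x => α x - α₀) (ENNReal.ofReal (1 + ε)) volume)
    (ha2 : Integrable (fun x => |x| * (α x - α₀)) volume) :
    ∃ K : ℂ → L2Line →L[ℂ] L2Line,
      (∀ k ∈ admissible d₁ d₂ α₀, ∀ K', IsBirmanSchwinger d₁ d₂ α α₀ k K' ↔ K' = K k) ∧
      (∀ k ∈ admissible d₁ d₂ α₀, IsHilbertSchmidt (K k)) ∧
      (∃ κ₀ > 0, ∀ κ : ℝ, κ₀ ≤ κ →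
        Complex.I * κ ∈ admissible d₁ d₂ α₀ ∧ IsUnit (1 + K (Complex.I * κ))) ∧
      (∀ k ∈ admissible d₁ d₂ α₀,
        Module.rank ℂ (kerSub (ham d₁ d₂ α) (k ^ 2)) =
          Module.rank ℂ (LinearMap.ker ((1 + K k : L2Line →L[ℂ] L2Line) : L2Line →ₗ[ℂ] L2Line))) ∧
      (∀ k ∈ admissible d₁ d₂ α₀,
        k ^ 2 ∈ discSpec (ham d₁ d₂ α) ↔ (-1 : ℂ) ∈ discSpecBdd (K k)) := by
  have hV : Measurable fun x => α x - α₀ := hα.sub_const α₀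
  obtain ⟨N, M, c, C, r, hr0, hr1, hN, hN', hNM, hM⟩ := exists_sqrt_mul_trace d₂ hd₁ hV hε ha1 ha2
  obtain ⟨σ, hσ⟩ := exists_mulOp (Real.measurable_sign.comp hV) fun x => abs_sign_le_one _
  have hσs : ∀ u v, inner ℂ (σ u) v = inner ℂ u (σ v) := fun u v => inner_mulOp (hσ u) (hσ v)
  let j := embL d₁ d₂
  let A₀ := constForm d₁ d₂ α₀
  have hj : Function.Injective j := embL_injective hd₁
  have hMc : IsCompactOperator M := HSBound.isCompactOperator_of_hasSum hN hNM
  -- Taking adjoints is continuous and preserves Hilbert-Schmidt bounds, so M* is again a sum of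
  -- Hilbert-Schmidt operators.
  have hMc' : IsCompactOperator (ContinuousLinearMap.adjoint M) :=
    HSBound.isCompactOperator_of_hasSum (fun i => (hN i).adjoint)
      (hNM.map (ContinuousLinearMap.adjoint (𝕜 := ℂ) (E := FormSpace d₁ d₂) (F := L2Line))
        (LinearIsometryEquiv.continuous _))
  have hK : ∀ z, IsCompactOperator (bsOp j A₀ M σ z) := fun z => hMc.comp_clm _
  have hF₀ : IsFormOperator (hamConst d₁ d₂ α₀) j A₀ := isFormOperator_hamConst hd₁ α₀
  have hF : IsFormOperator (ham d₁ d₂ α) j (pertOp A₀ M σ) :=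
    isFormOperator_ham_pertOp hd₁ (fun x => self_eq_sqrt_mul_sign_mul_sqrt (α x - α₀)) hM hσ
  -- With b = ‖σ‖ a single κ₀ serves both the unperturbed and the perturbed form.
  obtain ⟨κ₀, hκ₀, hκ⟩ := exists_isUnit_shiftOp hd₁ α₀ (norm_nonneg σ) hMc'
  have hre : ∀ u, (inner ℂ u (A₀ u)).re = ‖gradX d₁ d₂ u‖ ^ 2 + ‖gradY d₁ d₂ u‖ ^ 2 +
      α₀ * ‖traceL d₁ d₂ u‖ ^ 2 := fun u => by
    rw [inner_constForm, inner_self_eq_norm_sq_to_K, inner_self_eq_norm_sq_to_K,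
      inner_self_eq_norm_sq_to_K]
    simp only [RCLike.ofReal_eq_complex_ofReal]
    norm_cast
  have hu₀ : ∀ κ : ℝ, κ₀ ≤ κ → IsUnit (shiftOp j A₀ ((Complex.I * κ) ^ 2)) := fun κ h =>
    hκ κ h A₀ fun u => by
      rw [hre]
      linarith [mul_nonneg (norm_nonneg σ) (sq_nonneg ‖M u‖)]
  have hu : ∀ κ : ℝ, κ₀ ≤ κ → IsUnit (shiftOp j (pertOp A₀ M σ) ((Complex.I * κ) ^ 2)) :=
    fun κ h => hκ κ h _ fun u => by
      rw [inner_pertOp, Complex.add_re, hre]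
      have h1 : ‖inner ℂ (M u) (σ (M u))‖ ≤ ‖σ‖ * ‖M u‖ ^ 2 := by
        refine (norm_inner_le_norm _ _).trans ?_
        have := mul_le_mul_of_nonneg_left (σ.le_opNorm (M u)) (norm_nonneg (M u))
        nlinarith
      have h2 := (abs_le.1 (Complex.abs_re_le_norm (inner ℂ (M u) (σ (M u))))).1
      linarith
  have hadm : ∀ k ∈ admissible d₁ d₂ α₀, IsUnit (shiftOp j A₀ (k ^ 2)) := fun k hk =>
    (hF₀.mem_resSet_iff hj (hu₀ κ₀ le_rfl) _).1 hk.2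
  refine ⟨fun k => bsOp j A₀ M σ (k ^ 2), fun k hk K' => ?_, fun k _ => ?_,
    ⟨κ₀, hκ₀, fun κ h => ⟨⟨Or.inl ?_, ?_⟩, ?_⟩⟩, fun k hk => ?_, fun k hk => ?_⟩
  · have hT := isResolventTraceTrace_iff hd₁ (hadm k hk)
    have hcl := closure_sandwichGraph hα (a := α₀) (K := bsOp j A₀ M σ (k ^ 2))
      (T := traceL d₁ d₂ ∘L Ring.inverse (shiftOp j A₀ (k ^ 2)) ∘L
        ContinuousLinearMap.adjoint (traceL d₁ d₂))
      fun g w hw => by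
        rw [bsOp_apply, ← adjoint_traceL_apply_eq hM (hσ g) hw]
        exact hM _
    constructor
    · rintro ⟨T, hT', hc⟩
      rw [hT] at hT'
      subst hT'
      rw [hcl] at hc
      ext1 g
      have : (g, K' g) ∈ {p : L2Line × L2Line | p.2 = bsOp j A₀ M σ (k ^ 2) p.1} := by
        rw [hc]
        rfl
      exact this
    · rintro rfl
      exact ⟨_, (hT _).2 rfl, hcl⟩
  -- K is the Hilbert-Schmidt operator M X M* with X the inverse of the shifted form, followed on
  -- the right by the bounded σ.
  · obtain ⟨D, hD⟩ := exists_hsBound_conj hr0 hr1 hN hN' hNM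
      (Ring.inverse (shiftOp j A₀ (k ^ 2)))
    exact (hD.comp_right σ).isHilbertSchmidt
  · simpa using hκ₀.trans_le h
  · exact (hF₀.mem_resSet_iff hj (hu₀ κ₀ le_rfl) _).2 (hu₀ κ h)
  · exact isUnit_one_add_bsOp (hu₀ κ h) (hK _) (hu κ h)
  · exact hF.rank_kerSub hj (hadm k hk)
  · exact hF.mem_discSpec_iff hj (pertOp_symm M (constForm_symm α₀) hσs) hMc (hadm k hk)
      (hu κ₀ le_rfl)
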